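/- **Model.** Base stations (BSs) form a homogeneous Poisson point process $\Phi$ of intensity $\lambda>0$ on $\mathbb R^2$; the typical user is at the origin. The BSs carry independent marks. The link from a BS at $y$ to the origin is LOS with probability $p_{\rm LOS}\in[0,1]$ if $\|y\|\le D$ and NLOS otherwise; its path loss in dB is $\beta+10\alpha_j\log_{10}\|y\|+S_y$ with $S_y\sim N(0,\xi_j^2)$, where $j\in\{\mathrm L,\mathrm N\}$ is its state, $\alpha_j>0$, $\xi_j\ge 0$ (with $\xi_j=0$ meaning $S_y=0$), $D\ge 0$, and $L(y)>0$ denotes the path loss in linear scale. The link has $\eta_j\ge1$ paths with i.i.d. complex normal gains $\gamma_{1},\gamma_2,\dots$ (mean $0$, variance $1$), AOAs $\phi_{1},\phi_2,\dots$ i.i.d. with law $q_{\rm UE}$ on $\{1,\dots,N_{\rm UE}\}$ and AODs $\theta_{1},\theta_2,\dots$ i.i.d. with law $q_{\rm BS}$ on $\{1,\dots,N_{\rm BS}\}$. The BS at $y$ serves $U_y$ users, where $U_y$ has law $\tilde p$ on $\{0,1,2,\dots\}$, through beams with directions $\theta_{y,w}$, $w\le U_y$, i.i.d. with law $q_{\rm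 BS}$. The user is served by the BS $x$ of minimum path loss, and its combiner points at the AOA $\phi_0\sim q_{\rm UE}$ of the service link; apart from the dependence of the link state, the shadowing and the path loss on position and state just described, all these variables are independent, and $\phi_0$ is independent of the marked process. Fix $\rho_{\rm BS},\rho_{\rm UE}\in[0,1)$, transmit power $P>0$, and $G=P N_{\rm BS}N_{\rm UE}$. Let $\chi_{j,w}=a_j b_{j,w}$ with $a_j=1$ if $\phi_j=\phi_0$ and $a_j=\rho_{\rm UE}$ otherwise, $b_{j,w}=1$ if $\theta_j=\theta_{y,w}$ and $b_{j,w}=\rho_{\rm BS}$ otherwise. The out-of-cell interference is $$I_0=\sum_{y\in\Phi,\,y\ne x}I_{y,0},\qquad I_{y,0}=\frac{G}{L(y)\,\eta_y U_y}\sum_{w=1}^{U_y}\Big|\sum_{j=1}^{\eta_y}\gamma_j\chi_{j,w}\Big|^2 ,$$ where $\eta_y$ is the number of paths of the link of $y$, and $I_{y,0}=0$ if $U_y=0$. Put $L_{I_0,l}(s)=\mathbb E[e^{-sI_0}\mid L(x)=l]$, let $\Lambda_{\rm L},\Lambda_{\rm N}$ be the intensity measures on $(0,\infty)$ of the processes $\{L(y)\}$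 of path losses of the LOS and of the NLOS BSs, and $\Lambda=\Lambda_{\rm L}+\Lambda_{\rm N}$. We use $e^{-\infty}=0$, $1/0=\infty$, $1/\infty=0$ and $0\cdot\infty=0$. **Claim.** Let $s\ge 0$. For almost every $l$ with respect to the law of $L(x)$: 1. (Upper bound) $$L_{I_0,l}(s)\le\exp\Big(-(1-\tilde p(0))\int_l^\infty\frac{\Lambda(dt)}{1+(sGt^{-1}\rho_{\rm BS}^2\rho_{\rm UE}^2)^{-1}}\Big);$$ in particular, if $\tilde p(0)=0$ (every interfering BS serves at least one user), $$L_{I_0,l}(s)\le\exp\Big(-\int_l^\infty\frac{\Lambda(dt)}{1+(sGt^{-1}\rho_{\rm BS}^2\rho_{\rm UE}^2)^{-1}}\Big).$$ 2. (Lower bound) $$L_{I_0,l}(s)\ge\exp\Big(-\int_l^\infty(1-\mathbb E[\Psi_{t,\rm L}])\Lambda_{\rm L}(dt)\Big)\exp\Big(-\int_l^\infty(1-\mathbb E[\Psi_{t,\rm N}])\Lambda_{\rm N}(dt)\Big),$$ where $\Psi_{t,j}=\Psi_t(\eta_j,U)$, the expectation is over $U\sim\tilde p$, and $\Psi_t(\eta,U)$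 may be taken to be either of the following: (a) the expectation over the virtual angles $\mathbb E\big[(1+\frac{sGt^{-1}}{\eta U}\sum_{w=1}^{U}\sum_{j=1}^{\eta}\chi_{j,w}^2)^{-\eta}\big]$; (b) the explicit sum $$\Psi_t(\eta,U)=\sum_{i=1}^{N_{\rm UE}}\sum_{m=0}^{\eta}\binom{\eta}{m}q_{{\rm UE},i}^{m+1}(1-q_{{\rm UE},i})^{\eta-m}\sum_{k_1,\dots,k_U=1}^{N_{\rm BS}}\ \sum_{j_1,\dots,j_U=0}^{\eta}\ \prod_{n=1}^{U}\binom{\eta}{j_n}q_{{\rm BS},k_n}^{j_n+1}(1-q_{{\rm BS},k_n})^{\eta-j_n}$$ $$\times\Big(1+\frac{sGt^{-1}}{\eta U}\sum_{r=1}^{\eta}\Big(\sum_{n=1}^{U}\big(\rho_{\rm BS}^2+\mathbf 1(r\le j_n)(1-\rho_{\rm BS}^2)\big)\Big)\big(\rho_{\rm UE}^2+\mathbf 1(r\le m)(1-\rho_{\rm UE}^2)\big)\Big)^{-\eta}.$$ In both, $\Psi_t(\eta,0)=1$. 3. If $q_{\rm UE}$ and $q_{\rm BS}$ are uniform, the sum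 in (b) equals, for all $\eta,U,t$, $$\sum_{m=0}^{\eta}\binom{\eta}{m}\Big(\frac1{N_{\rm UE}}\Big)^{m}\Big(1-\frac1{N_{\rm UE}}\Big)^{\eta-m}\sum_{j_1,\dots,j_U=0}^{\eta}\ \prod_{n=1}^{U}\binom{\eta}{j_n}\Big(\frac1{N_{\rm BS}}\Big)^{j_n}\Big(1-\frac1{N_{\rm BS}}\Big)^{\eta-j_n}$$ $$\times\Big(1+\frac{sGt^{-1}}{\eta U}\sum_{r=1}^{\eta}\Big(\sum_{n=1}^{U}\big(\rho_{\rm BS}^2+\mathbf 1(r\le j_n)(1-\rho_{\rm BS}^2)\big)\Big)\big(\rho_{\rm UE}^2+\mathbf 1(r\le m)(1-\rho_{\rm UE}^2)\big)\Big)^{-\eta}$$ (the fraction $\frac{sGt^{-1}}{\eta U}$ being read as $0$ if $\eta U=0$ or $t=0$). -/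

import Mathlib

open MeasureTheory ProbabilityTheory
open scoped ENNReal NNReal

noncomputable section

namespace MmWave

/-- `e^{-x}` for `x ∈ [0,∞]`, with `e^{-∞} = 0`. -/
def expNeg (x : ℝ≥0∞) : ℝ≥0∞ := EReal.exp (-(x : EReal))

/-- Deterministic parameters of the network. Quantities that depend on the state of a link are
indexed by `Bool`, where `true` means LOS and `false` means NLOS. -/
structure Params (NBS NUE : ℕ) where
  /-- BS density -/
  lam : ℝ
  /-- reference path loss (dB) at one metre -/
  beta : ℝ
  /-- path loss exponents -/
  alpha : Bool → ℝ
  /-- shadowing standard deviations (dB) -/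
  xi : Bool → ℝ≥0
  /-- LOS probability of a link of length at most `D` -/
  pLOS : ℝ
  /-- LOS radius -/
  D : ℝ
  /-- number of paths of a link -/
  eta : Bool → ℕ
  /-- transmit power -/
  power : ℝ
  /-- sidelobe parameter at the BSs -/
  rhoBS : ℝ
  /-- sidelobe parameter at the users -/
  rhoUE : ℝ
  /-- distribution of a quantized virtual AOD -/
  qBS : PMF (Fin NBS)
  /-- distribution of a quantized virtual AOA -/
  qUE : PMF (Fin NUE)
  /-- distribution of the number of users scheduled by an interfering BS -/
  pU : PMF ℕ
  lam_pos : 0 < lam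
  alpha_pos : ∀ b, 0 < alpha b
  pLOS_nonneg : 0 ≤ pLOS
  pLOS_le_one : pLOS ≤ 1
  D_nonneg : 0 ≤ D
  eta_pos : ∀ b, 1 ≤ eta b
  power_pos : 0 < power
  rhoBS_nonneg : 0 ≤ rhoBS
  rhoBS_lt_one : rhoBS < 1
  rhoUE_nonneg : 0 ≤ rhoUE
  rhoUE_lt_one : rhoUE < 1

/-- The location and the link state of a BS: position, LOS/NLOS indicator, shadowing (dB). -/
abbrev Link : Type := EuclideanSpace ℝ (Fin 2) × Bool × ℝ

/-- The virtual angles of an interfering BS: the AOA and the AOD of each path of its channel to the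
typical user, and the direction of the beam serving each of its own users. -/
abbrev Angles (NBS NUE : ℕ) : Type := (ℕ → Fin NUE) × (ℕ → Fin NBS) × (ℕ → Fin NBS)

/-- A BS together with its marks: its link, the number of users that it serves, the small scale
fading of each path, and the virtual angles. Only the first `η` paths and the first `U` beams of
the sequences are used. -/
abbrev Station (NBS NUE : ℕ) : Type := Link × ℕ × (ℕ → ℂ) × Angles NBS NUE

variable {NBS NUE : ℕ}

/-- Path loss in dB to the origin. -/
def pathLossDB (c : Params NBS NUE) (y : Link) : ℝ :=
  c.beta + 10 * c.alpha y.2.1 * Real.logb 10 ‖y.1‖ + y.2.2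

/-- Path loss to the origin in linear scale. -/
def pathLoss (c : Params NBS NUE) (y : Link) : ℝ := (10 : ℝ) ^ (pathLossDB c y / 10)

/-- The array gain `G = P · N_BS · N_UE`. -/
def gain (c : Params NBS NUE) : ℝ := c.power * NBS * NUE

/-- The probability that a link from position `x` to the origin is in state `b`. -/
def stateProb (c : Params NBS NUE) (b : Bool) (x : EuclideanSpace ℝ (Fin 2)) : ℝ≥0∞ :=
  if ‖x‖ ≤ c.D then ENNReal.ofReal (if b then c.pLOS else 1 - c.pLOS)
  else (if b then 0 else 1)

/-- Intensity of the BSs in link state `b`, marked with their state and their shadowing. -/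
def linkIntensity (c : Params NBS NUE) (b : Bool) : Measure Link :=
  ((ENNReal.ofReal c.lam • (volume : Measure (EuclideanSpace ℝ (Fin 2)))).withDensity
    (stateProb c b)).prod ((Measure.dirac b).prod (gaussianReal 0 (c.xi b ^ 2)))

/-- The intensity measure `Λ_L` (`b = true`) or `Λ_N` (`b = false`) of the propagation process
`𝒩_L`, respectively `𝒩_N`, of path losses. -/
def lossIntensity (c : Params NBS NUE) (b : Bool) : Measure ℝ :=
  (linkIntensity c b).map (pathLoss c)

/-- The circularly symmetric complex normal law with zero mean and unit variance. -/
def complexNormal : Measure ℂ :=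
  ((gaussianReal 0 (1 / 2)).prod (gaussianReal 0 (1 / 2))).map (fun z : ℝ × ℝ => (⟨z.1, z.2⟩ : ℂ))

/-- All virtual angles are independent. -/
def anglesLaw (c : Params NBS NUE) : Measure (Angles NBS NUE) :=
  (Measure.infinitePi fun _ : ℕ => c.qUE.toMeasure).prod
    ((Measure.infinitePi fun _ : ℕ => c.qBS.toMeasure).prod
      (Measure.infinitePi fun _ : ℕ => c.qBS.toMeasure))

/-- The intensity measure of the independently marked homogeneous Poisson process of BSs. -/
def stationIntensity (c : Params NBS NUE) : Measure (Station NBS NUE) :=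
  (linkIntensity c true + linkIntensity c false).prod
    (c.pU.toMeasure.prod
      ((Measure.infinitePi fun _ : ℕ => complexNormal).prod (anglesLaw c)))

/-- The number of points of the configuration `S` in `A`. -/
def count {E : Type*} (S A : Set E) : ℕ∞ := (S ∩ A).encard

/-- The random set `Φ` is a (simple) Poisson point process with intensity measure `Λ`. -/
structure IsPoissonProcess {Ω E : Type*} [MeasurableSpace Ω] [MeasurableSpace E]
    (P : Measure Ω) (Φ : Ω → Set E) (Λ : Measure E) : Prop where
  measurable_count : ∀ A, MeasurableSet A → Measurable fun ω => count (Φ ω) A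
  law_count : ∀ A, MeasurableSet A → Λ A ≠ ∞ →
    P.map (fun ω => count (Φ ω) A) =
      (poissonMeasure (Λ A).toNNReal).map (fun n : ℕ => (n : ℕ∞))
  indep_count : ∀ (n : ℕ) (A : Fin n → Set E), (∀ i, MeasurableSet (A i)) →
    Pairwise (fun i j => Disjoint (A i) (A j)) →
    iIndepFun (fun i ω => count (Φ ω) (A i)) P

/-- The sigma-algebra on the sample space generated by a point process. -/
abbrev processSigma {Ω E : Type*} [MeasurableSpace E] (Φ : Ω → Set E) : MeasurableSpace Ω :=
  ⨆ A : {A : Set E // MeasurableSet A},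
    MeasurableSpace.comap (fun ω => count (Φ ω) A.1) inferInstance

/-- The random objects of the model: the marked Poisson process `Φ` of BSs, and the AOA `φ₀`
(virtual angle) of the service link, at which the typical user points its combiner. -/
structure IsNetwork {Ω : Type*} [MeasurableSpace Ω] (P : Measure Ω) (c : Params NBS NUE)
    (Φ : Ω → Set (Station NBS NUE)) (φ₀ : Ω → Fin NUE) : Prop where
  poisson : IsPoissonProcess P Φ (stationIntensity c)
  measurable_aoa : Measurable φ₀
  law_aoa : P.map φ₀ = c.qUE.toMeasure
  indep : Indep (processSigma Φ) (MeasurableSpace.comap φ₀ inferInstance) P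

/-- Inner product of two beam steering vectors with sidelobe parameter `ρ`. -/
def beamInner {n : ℕ} (ρ : ℝ) (θ₁ θ₂ : Fin n) : ℝ := if θ₁ = θ₂ then 1 else ρ

/-- `χ_{j,w}`: the gain of path `j` against the beam serving user `w`. -/
def chi (c : Params NBS NUE) (φ₀ : Fin NUE) (a : Angles NBS NUE) (j w : ℕ) : ℝ :=
  beamInner c.rhoUE φ₀ (a.1 j) * beamInner c.rhoBS (a.2.1 j) (a.2.2 w)

/-- The interference power `I_{y,0} = G / (L η U) · ∑_w |∑_j γ_j χ_{j,w}|²` received at the origin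
from the BS `y`; it is `0` if the BS serves nobody. -/
def power (c : Params NBS NUE) (φ₀ : Fin NUE) (y : Station NBS NUE) : ℝ :=
  gain c / (pathLoss c y.1 * c.eta y.1.2.1 * y.2.1) *
    ∑ w ∈ Finset.range y.2.1,
      ‖∑ j ∈ Finset.range (c.eta y.1.2.1), y.2.2.1 j * (chi c φ₀ y.2.2.2 j w : ℂ)‖ ^ 2

/-- `x` is a BS of the configuration `S` with minimum path loss to the origin. -/
def IsServing (c : Params NBS NUE) (S : Set (Station NBS NUE)) (x : Station NBS NUE) : Prop :=
  x ∈ S ∧ ∀ y ∈ S, pathLoss c x.1 ≤ pathLoss c y.1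

open Classical in
/-- The BS serving the typical user at the origin: the one with minimum path loss (it exists and is
unique almost surely). If no BS attains the minimum, the value is `none`. -/
def servingBS (c : Params NBS NUE) (S : Set (Station NBS NUE)) : Option (Station NBS NUE) :=
  if h : ∃ x, IsServing c S x then some h.choose else none

/-- The path loss on the service link. -/
def servingLoss (c : Params NBS NUE) (S : Set (Station NBS NUE)) : ℝ :=
  match servingBS c S with
  | some x => pathLoss c x.1
  | none => 0

/-- The total out-of-cell interference power `I₀ = ∑_{y ∈ Φ, y ≠ x} I_{y,0}` at the origin. -/
def interference (c : Params NBS NUE) (S : Set (Station NBS NUE)) (φ₀ : Fin NUE) : ℝ≥0∞ :=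
  ∑' y : {y : Station NBS NUE // y ∈ S ∧ some y ≠ servingBS c S}, ENNReal.ofReal (power c φ₀ y.1)

/-- The conditional Laplace functional `L_{I₀,l}(s) = E[exp(-s I₀) | L(x,0) = l]`, through the
regular conditional distribution of `I₀` given the path loss on the service link. -/
def condLaplace {Ω : Type*} [MeasurableSpace Ω] (P : Measure Ω) [IsFiniteMeasure P]
    (c : Params NBS NUE) (Φ : Ω → Set (Station NBS NUE)) (φ₀ : Ω → Fin NUE) (s l : ℝ) : ℝ≥0∞ :=
  ∫⁻ i, expNeg (ENNReal.ofReal s * i)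
    ∂(condDistrib (fun ω => interference c (Φ ω) (φ₀ ω)) (fun ω => servingLoss c (Φ ω)) P l)

/-- `∫_l^∞ Λ(dt) / (1 + (s G t⁻¹ ρ_BS² ρ_UE²)⁻¹)` with `Λ = Λ_L + Λ_N`. -/
def upperExponent (c : Params NBS NUE) (s l : ℝ) : ℝ≥0∞ :=
  ∫⁻ t in Set.Ici l,
    1 / (1 + (ENNReal.ofReal (s * gain c * t⁻¹ * c.rhoBS ^ 2 * c.rhoUE ^ 2))⁻¹)
    ∂(lossIntensity c true + lossIntensity c false)

/-- The explicit combinatorial sum `Ψ_t`, for links with `η` paths and `U` scheduled users. -/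
def Psi (c : Params NBS NUE) (s : ℝ) (η U : ℕ) (t : ℝ) : ℝ :=
  ∑ i : Fin NUE, ∑ m ∈ Finset.range (η + 1),
    (η.choose m : ℝ) * (c.qUE i).toReal ^ (m + 1) * (1 - (c.qUE i).toReal) ^ (η - m) *
    ∑ k : Fin U → Fin NBS, ∑ j : Fin U → Fin (η + 1),
      (∏ n : Fin U, (η.choose (j n) : ℝ) * (c.qBS (k n)).toReal ^ ((j n : ℕ) + 1) *
        (1 - (c.qBS (k n)).toReal) ^ (η - (j n : ℕ))) *
      ((1 + s * gain c * t⁻¹ / (η * U) * ∑ r ∈ Finset.Icc 1 η,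
        (∑ n : Fin U, (c.rhoBS ^ 2 + if r ≤ (j n : ℕ) then 1 - c.rhoBS ^ 2 else 0)) *
        (c.rhoUE ^ 2 + if r ≤ m then 1 - c.rhoUE ^ 2 else 0)) ^ η)⁻¹

/-- The simplified form of `Ψ_t` for equiprobable virtual angles. -/
def PsiUniform (c : Params NBS NUE) (s : ℝ) (η U : ℕ) (t : ℝ) : ℝ :=
  ∑ m ∈ Finset.range (η + 1),
    (η.choose m : ℝ) * (1 / (NUE : ℝ)) ^ m * (1 - 1 / (NUE : ℝ)) ^ (η - m) *
    ∑ j : Fin U → Fin (η + 1),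
      (∏ n : Fin U, (η.choose (j n) : ℝ) * (1 / (NBS : ℝ)) ^ (j n : ℕ) *
        (1 - 1 / (NBS : ℝ)) ^ (η - (j n : ℕ))) *
      ((1 + s * gain c * t⁻¹ / (η * U) * ∑ r ∈ Finset.Icc 1 η,
        (∑ n : Fin U, (c.rhoBS ^ 2 + if r ≤ (j n : ℕ) then 1 - c.rhoBS ^ 2 else 0)) *
        (c.rhoUE ^ 2 + if r ≤ m then 1 - c.rhoUE ^ 2 else 0)) ^ η)⁻¹

/-- The expectation over the virtual angles of
`(1 + s G t⁻¹ / (η U) · ∑_w ∑_j χ_{j,w}²)^{-η}`. -/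
def PsiCS (c : Params NBS NUE) (s : ℝ) (η U : ℕ) (t : ℝ) : ℝ :=
  ∫ z, ((1 + s * gain c * t⁻¹ / (η * U) *
      ∑ w ∈ Finset.range U, ∑ j ∈ Finset.range η, chi c z.1 z.2 j w ^ 2) ^ η)⁻¹
    ∂(c.qUE.toMeasure.prod (anglesLaw c))

/-- `∫_l^∞ (1 - E[Ψ_t]) Λ_b(dt)`, the expectation being over the number of scheduled users. -/
def lowerExponent (c : Params NBS NUE) (Ψ : ℕ → ℕ → ℝ → ℝ) (b : Bool) (l : ℝ) : ℝ≥0∞ :=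
  ∫⁻ t in Set.Ici l,
    ENNReal.ofReal (1 - ∑' u : ℕ, (c.pU u).toReal * Ψ (c.eta b) u t) ∂(lossIntensity c b)

end MmWave

end

noncomputable section

namespace MmWave

open Filter Topology

section

/-! ### The map `x ↦ e^{-x}` on `[0,∞]` -/

/-! Seen from its first point, a Poisson process stays Poisson. Given that the smallest path loss
equals `l`, the remaining BSs form a marked Poisson process with the original intensity restricted
to path losses beyond `l`, and the AOA `φ₀` is independent of everything. Hence the conditional
Laplace functional is the `qUE`-average over `i` of `laplaceBeyond c s i l`, the exponential of
minus the integral of `1 - e^{-sI}` over that region (`IsNetwork.condLaplace_ae_eq`). The tools are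
the Laplace functional of a Poisson process (`IsPoissonProcess.laplace`), its version beyond the
first point (`laplace_beyond_first`), and the almost sure absence of ties
(`IsPoissonProcess.ae_injOn`). Integrating out the marks turns the exponent into integrals of
`markDeficit` against `Λ_L` and `Λ_N` (`laplaceBeyond_eq`).

Upper bound: the power of a BS is an average over its `U` beams, so by convexity of the exponential
its Laplace transform is at most the average of those of single beams. For one beam, `∑ γ_j χ_j` is
complex normal with variance `∑ χ_j²`, which gives `1/(1 + v ∑ χ_j²)`; then every `χ²` is bounded
below by `ρ_BS² ρ_UE²` (`lintegral_fading_le`). BSs without users account for the factor `1 -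
p̃(0)`.

Lower bound: Jensen moves the average over `φ₀` inside the exponential (`expNeg_sum_mul_le`).
Cauchy-Schwarz bounds `|∑ γ_j χ_j|²` by `∑ χ_j² · ∑ |γ_j|²`, and `∑ |γ_j|²` has Laplace transform
`(1 + v)^{-η}` (`le_lintegral_fading`). This gives version (a), `PsiCS`.

Version (b) follows from `Psi ≤ PsiCS`. Both are mixtures of functions `(1 + C x)^{-η}`, each itself
a mixture of exponentials, so it is enough to compare Laplace transforms of the angle gain
(`sum_mul_inv_pow_le`). Two changes lead from the true gain to the explicit one, and both lower the
transform: AODs shared by the `U` beams are replaced by independent copies (power mean inequality),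
and the paths aligned at the BS and at the user are made to overlap as much as possible
(`sum_aligned_le`). For uniform angles the sums over directions cancel against factors `1/N`. -/

lemma expNeg_zero : expNeg 0 = 1 := by simp [expNeg]

lemma expNeg_top : expNeg ∞ = 0 := by simp [expNeg]

lemma expNeg_antitone : Antitone expNeg := fun _ _ h =>
  EReal.exp_monotone (EReal.neg_le_neg_iff.2 (EReal.coe_ennreal_le_coe_ennreal_iff.2 h))

lemma expNeg_le_one (x : ℝ≥0∞) : expNeg x ≤ 1 := by
  simpa [expNeg_zero] using expNeg_antitone (zero_le (a := x))

lemma expNeg_ne_top (x : ℝ≥0∞) : expNeg x ≠ ∞ :=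
  ((expNeg_le_one x).trans_lt ENNReal.one_lt_top).ne

lemma continuous_expNeg : Continuous expNeg :=
  ENNReal.continuous_exp.comp (continuous_neg.comp continuous_coe_ennreal_ereal)

lemma measurable_expNeg : Measurable expNeg := continuous_expNeg.measurable

lemma expNeg_coe (x : ℝ≥0) : expNeg x = ENNReal.ofReal (Real.exp (-x)) := by
  have : (-(((x : ℝ≥0∞)) : EReal)) = ((-(x : ℝ) : ℝ) : EReal) := by
    rw [EReal.coe_neg]; rfl
  rw [expNeg, this, EReal.exp_coe]

lemma expNeg_ofReal {x : ℝ} (hx : 0 ≤ x) :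
    expNeg (ENNReal.ofReal x) = ENNReal.ofReal (Real.exp (-x)) := by
  rw [ENNReal.ofReal, expNeg_coe, Real.coe_toNNReal x hx]

lemma expNeg_add (x y : ℝ≥0∞) : expNeg (x + y) = expNeg x * expNeg y := by
  induction x with
  | top => simp [expNeg_top]
  | coe x =>
    induction y with
    | top => simp [expNeg_top]
    | coe y =>
      rw [← ENNReal.coe_add, expNeg_coe, expNeg_coe, expNeg_coe,
        ← ENNReal.ofReal_mul (Real.exp_pos _).le, ← Real.exp_add]
      congr 2
      push_cast
      ring

lemma expNeg_sum {ι : Type*} (t : Finset ι) (f : ι → ℝ≥0∞) :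
    expNeg (∑ i ∈ t, f i) = ∏ i ∈ t, expNeg (f i) := by
  classical
  induction t using Finset.induction_on with
  | empty => simp [expNeg_zero]
  | insert i t hi ih => rw [Finset.sum_insert hi, Finset.prod_insert hi, expNeg_add, ih]

lemma expNeg_nat_mul (n : ℕ) (x : ℝ≥0∞) : expNeg (n * x) = expNeg x ^ n := by
  induction n with
  | zero => simp [expNeg_zero]
  | succ n ih => rw [Nat.cast_succ, add_mul, expNeg_add, ih, one_mul, pow_succ]

/-! ### Point measures -/

variable {E Ω : Type*} [MeasurableSpace E] [MeasurableSpace Ω]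

/-- The counting measure of a configuration. -/
def pointMeasure (S : Set E) : Measure E := Measure.sum fun y : S => Measure.dirac (y : E)

lemma lintegral_pointMeasure (S : Set E) {f : E → ℝ≥0∞} (hf : Measurable f) :
    ∫⁻ y, f y ∂(pointMeasure S) = ∑' y : S, f y := by
  rw [pointMeasure, lintegral_sum_measure]
  exact tsum_congr fun y => lintegral_dirac' _ hf

lemma pointMeasure_apply (S : Set E) {A : Set E} (hA : MeasurableSet A) :
    pointMeasure S A = (count S A : ℕ∞) := by
  rw [pointMeasure, Measure.sum_apply _ hA]
  simp_rw [Measure.dirac_apply' _ hA]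
  rw [tsum_subtype S (A.indicator 1), Set.indicator_indicator, ← tsum_subtype (S ∩ A) 1, count]
  exact ENNReal.tsum_set_one _

lemma measurable_pointMeasure_of_count {Ω' : Type*} {m : MeasurableSpace Ω'} {Φ : Ω' → Set E}
    (h : ∀ A, MeasurableSet A → Measurable[m] fun ω => count (Φ ω) A) :
    Measurable[m] fun ω => pointMeasure (Φ ω) := by
  refine Measure.measurable_of_measurable_coe _ fun A hA => ?_
  simp_rw [pointMeasure_apply _ hA]
  exact (measurable_from_top (f := fun n : ℕ∞ => (n : ℝ≥0∞))).comp (h A hA)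

/-- The Poisson generating function `E z^N = e^{-r(1-z)}` at `z = e^{-x}`. Allowing `x = ∞`, that is
`z = 0`, includes the void probability. -/
lemma lintegral_expNeg_poisson (r : ℝ≥0) (x : ℝ≥0∞) :
    ∫⁻ n : ℕ, expNeg (x * n) ∂(poissonMeasure r) = expNeg (r * (1 - expNeg x)) := by
  obtain ⟨p, hp, hp0, hp1⟩ : ∃ p : ℝ, expNeg x = ENNReal.ofReal p ∧ 0 ≤ p ∧ p ≤ 1 := by
    refine ⟨(expNeg x).toReal, (ENNReal.ofReal_toReal (expNeg_ne_top x)).symm,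
      ENNReal.toReal_nonneg, ?_⟩
    exact ENNReal.toReal_le_of_le_ofReal zero_le_one (by simpa using expNeg_le_one x)
  have h1 : (r : ℝ≥0∞) * (1 - expNeg x) = ENNReal.ofReal (r * (1 - p)) := by
    rw [hp, ENNReal.ofReal_mul r.coe_nonneg, ENNReal.ofReal_sub _ hp0, ENNReal.ofReal_one,
      ENNReal.ofReal_coe_nnreal]
  have hs : HasSum (fun n : ℕ => p ^ n * (Real.exp (-r) * (r : ℝ) ^ n / n.factorial))
      (Real.exp (-(r * (1 - p)))) := by
    have := (NormedSpace.expSeries_div_hasSum_exp (p * r : ℝ)).mul_left (Real.exp (-r))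
    rw [← Real.exp_eq_exp_ℝ, ← Real.exp_add] at this
    rw [show -(r : ℝ) + p * r = -(r * (1 - p)) by ring] at this
    have he : (fun n : ℕ => p ^ n * (Real.exp (-r) * (r : ℝ) ^ n / n.factorial)) =
        fun n : ℕ => Real.exp (-r) * ((p * r) ^ n / n.factorial) := by
      ext n
      rw [mul_pow]
      ring
    rwa [he]
  rw [lintegral_countable', h1, expNeg_ofReal (mul_nonneg r.coe_nonneg (by linarith)),
    ← hs.tsum_eq, ENNReal.ofReal_tsum_of_nonneg (fun n => by positivity) hs.summable]
  refine tsum_congr fun n => ?_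
  rw [mul_comm x, expNeg_nat_mul, poissonMeasure_singleton, hp, ENNReal.ofReal_mul (by positivity),
    ENNReal.ofReal_pow hp0]

/-! ### Laplace functional of a Poisson process. -/

namespace IsPoissonProcess

variable {P : Measure Ω} {Φ : Ω → Set E} {Λ : Measure E}

lemma measurable_pointMeasure (h : IsPoissonProcess P Φ Λ) :
    Measurable fun ω => pointMeasure (Φ ω) :=
  measurable_pointMeasure_of_count h.measurable_count

lemma lintegral_expNeg_count (h : IsPoissonProcess P Φ Λ) {A : Set E} (hA : MeasurableSet A)
    (hfin : Λ A ≠ ∞) (x : ℝ≥0∞) :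
    ∫⁻ ω, expNeg (x * (count (Φ ω) A : ℕ∞)) ∂P = expNeg ((1 - expNeg x) * Λ A) := by
  have h1 := lintegral_map (μ := P) (f := fun n : ℕ∞ => expNeg (x * (n : ℝ≥0∞)))
    measurable_from_top (h.measurable_count A hA)
  rw [← h1, h.law_count A hA hfin, lintegral_map measurable_from_top measurable_from_top]
  simp only [ENat.toENNReal_coe]
  rw [lintegral_expNeg_poisson, ENNReal.coe_toNNReal hfin, mul_comm]

/-- The counts on the level sets are independent Poisson variables, so the expectation factorises.
The level set of `0` contributes a factor `1` and may have infinite intensity. -/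
lemma laplace_simpleFunc [IsProbabilityMeasure P] (h : IsPoissonProcess P Φ Λ)
    (f : SimpleFunc E ℝ≥0∞) (hf : ∀ x, x ≠ 0 → Λ (f ⁻¹' {x}) ≠ ∞) :
    ∫⁻ ω, expNeg (∫⁻ y, f y ∂(pointMeasure (Φ ω))) ∂P =
      expNeg (∫⁻ y, 1 - expNeg (f y) ∂Λ) := by
  have hR : ∫⁻ y, 1 - expNeg (f y) ∂Λ = ∑ x ∈ f.range, (1 - expNeg x) * Λ (f ⁻¹' {x}) := by
    rw [← SimpleFunc.map_lintegral, ← SimpleFunc.lintegral_eq_lintegral]; rfl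
  have hind : iIndepFun (fun (x : f.range) ω => count (Φ ω) (f ⁻¹' {(x : ℝ≥0∞)})) P := by
    have := h.indep_count _ (fun i => f ⁻¹' {((Fintype.equivFin f.range).symm i : ℝ≥0∞)})
      (fun i => f.measurableSet_fiber _) (fun i j hij => by
        refine Disjoint.preimage _ (Set.disjoint_singleton.2 fun he => hij ?_)
        exact (Fintype.equivFin f.range).symm.injective (Subtype.ext he))
    have h2 := this.precomp (Fintype.equivFin f.range).injective
    simpa only [Function.comp_def, Equiv.symm_apply_apply] using h2
  have hind' := hind.comp (fun x n => expNeg ((x : ℝ≥0∞) * ((n : ℕ∞) : ℝ≥0∞)))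
    (fun x => measurable_from_top)
  have hprod := lintegral_prod_eq_prod_lintegral_of_indepFun Finset.univ _ hind'
    (fun x => measurable_from_top.comp (h.measurable_count _ (f.measurableSet_fiber _)))
  calc ∫⁻ ω, expNeg (∫⁻ y, f y ∂(pointMeasure (Φ ω))) ∂P
      = ∫⁻ ω, ∏ x : f.range, expNeg ((x : ℝ≥0∞) * (count (Φ ω) (f ⁻¹' {(x : ℝ≥0∞)}) : ℕ∞)) ∂P := by
        refine lintegral_congr fun ω => ?_
        rw [← expNeg_sum, SimpleFunc.lintegral_eq_lintegral, SimpleFunc.lintegral,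
          ← Finset.sum_coe_sort f.range]
        simp_rw [pointMeasure_apply _ (f.measurableSet_fiber _)]
    _ = ∏ x : f.range, expNeg ((1 - expNeg x) * Λ (f ⁻¹' {(x : ℝ≥0∞)})) := by
        refine hprod.trans (Finset.prod_congr rfl fun x _ => ?_)
        by_cases hx : (x : ℝ≥0∞) = 0
        · simp [hx, expNeg_zero]
        · exact h.lintegral_expNeg_count (f.measurableSet_fiber _) (hf _ hx) _
    _ = _ := by
        rw [hR, expNeg_sum, ← Finset.prod_coe_sort f.range]

/-- The Laplace functional of a Poisson point process. -/
theorem laplace [IsProbabilityMeasure P] [SigmaFinite Λ] (h : IsPoissonProcess P Φ Λ)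
    {f : E → ℝ≥0∞} (hf : Measurable f) :
    ∫⁻ ω, expNeg (∫⁻ y, f y ∂(pointMeasure (Φ ω))) ∂P = expNeg (∫⁻ y, 1 - expNeg (f y) ∂Λ) := by
  -- Cutting off to the spanning sets gives every nonzero level set finite intensity, while `g n`
  -- still increases to `f` pointwise.
  set g : ℕ → SimpleFunc E ℝ≥0∞ := fun n => (SimpleFunc.eapprox f n).restrict (spanningSets Λ n)
    with hg
  have hgapp : ∀ n y, g n y = (spanningSets Λ n).indicator (SimpleFunc.eapprox f n) y :=
    fun n y => SimpleFunc.restrict_apply _ (measurableSet_spanningSets Λ n) y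
  have hmono : ∀ y, Monotone fun n => g n y := fun y n m hnm => by
    simp only [hgapp]
    refine (Set.indicator_le_indicator_of_subset (monotone_spanningSets Λ hnm)
      (fun _ => zero_le) y).trans (Set.indicator_le_indicator ?_)
    exact SimpleFunc.monotone_eapprox f hnm y
  have hlim : ∀ y, Tendsto (fun n => g n y) atTop (𝓝 (f y)) := fun y => by
    refine (SimpleFunc.tendsto_eapprox hf y).congr' ?_
    filter_upwards [eventually_ge_atTop (spanningSetsIndex Λ y)] with n hn
    rw [hgapp, Set.indicator_of_mem (mem_spanningSets_of_index_le Λ y hn)]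
  have hfin : ∀ n x, x ≠ 0 → Λ (g n ⁻¹' {x}) ≠ ∞ := fun n x hx => by
    refine ((measure_mono ?_).trans_lt (measure_spanningSets_lt_top Λ n)).ne
    intro y hy
    by_contra hc
    rw [Set.mem_preimage, Set.mem_singleton_iff, hgapp, Set.indicator_of_notMem hc] at hy
    exact hx hy.symm
  have hint : ∀ μ : Measure E, Tendsto (fun n => ∫⁻ y, g n y ∂μ) atTop (𝓝 (∫⁻ y, f y ∂μ)) :=
    fun μ => lintegral_tendsto_of_tendsto_of_monotone (fun n => (g n).measurable.aemeasurable)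
      (Eventually.of_forall hmono) (Eventually.of_forall hlim)
  have hN := h.measurable_pointMeasure
  have hL : Tendsto (fun n => ∫⁻ ω, expNeg (∫⁻ y, g n y ∂(pointMeasure (Φ ω))) ∂P) atTop
      (𝓝 (∫⁻ ω, expNeg (∫⁻ y, f y ∂(pointMeasure (Φ ω))) ∂P)) := by
    refine tendsto_lintegral_of_dominated_convergence (fun _ => 1) (fun n => ?_)
      (fun n => Eventually.of_forall fun ω => expNeg_le_one _) (by simp)
      (Eventually.of_forall fun ω => (continuous_expNeg.tendsto _).comp (hint _))
    exact measurable_expNeg.comp ((Measure.measurable_lintegral (g n).measurable).comp hN)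
  have hRt : Tendsto (fun n => expNeg (∫⁻ y, 1 - expNeg (g n y) ∂Λ)) atTop
      (𝓝 (expNeg (∫⁻ y, 1 - expNeg (f y) ∂Λ))) := by
    refine (continuous_expNeg.tendsto _).comp ?_
    refine lintegral_tendsto_of_tendsto_of_monotone (fun n => ?_) (Eventually.of_forall ?_)
      (Eventually.of_forall fun y => ?_)
    · exact (measurable_const.sub (measurable_expNeg.comp (g n).measurable)).aemeasurable
    · exact fun y n m hnm => tsub_le_tsub_left (expNeg_antitone (hmono y hnm)) _
    · exact ENNReal.Tendsto.sub tendsto_const_nhds ((continuous_expNeg.tendsto _).comp (hlim y))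
        (Or.inl ENNReal.one_ne_top)
  refine tendsto_nhds_unique hL (hRt.congr fun n => ?_)
  exact (h.laplace_simpleFunc (g n) (hfin n)).symm

end IsPoissonProcess

end

section

/-! ### Dyadic approximation from above -/

/-- The least point of the grid `r + 2^{-n} ℕ` that is at least `x`. -/
def dyadicCeil (r : ℝ) (n : ℕ) (x : ℝ) : ℝ := r + ⌈(x - r) * 2 ^ n⌉₊ / 2 ^ n

lemma le_dyadicCeil (r : ℝ) (n : ℕ) (x : ℝ) : x ≤ dyadicCeil r n x := by
  have h2 : (0 : ℝ) < 2 ^ n := by positivity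
  have := Nat.le_ceil ((x - r) * 2 ^ n)
  rw [dyadicCeil, ← sub_le_iff_le_add', le_div_iff₀ h2]
  exact this

lemma dyadicCeil_le {r x : ℝ} (hx : r < x) (n : ℕ) : dyadicCeil r n x ≤ x + (1 / 2) ^ n := by
  have h2 : (0 : ℝ) < 2 ^ n := by positivity
  have := Nat.ceil_lt_add_one (mul_pos (sub_pos.2 hx) h2).le
  have h3 : (⌈(x - r) * 2 ^ n⌉₊ : ℝ) / 2 ^ n ≤ x - r + (1 / 2) ^ n := by
    rw [div_le_iff₀ h2, add_mul, ← mul_pow]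
    norm_num
    exact this.le
  rw [dyadicCeil]
  linarith

lemma antitone_dyadicCeil (r x : ℝ) : Antitone fun n => dyadicCeil r n x := by
  refine antitone_nat_of_succ_le fun n => ?_
  have h2 : (0 : ℝ) < 2 ^ n := by positivity
  have h : (⌈(x - r) * 2 ^ (n + 1)⌉₊ : ℝ) ≤ 2 * ⌈(x - r) * 2 ^ n⌉₊ := by
    have : ⌈(x - r) * 2 ^ (n + 1)⌉₊ ≤ 2 * ⌈(x - r) * 2 ^ n⌉₊ := by
      rw [Nat.ceil_le]
      push_cast
      have := Nat.le_ceil ((x - r) * 2 ^ n)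
      rw [pow_succ]
      linarith
    exact_mod_cast this
  simp only [dyadicCeil]
  rw [pow_succ] at h
  rw [add_le_add_iff_left, pow_succ, div_le_div_iff₀ (by positivity) h2]
  nlinarith

lemma iUnion_dyadicCeil_lt {E : Type*} (κ : E → ℝ) {r x : ℝ} (hx : r < x) :
    ⋃ n, {y | dyadicCeil r n x < κ y} = {y | x < κ y} := by
  ext y
  simp only [Set.mem_iUnion, Set.mem_ofPred_eq]
  refine ⟨fun ⟨n, hn⟩ => (le_dyadicCeil r n x).trans_lt hn, fun h => ?_⟩
  obtain ⟨n, hn⟩ := exists_pow_lt_of_lt_one (sub_pos.2 h) (by norm_num : (1 / 2 : ℝ) < 1)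
  exact ⟨n, (dyadicCeil_le hx n).trans_lt (by linarith)⟩

variable {E Ω : Type*} [MeasurableSpace E] [MeasurableSpace Ω]

/-- Approximating `x` from above makes the regions increase to `{x < κ}`, so continuity from below
applies and no integrability of `f` is needed. -/
lemma tendsto_lintegral_dyadicCeil {μ : Measure E} {κ : E → ℝ} (hκ : Measurable κ)
    (f : E → ℝ≥0∞) {r x : ℝ} (hx : r < x) :
    Tendsto (fun n => ∫⁻ y in {y | dyadicCeil r n x < κ y}, f y ∂μ) atTop
      (𝓝 (∫⁻ y in {y | x < κ y}, f y ∂μ)) := by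
  have hm : ∀ a : ℝ, MeasurableSet {y | a < κ y} := fun a => measurableSet_lt measurable_const hκ
  simp_rw [← withDensity_apply f (hm _)]
  rw [← iUnion_dyadicCeil_lt κ hx]
  exact tendsto_measure_iUnion_atTop fun n m hnm y hy =>
    lt_of_le_of_lt (antitone_dyadicCeil r x hnm) hy

lemma dyadic_cell_eq (r x : ℝ) (n k : ℕ) :
    (r + k / 2 ^ n < x ∧ x ≤ r + (k + 1 : ℕ) / 2 ^ n) ↔ ⌈(x - r) * 2 ^ n⌉₊ = k + 1 := by
  have h2 : (0 : ℝ) < 2 ^ n := by positivity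
  rw [Nat.ceil_eq_iff k.succ_ne_zero, ← lt_sub_iff_add_lt', div_lt_iff₀ h2,
    ← sub_le_iff_le_add', le_div_iff₀ h2]
  simp

lemma iUnion_dyadic_cell {Ω : Type*} (L : Ω → ℝ) (r : ℝ) (n : ℕ) :
    ⋃ k : ℕ, {ω | ⌈(L ω - r) * 2 ^ n⌉₊ = k + 1} = {ω | r < L ω} := by
  have h2 : (0 : ℝ) < 2 ^ n := by positivity
  ext ω
  simp only [Set.mem_iUnion, Set.mem_ofPred_eq]
  have : r < L ω ↔ 0 < ⌈(L ω - r) * 2 ^ n⌉₊ := by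
    rw [Nat.ceil_pos, mul_pos_iff_of_pos_right h2, sub_pos]
  rw [this]
  refine ⟨fun ⟨k, hk⟩ => by omega, fun h => ⟨⌈(L ω - r) * 2 ^ n⌉₊ - 1, by omega⟩⟩

/-! ### The first point of a Poisson process -/

section FirstPoint

variable {Q : Measure Ω} {N : Ω → Measure E} {Λ : Measure E} {κ : E → ℝ} {L : Ω → ℝ}

/-- A test function equal to `∞` on `{κ ≤ u}` turns `e^{-∫ g dN}` into the indicator of the void
event `{u < L}`. Since `u ≤ v`, it lives on a region disjoint from `{v < κ}`, and the exponent
splits. -/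
lemma setLIntegral_void
    (hLap : ∀ g : E → ℝ≥0∞, Measurable g → ∫⁻ ω, expNeg (∫⁻ y, g y ∂N ω) ∂Q =
      Q Set.univ * expNeg (∫⁻ y, 1 - expNeg (g y) ∂Λ))
    (hκ : Measurable κ) (hL : Measurable L)
    (hLN : ∀ᵐ ω ∂Q, ∀ u, u < L ω ↔ N ω {y | κ y ≤ u} = 0)
    {f : E → ℝ≥0∞} (hf : Measurable f) {u v : ℝ} (huv : u ≤ v) :
    ∫⁻ ω in {ω | u < L ω}, expNeg (∫⁻ y in {y | v < κ y}, f y ∂N ω) ∂Q =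
      Q {ω | u < L ω} * expNeg (∫⁻ y in {y | v < κ y}, 1 - expNeg (f y) ∂Λ) := by
  have hA : ∀ a : ℝ, MeasurableSet {y | κ y ≤ a} := fun a => measurableSet_le hκ measurable_const
  have hB : ∀ a : ℝ, MeasurableSet {y | a < κ y} := fun a => measurableSet_lt measurable_const hκ
  have hU : ∀ a : ℝ, MeasurableSet {ω | a < L ω} := fun a => measurableSet_lt measurable_const hL
  have key : ∀ f : E → ℝ≥0∞, Measurable f →
      ∫⁻ ω in {ω | u < L ω}, expNeg (∫⁻ y in {y | v < κ y}, f y ∂N ω) ∂Q =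
      Q Set.univ * (expNeg (Λ {y | κ y ≤ u}) *
        expNeg (∫⁻ y in {y | v < κ y}, 1 - expNeg (f y) ∂Λ)) := by
    intro f hf
    have h := hLap (fun y => {y | κ y ≤ u}.indicator (fun _ => ∞) y + {y | v < κ y}.indicator f y)
      ((measurable_const.indicator (hA u)).add (hf.indicator (hB v)))
    have h1 : ∀ y, 1 - expNeg ({y | κ y ≤ u}.indicator (fun _ => ∞) y + {y | v < κ y}.indicator f y)
        = {y | κ y ≤ u}.indicator (fun _ => 1) y +
          {y | v < κ y}.indicator (fun y => 1 - expNeg (f y)) y := by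
      intro y
      by_cases hy : κ y ≤ u
      · have : ¬ v < κ y := by linarith
        simp [hy, this, expNeg_top]
      · by_cases hy' : v < κ y <;> simp [hy, hy', expNeg_zero]
    simp_rw [h1] at h
    rw [lintegral_add_left (measurable_const.indicator (hA u)), lintegral_indicator (hA u),
      lintegral_indicator (hB v), expNeg_add] at h
    rw [setLIntegral_one] at h
    rw [← h, ← lintegral_indicator (hU u)]
    refine lintegral_congr_ae (hLN.mono fun ω hω => ?_)
    dsimp only
    rw [lintegral_add_left (measurable_const.indicator (hA u)), lintegral_indicator (hA u),
      lintegral_indicator (hB v), expNeg_add, setLIntegral_const]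
    by_cases hu : u < L ω
    · rw [Set.indicator_of_mem (by exact hu), (hω u).1 hu]
      simp [expNeg_zero]
    · rw [Set.indicator_of_notMem (by exact hu), ENNReal.top_mul (fun h0 => hu ((hω u).2 h0)),
        expNeg_top, zero_mul]
  -- The case `f = 0` identifies the void factor as the mass of `{u < L}`.
  have h0 := key (fun _ => 0) measurable_const
  simp only [lintegral_const, expNeg_zero, zero_mul, tsub_self, mul_one, Measure.restrict_apply,
    MeasurableSet.univ, Set.univ_inter, one_mul] at h0
  rw [key f hf, h0, mul_assoc]

/-- The difference of the void formulas at `u` and at `v`: the same exponential factor appears in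
both because the region of integration is fixed at `v`. Finiteness of `Q` permits the cancellation.
-/
lemma setLIntegral_cell [IsFiniteMeasure Q]
    (hLap : ∀ g : E → ℝ≥0∞, Measurable g → ∫⁻ ω, expNeg (∫⁻ y, g y ∂N ω) ∂Q =
      Q Set.univ * expNeg (∫⁻ y, 1 - expNeg (g y) ∂Λ))
    (hκ : Measurable κ) (hL : Measurable L)
    (hLN : ∀ᵐ ω ∂Q, ∀ u, u < L ω ↔ N ω {y | κ y ≤ u} = 0)
    {f : E → ℝ≥0∞} (hf : Measurable f) {u v : ℝ} (huv : u ≤ v) :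
    ∫⁻ ω in {ω | u < L ω ∧ L ω ≤ v}, expNeg (∫⁻ y in {y | v < κ y}, f y ∂N ω) ∂Q =
      Q {ω | u < L ω ∧ L ω ≤ v} * expNeg (∫⁻ y in {y | v < κ y}, 1 - expNeg (f y) ∂Λ) := by
  have hU : ∀ a : ℝ, MeasurableSet {ω | a < L ω} := fun a => measurableSet_lt measurable_const hL
  have hset : {ω | u < L ω} = {ω | u < L ω ∧ L ω ≤ v} ∪ {ω | v < L ω} := by
    ext ω
    simp only [Set.mem_union, Set.mem_ofPred_eq]
    constructor
    · intro h
      rcases le_or_gt (L ω) v with h' | h'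
      · exact Or.inl ⟨h, h'⟩
      · exact Or.inr h'
    · rintro (h | h)
      · exact h.1
      · exact huv.trans_lt h
  have hdis : Disjoint {ω | u < L ω ∧ L ω ≤ v} {ω | v < L ω} :=
    Set.disjoint_left.2 fun ω h h' => not_lt.2 h.2 h'
  have h1 := setLIntegral_void hLap hκ hL hLN hf huv
  have h2 := setLIntegral_void hLap hκ hL hLN hf (le_refl v)
  rw [hset, lintegral_union (hU v) hdis, measure_union hdis (hU v), add_mul, h2] at h1
  exact (ENNReal.add_left_inj (ENNReal.mul_ne_top (measure_ne_top _ _) (expNeg_ne_top _))).1 h1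

/-- The points of a Poisson process beyond its first point form, given the position `L ω` of the
latter, a Poisson process. Here `κ` is the coordinate in which the points are ordered. -/
theorem laplace_beyond_first [IsFiniteMeasure Q] (hN : Measurable N)
    (hLap : ∀ g : E → ℝ≥0∞, Measurable g → ∫⁻ ω, expNeg (∫⁻ y, g y ∂N ω) ∂Q =
      Q Set.univ * expNeg (∫⁻ y, 1 - expNeg (g y) ∂Λ))
    (hκ : Measurable κ) (hL : Measurable L)
    (hLN : ∀ᵐ ω ∂Q, ∀ u, u < L ω ↔ N ω {y | κ y ≤ u} = 0)
    {f : E → ℝ≥0∞} (hf : Measurable f) (r : ℝ) :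
    ∫⁻ ω in {ω | r < L ω}, expNeg (∫⁻ y in {y | L ω < κ y}, f y ∂N ω) ∂Q =
      ∫⁻ ω in {ω | r < L ω}, expNeg (∫⁻ y in {y | L ω < κ y}, 1 - expNeg (f y) ∂Λ) ∂Q := by
  have hB : ∀ a : ℝ, MeasurableSet {y | a < κ y} := fun a => measurableSet_lt measurable_const hκ
  have hU : MeasurableSet {ω | r < L ω} := measurableSet_lt measurable_const hL
  have hceil : ∀ n : ℕ, Measurable fun ω => ⌈(L ω - r) * 2 ^ n⌉₊ := fun n =>
    ((hL.sub_const r).mul_const _).nat_ceil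
  have hX : ∀ n, Measurable fun ω =>
      expNeg (∫⁻ y in {y | dyadicCeil r n (L ω) < κ y}, f y ∂N ω) := fun n => by
    have : Measurable fun p : ℕ × Ω =>
        expNeg (∫⁻ y in {y | r + p.1 / 2 ^ n < κ y}, f y ∂N p.2) := by
      refine measurable_from_prod_countable_right fun k => measurable_expNeg.comp ?_
      simp_rw [← lintegral_indicator (hB _)]
      exact (Measure.measurable_lintegral (hf.indicator (hB _))).comp hN
    have h3 := this.comp ((hceil n).prodMk measurable_id)
    simpa only [Function.comp_def, dyadicCeil, id] using h3
  have hF : ∀ n, Measurable fun ω =>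
      expNeg (∫⁻ y in {y | dyadicCeil r n (L ω) < κ y}, 1 - expNeg (f y) ∂Λ) := fun n => by
    have : Measurable fun k : ℕ =>
        expNeg (∫⁻ y in {y | r + k / 2 ^ n < κ y}, 1 - expNeg (f y) ∂Λ) := measurable_from_top
    have h3 := this.comp (hceil n)
    simpa only [Function.comp_def, dyadicCeil] using h3
  -- On a cell of the grid the rounded value of `L` is the constant right endpoint, so the region is
  -- no longer random and the cell formula applies.
  have hstep : ∀ n, ∫⁻ ω in {ω | r < L ω},
      expNeg (∫⁻ y in {y | dyadicCeil r n (L ω) < κ y}, f y ∂N ω) ∂Q =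
      ∫⁻ ω in {ω | r < L ω},
        expNeg (∫⁻ y in {y | dyadicCeil r n (L ω) < κ y}, 1 - expNeg (f y) ∂Λ) ∂Q := by
    intro n
    have hmeas : ∀ k : ℕ, MeasurableSet {ω | ⌈(L ω - r) * 2 ^ n⌉₊ = k + 1} := fun k =>
      hceil n (measurableSet_singleton (k + 1))
    have hdisj : Pairwise (Function.onFun Disjoint
        fun k : ℕ => {ω | ⌈(L ω - r) * 2 ^ n⌉₊ = k + 1}) := fun i j hij =>
      Set.disjoint_left.2 fun ω (h : _ = _) (h' : _ = _) => hij (by omega)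
    rw [← iUnion_dyadic_cell L r n, lintegral_iUnion hmeas hdisj, lintegral_iUnion hmeas hdisj]
    refine tsum_congr fun k => ?_
    have hcell : {ω | ⌈(L ω - r) * 2 ^ n⌉₊ = k + 1} =
        {ω | r + k / 2 ^ n < L ω ∧ L ω ≤ r + (k + 1 : ℕ) / 2 ^ n} := by
      ext ω
      exact (dyadic_cell_eq r (L ω) n k).symm
    have heq : ∀ ω ∈ {ω | ⌈(L ω - r) * 2 ^ n⌉₊ = k + 1},
        dyadicCeil r n (L ω) = r + (k + 1 : ℕ) / 2 ^ n := fun ω (hω : _ = _) => by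
      rw [dyadicCeil, hω]
    have hle : r + (k : ℝ) / 2 ^ n ≤ r + (k + 1 : ℕ) / 2 ^ n := by
      push_cast
      gcongr
      linarith
    refine (setLIntegral_congr_fun (g := fun ω =>
        expNeg (∫⁻ y in {y | r + (k + 1 : ℕ) / 2 ^ n < κ y}, f y ∂N ω)) (hmeas k)
        (fun ω hω => by simp only [heq ω hω])).trans (Eq.trans ?_
      (setLIntegral_congr_fun (f := fun _ =>
        expNeg (∫⁻ y in {y | r + (k + 1 : ℕ) / 2 ^ n < κ y}, 1 - expNeg (f y) ∂Λ)) (hmeas k)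
        (fun ω hω => by simp only [heq ω hω])))
    rw [setLIntegral_const, hcell, setLIntegral_cell hLap hκ hL hLN hf hle, mul_comm]
  have hlim1 : Tendsto (fun n => ∫⁻ ω in {ω | r < L ω},
      expNeg (∫⁻ y in {y | dyadicCeil r n (L ω) < κ y}, f y ∂N ω) ∂Q) atTop
      (𝓝 (∫⁻ ω in {ω | r < L ω}, expNeg (∫⁻ y in {y | L ω < κ y}, f y ∂N ω) ∂Q)) := by
    refine tendsto_lintegral_of_dominated_convergence (fun _ => 1) hX
      (fun n => Eventually.of_forall fun ω => expNeg_le_one _)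
      (by simp) ?_
    filter_upwards [ae_restrict_mem hU] with ω hω
    exact (continuous_expNeg.tendsto _).comp (tendsto_lintegral_dyadicCeil hκ f hω)
  have hlim2 : Tendsto (fun n => ∫⁻ ω in {ω | r < L ω},
      expNeg (∫⁻ y in {y | dyadicCeil r n (L ω) < κ y}, 1 - expNeg (f y) ∂Λ) ∂Q) atTop
      (𝓝 (∫⁻ ω in {ω | r < L ω}, expNeg (∫⁻ y in {y | L ω < κ y}, 1 - expNeg (f y) ∂Λ) ∂Q)) := by
    refine tendsto_lintegral_of_dominated_convergence (fun _ => 1) hF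
      (fun n => Eventually.of_forall fun ω => expNeg_le_one _)
      (by simp) ?_
    filter_upwards [ae_restrict_mem hU] with ω hω
    exact (continuous_expNeg.tendsto _).comp (tendsto_lintegral_dyadicCeil hκ _ hω)
  exact tendsto_nhds_unique hlim1 (hlim2.congr fun n => (hstep n).symm)

/-- Law of the position of the first point. -/
lemma measure_lt_first
    (hLap : ∀ g : E → ℝ≥0∞, Measurable g → ∫⁻ ω, expNeg (∫⁻ y, g y ∂N ω) ∂Q =
      Q Set.univ * expNeg (∫⁻ y, 1 - expNeg (g y) ∂Λ))
    (hκ : Measurable κ) (hL : Measurable L)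
    (hLN : ∀ᵐ ω ∂Q, ∀ u, u < L ω ↔ N ω {y | κ y ≤ u} = 0) (u : ℝ) :
    Q {ω | u < L ω} = Q Set.univ * expNeg (Λ {y | κ y ≤ u}) := by
  have hA : MeasurableSet {y | κ y ≤ u} := measurableSet_le hκ measurable_const
  have h := hLap ({y | κ y ≤ u}.indicator fun _ => ∞) (measurable_const.indicator hA)
  have h1 : ∀ y, 1 - expNeg ({y | κ y ≤ u}.indicator (fun _ => ∞) y) =
      {y | κ y ≤ u}.indicator 1 y := fun y => by
    by_cases hy : κ y ≤ u <;> simp [hy, expNeg_top, expNeg_zero]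
  simp_rw [h1] at h
  rw [lintegral_indicator_one hA] at h
  rw [← h, ← lintegral_indicator_one (measurableSet_lt measurable_const hL)]
  refine lintegral_congr_ae (hLN.mono fun ω hω => ?_)
  dsimp only
  rw [lintegral_indicator hA, setLIntegral_const]
  by_cases hu : u < L ω
  · rw [Set.indicator_of_mem (by exact hu), (hω u).1 hu]
    simp [expNeg_zero]
  · rw [Set.indicator_of_notMem (by exact hu), ENNReal.top_mul (fun h0 => hu ((hω u).2 h0)),
      expNeg_top]

end FirstPoint

end

/-! ### Almost sure properties of a Poisson configuration. -/

section

variable {E Ω : Type*} [MeasurableSpace E] [MeasurableSpace Ω]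

namespace IsPoissonProcess

variable {P : Measure Ω} {Φ : Ω → Set E} {Λ : Measure E}

/-- From `e^{-r} ≥ 1 - r`: `1 - e^{-r}(1 + r) ≤ 1 - (1 - r)(1 + r) = r²`. -/
lemma measure_two_le_count_le (h : IsPoissonProcess P Φ Λ) {A : Set E} (hA : MeasurableSet A)
    (hfin : Λ A ≠ ∞) : P {ω | 2 ≤ count (Φ ω) A} ≤ Λ A ^ 2 := by
  have h1 : P {ω | 2 ≤ count (Φ ω) A} = poissonMeasure (Λ A).toNNReal {n | 2 ≤ n} := by
    have hm : MeasurableSet {n : ℕ∞ | 2 ≤ n} := MeasurableSet.of_discrete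
    have := congrArg (fun μ => μ {n : ℕ∞ | 2 ≤ n}) (h.law_count A hA hfin)
    simp only [Measure.map_apply (h.measurable_count A hA) hm,
      Measure.map_apply measurable_from_top hm] at this
    refine this.trans (congrArg _ ?_)
    ext n
    simp only [Set.mem_preimage, Set.mem_ofPred_eq]
    exact_mod_cast Iff.rfl
  set r := (Λ A).toNNReal
  have h2 : {n : ℕ | 2 ≤ n}ᶜ = {0} ∪ {1} := by
    ext n
    simp only [Set.mem_compl_iff, Set.mem_ofPred_eq, Set.mem_union, Set.mem_singleton_iff]
    omega
  have h3 : poissonMeasure r {n | 2 ≤ n} =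
      ENNReal.ofReal (1 - (Real.exp (-r) + Real.exp (-r) * r)) := by
    rw [← compl_compl {n : ℕ | 2 ≤ n}, prob_compl_eq_one_sub MeasurableSet.of_discrete, h2,
      measure_union (by simp) (measurableSet_singleton 1), poissonMeasure_singleton,
      poissonMeasure_singleton, ← ENNReal.ofReal_add (by positivity) (by positivity),
      ← ENNReal.ofReal_one, ← ENNReal.ofReal_sub _ (by positivity)]
    simp
  rw [h1, h3, ← ENNReal.coe_toNNReal hfin]
  have h4 : ((Λ A).toNNReal : ℝ≥0∞) ^ 2 = ENNReal.ofReal ((r : ℝ) ^ 2) := by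
    rw [ENNReal.ofReal_pow r.coe_nonneg, ENNReal.ofReal_coe_nnreal]
  rw [h4]
  refine ENNReal.ofReal_le_ofReal ?_
  have h5 := Real.add_one_le_exp (-(r : ℝ))
  nlinarith [r.coe_nonneg]

lemma ae_count_ne_top (h : IsPoissonProcess P Φ Λ) {A : Set E} (hA : MeasurableSet A)
    (hfin : Λ A ≠ ∞) : ∀ᵐ ω ∂P, count (Φ ω) A ≠ ⊤ := by
  have hm : MeasurableSet {n : ℕ∞ | n = ⊤} := MeasurableSet.of_discrete
  have := congrArg (fun μ => μ {n : ℕ∞ | n = ⊤}) (h.law_count A hA hfin)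
  simp only [Measure.map_apply (h.measurable_count A hA) hm,
    Measure.map_apply measurable_from_top hm] at this
  rw [ae_iff]
  simp only [not_not]
  refine this.trans ?_
  convert measure_empty (μ := poissonMeasure (Λ A).toNNReal)
  ext n
  simp

/-- The Laplace functional at the constant `∞` is the probability of an empty configuration, here
`e^{-∞} = 0`. -/
lemma ae_nonempty [IsProbabilityMeasure P] [SigmaFinite Λ] (h : IsPoissonProcess P Φ Λ)
    (hΛ : Λ Set.univ = ∞) : ∀ᵐ ω ∂P, (Φ ω).Nonempty := by
  have h1 := h.laplace (f := fun _ => ∞) measurable_const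
  simp only [lintegral_const, expNeg_top, tsub_zero, hΛ, one_mul] at h1
  rw [lintegral_eq_zero_iff] at h1
  · refine h1.mono fun ω hω => ?_
    by_contra hc
    rw [Set.not_nonempty_iff_eq_empty] at hc
    simp [hc, pointMeasure_apply, count, expNeg_zero] at hω
  · refine measurable_expNeg.comp (Measurable.const_mul ?_ _)
    exact (Measure.measurable_coe MeasurableSet.univ).comp h.measurable_pointMeasure

/-- The dyadic cell of `y` shrinks into the null set `{κ = κ y}`; the finite mass of `{κ ≤ R}`
dominates. -/
lemma tendsto_lintegral_measure_cell {κ : E → ℝ} (hκ : Measurable κ) {R : ℝ}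
    (hfin : Λ {y | κ y ≤ R} ≠ ∞) (hatom : ∀ t, Λ {y | κ y = t} = 0) :
    Tendsto (fun n : ℕ => ∫⁻ y in {y | κ y ≤ R},
      Λ {z | κ z ≤ R ∧ ⌊κ z * 2 ^ n⌋ = ⌊κ y * 2 ^ n⌋} ∂Λ) atTop (𝓝 0) := by
  have hA : MeasurableSet {y | κ y ≤ R} := measurableSet_le hκ measurable_const
  have hlim : ∀ y, Tendsto (fun n : ℕ => Λ {z | κ z ≤ R ∧ ⌊κ z * 2 ^ n⌋ = ⌊κ y * 2 ^ n⌋}) atTop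
      (𝓝 0) := by
    intro y
    have h1 : Tendsto (fun n : ℕ => Λ {z | κ z ≤ R ∧ |κ z - κ y| ≤ (1 / 2) ^ n}) atTop
        (𝓝 (Λ (⋂ n : ℕ, {z | κ z ≤ R ∧ |κ z - κ y| ≤ (1 / 2) ^ n}))) := by
      refine tendsto_measure_iInter_atTop (fun n => ?_) (fun n m hnm z hz => ?_) ⟨0, ?_⟩
      · exact (hA.inter (measurableSet_le (continuous_abs.measurable.comp (hκ.sub_const (κ y)))
        measurable_const)).nullMeasurableSet
      · exact ⟨hz.1, hz.2.trans (pow_le_pow_of_le_one (by norm_num) (by norm_num) hnm)⟩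
      · exact ((measure_mono fun z hz => hz.1).trans_lt hfin.lt_top).ne
    have h0 : Λ (⋂ n : ℕ, {z | κ z ≤ R ∧ |κ z - κ y| ≤ (1 / 2) ^ n}) = 0 := by
      refine measure_mono_null (fun z hz => ?_) (hatom (κ y))
      rw [Set.mem_iInter] at hz
      by_contra hc
      have hpos : 0 < |κ z - κ y| := abs_pos.2 (sub_ne_zero.2 hc)
      obtain ⟨n, hn⟩ := exists_pow_lt_of_lt_one hpos (by norm_num : (1 / 2 : ℝ) < 1)
      exact absurd (hz n).2 (not_le.2 hn)
    rw [h0] at h1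
    refine tendsto_of_tendsto_of_tendsto_of_le_of_le tendsto_const_nhds h1
      (fun n => zero_le) fun n => measure_mono fun z hz => ⟨hz.1, ?_⟩
    have h2 : (0 : ℝ) < 2 ^ n := by positivity
    have h3 := (Int.abs_sub_lt_one_of_floor_eq_floor hz.2).le
    rw [← sub_mul, abs_mul, abs_of_pos h2] at h3
    rw [one_div, inv_pow]
    rwa [← one_div, le_div_iff₀ h2]
  have := tendsto_lintegral_of_dominated_convergence (μ := Λ.restrict {y | κ y ≤ R})
    (F := fun n y => Λ {z | κ z ≤ R ∧ ⌊κ z * 2 ^ n⌋ = ⌊κ y * 2 ^ n⌋}) (f := fun _ => 0)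
    (fun _ => Λ {y | κ y ≤ R}) (fun n => ?_)
    (fun n => Eventually.of_forall fun y => measure_mono fun z hz => hz.1) ?_
    (Eventually.of_forall hlim)
  · simpa using this
  · have h1 : Measurable fun k : ℤ => Λ {z | κ z ≤ R ∧ ⌊κ z * 2 ^ n⌋ = k} := measurable_from_top
    have h2 : Measurable fun y => ⌊κ y * 2 ^ n⌋ := (hκ.mul_const _).floor
    exact h1.comp h2
  · rw [setLIntegral_const]
    exact ENNReal.mul_ne_top hfin hfin

/-- Almost surely, no two points of a Poisson process have the same value of a coordinate with
locally finite and diffuse intensity. -/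
theorem ae_injOn (h : IsPoissonProcess P Φ Λ) {κ : E → ℝ} (hκ : Measurable κ)
    (hfin : ∀ R, Λ {y | κ y ≤ R} ≠ ∞) (hatom : ∀ t, Λ {y | κ y = t} = 0) :
    ∀ᵐ ω ∂P, Set.InjOn κ (Φ ω) := by
  have key : ∀ R : ℕ, ∀ᵐ ω ∂P, Set.InjOn κ (Φ ω ∩ {y | κ y ≤ R}) := by
    intro R
    have hA : MeasurableSet {y | κ y ≤ R} := measurableSet_le hκ measurable_const
    rw [ae_iff]
    refine le_antisymm (ge_of_tendsto' (tendsto_lintegral_measure_cell hκ (hfin R) hatom)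
      fun n => ?_) zero_le
    have hfl : Measurable fun y => ⌊κ y * 2 ^ n⌋ := (hκ.mul_const _).floor
    have hB : ∀ k : ℤ, MeasurableSet {y | ⌊κ y * 2 ^ n⌋ = k} := fun k =>
      hfl (measurableSet_singleton k)
    have hC : ∀ k : ℤ, MeasurableSet {y | κ y ≤ R ∧ ⌊κ y * 2 ^ n⌋ = k} := fun k => hA.inter (hB k)
    have hCfin : ∀ k : ℤ, Λ {y | κ y ≤ R ∧ ⌊κ y * 2 ^ n⌋ = k} ≠ ∞ := fun k =>
      ((measure_mono fun z hz => hz.1).trans_lt (hfin R).lt_top).ne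
    -- Two points with equal coordinate share a cell at every scale. The union bound leaves the sum
    -- of the squared cell masses, which is the integral over `y` of the mass of the cell of `y`.
    calc P {ω | ¬ Set.InjOn κ (Φ ω ∩ {y | κ y ≤ R})}
        ≤ P (⋃ k : ℤ, {ω | 2 ≤ count (Φ ω) {y | κ y ≤ R ∧ ⌊κ y * 2 ^ n⌋ = k}}) := by
          refine measure_mono fun ω hω => ?_
          rw [Set.mem_ofPred_eq, Set.InjOn] at hω
          push Not at hω
          obtain ⟨y, hy, z, hz, hyz, hne⟩ := hω
          rw [Set.mem_iUnion]
          refine ⟨⌊κ y * 2 ^ n⌋, ?_⟩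
          rw [Set.mem_ofPred_eq, count]
          rw [← one_add_one_eq_two]
          refine Order.add_one_le_of_lt (Set.one_lt_encard_iff.2
            ⟨y, z, ⟨hy.1, hy.2, rfl⟩, ⟨hz.1, hz.2, by rw [hyz]⟩, hne⟩)
      _ ≤ ∑' k : ℤ, P {ω | 2 ≤ count (Φ ω) {y | κ y ≤ R ∧ ⌊κ y * 2 ^ n⌋ = k}} :=
          measure_iUnion_le _
      _ ≤ ∑' k : ℤ, Λ {y | κ y ≤ R ∧ ⌊κ y * 2 ^ n⌋ = k} ^ 2 :=
          ENNReal.tsum_le_tsum fun k => h.measure_two_le_count_le (hC k) (hCfin k)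
      _ = ∫⁻ y in {y | κ y ≤ R}, Λ {z | κ z ≤ R ∧ ⌊κ z * 2 ^ n⌋ = ⌊κ y * 2 ^ n⌋} ∂Λ := by
          have hU : {y | κ y ≤ R} = ⋃ k : ℤ, {y | κ y ≤ R ∧ ⌊κ y * 2 ^ n⌋ = k} := by
            ext y
            simp
          have hdisj : Pairwise (Function.onFun Disjoint
              fun k : ℤ => {y | κ y ≤ R ∧ ⌊κ y * 2 ^ n⌋ = k}) := fun i j hij =>
            Set.disjoint_left.2 fun y hy hy' => hij (hy.2.symm.trans hy'.2)
          conv_rhs => rw [hU, lintegral_iUnion hC hdisj]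
          refine tsum_congr fun k => ?_
          rw [setLIntegral_congr_fun (g := fun _ => Λ {z | κ z ≤ R ∧ ⌊κ z * 2 ^ n⌋ = k}) (hC k)
            (fun y hy => by simp only [hy.2]), setLIntegral_const, sq]
  filter_upwards [ae_all_iff.2 key] with ω hω y hy z hz hyz
  obtain ⟨R, hR⟩ := exists_nat_ge (κ y)
  exact hω R ⟨hy, hR⟩ ⟨hz, by rw [Set.mem_ofPred_eq, ← hyz]; exact hR⟩ hyz

end IsPoissonProcess

/-! ### The serving base station -/

variable {NBS NUE : ℕ} {c : Params NBS NUE} {S : Set (Station NBS NUE)}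

lemma exists_isServing (hne : S.Nonempty)
    (hfin : ∀ R : ℕ, count S {y | pathLoss c y.1 ≤ R} ≠ ⊤) : ∃ x, IsServing c S x := by
  obtain ⟨y, hy⟩ := hne
  obtain ⟨R, hR⟩ := exists_nat_ge (pathLoss c y.1)
  have hf : (S ∩ {y | pathLoss c y.1 ≤ R}).Finite := Set.encard_ne_top_iff.1 (hfin R)
  obtain ⟨x, hx, hmin⟩ := Set.exists_min_image _ (fun y => pathLoss c y.1) hf ⟨y, hy, hR⟩
  refine ⟨x, hx.1, fun z hz => ?_⟩
  rcases le_total (pathLoss c z.1) R with h | h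
  · exact hmin z ⟨hz, h⟩
  · exact (hx.2 : _ ≤ (R : ℝ)).trans h

lemma servingBS_eq (hinj : Set.InjOn (fun y : Station NBS NUE => pathLoss c y.1) S)
    {x : Station NBS NUE} (hx : IsServing c S x) : servingBS c S = some x := by
  have h : ∃ x, IsServing c S x := ⟨x, hx⟩
  rw [servingBS, dif_pos h]
  exact congrArg some (hinj h.choose_spec.1 hx.1
    (le_antisymm (h.choose_spec.2 x hx.1) (hx.2 _ h.choose_spec.1)))

lemma servingLoss_eq (hinj : Set.InjOn (fun y : Station NBS NUE => pathLoss c y.1) S)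
    {x : Station NBS NUE} (hx : IsServing c S x) : servingLoss c S = pathLoss c x.1 := by
  rw [servingLoss, servingBS_eq hinj hx]

/-- Expresses the serving loss through void events, the only form in which the point process theory
and measurability can reach it. -/
lemma lt_servingLoss_iff (hinj : Set.InjOn (fun y : Station NBS NUE => pathLoss c y.1) S)
    (hex : ∃ x, IsServing c S x) (u : ℝ) :
    u < servingLoss c S ↔ count S {y | pathLoss c y.1 ≤ u} = 0 := by
  obtain ⟨x, hx⟩ := hex
  rw [servingLoss_eq hinj hx, count, Set.encard_eq_zero]
  constructor
  · intro h
    ext y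
    simp only [Set.mem_inter_iff, Set.mem_ofPred_eq, Set.mem_empty_iff_false, iff_false, not_and,
      not_le]
    exact fun hy => h.trans_le (hx.2 y hy)
  · intro h
    by_contra hc
    exact (Set.ext_iff.1 h x).1 ⟨hx.1, not_lt.1 hc⟩

/-- Without ties, being different from the serving BS means having strictly larger path loss. The
interference thus becomes an integral against the point measure over a region that depends only on
the serving loss. -/
lemma interference_eq (hinj : Set.InjOn (fun y : Station NBS NUE => pathLoss c y.1) S)
    (hex : ∃ x, IsServing c S x) (φ₀ : Fin NUE)
    (hκ : Measurable fun y : Station NBS NUE => pathLoss c y.1) (hpow : Measurable (power c φ₀)) :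
    interference c S φ₀ = ∫⁻ y in {y | servingLoss c S < pathLoss c y.1},
      ENNReal.ofReal (power c φ₀ y) ∂(pointMeasure S) := by
  obtain ⟨x, hx⟩ := hex
  have hm : MeasurableSet {y : Station NBS NUE | servingLoss c S < pathLoss c y.1} :=
    measurableSet_lt measurable_const hκ
  rw [← lintegral_indicator hm, lintegral_pointMeasure _ (hpow.ennreal_ofReal.indicator hm),
    tsum_subtype S, Set.indicator_indicator, ← tsum_subtype]
  have hset : S ∩ {y | servingLoss c S < pathLoss c y.1} = {y | y ∈ S ∧ some y ≠ servingBS c S} := by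
    ext y
    rw [servingLoss_eq hinj hx, servingBS_eq hinj hx]
    simp only [Set.mem_inter_iff, Set.mem_ofPred_eq, ne_eq, Option.some.injEq]
    refine and_congr_right fun hy => ⟨fun h he => ?_, fun h => ?_⟩
    · rw [he] at h
      exact lt_irrefl _ h
    · exact lt_of_le_of_ne (hx.2 y hy) fun he => h (hinj hy hx.1 he.symm)
  rw [hset]
  rfl

end

section

variable {NBS NUE : ℕ} (c : Params NBS NUE)

/-! ### Path losses -/

/-- Used for expressions whose form depends on a discrete mark: link state, number of users, AOA,
grid index. -/
lemma measurable_comp_countable {ι α β : Type*} [MeasurableSpace ι] [Countable ι]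
    [MeasurableSingletonClass ι] [MeasurableSpace α] [MeasurableSpace β] {f : ι → α → β}
    (hf : ∀ i, Measurable (f i)) {g : α → ι} (hg : Measurable g) :
    Measurable fun a => f (g a) a := by
  have : Measurable fun p : ι × α => f p.1 p.2 := measurable_from_prod_countable_right hf
  exact this.comp (hg.prodMk measurable_id)

lemma measurable_pathLoss : Measurable (pathLoss c) := by
  have h : Measurable (pathLossDB c) := by
    have h1 : Measurable fun y : Link => c.alpha y.2.1 :=
      (measurable_of_countable c.alpha).comp (measurable_fst.comp measurable_snd)
    have h2 : Measurable fun y : Link => Real.logb 10 ‖y.1‖ :=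
      (Real.measurable_log.comp measurable_fst.norm).div_const _
    have h3 : Measurable fun y : Link => y.2.2 := measurable_snd.comp measurable_snd
    exact (((h1.const_mul 10).mul h2).const_add c.beta).add h3
  exact measurable_const.pow (h.div_const 10)

lemma pathLoss_pos (y : Link) : 0 < pathLoss c y := Real.rpow_pos_of_pos (by norm_num) _

lemma measurable_stationLoss : Measurable fun y : Station NBS NUE => pathLoss c y.1 :=
  (measurable_pathLoss c).comp measurable_fst

lemma measurable_chi (φ₀ : Fin NUE) (j w : ℕ) :
    Measurable fun a : Angles NBS NUE => chi c φ₀ a j w := by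
  have h1 : Measurable fun a : Angles NBS NUE => beamInner c.rhoUE φ₀ (a.1 j) :=
    (measurable_of_countable fun x => beamInner c.rhoUE φ₀ x).comp
      ((measurable_pi_apply j).comp measurable_fst)
  have hb : Measurable fun x : Fin NBS × Fin NBS => beamInner c.rhoBS x.1 x.2 :=
    measurable_of_countable _
  have h2 : Measurable fun a : Angles NBS NUE => beamInner c.rhoBS (a.2.1 j) (a.2.2 w) :=
    hb.comp (f := fun a : Angles NBS NUE => (a.2.1 j, a.2.2 w))
      (((measurable_pi_apply j).comp (measurable_fst.comp measurable_snd)).prodMk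
        ((measurable_pi_apply w).comp (measurable_snd.comp measurable_snd)))
  exact h1.mul h2

/-- The normalised interference `(s G / (t η U)) ∑_w |∑_j γ_j χ_{j,w}|²` of a BS at path loss `t`
whose link has `η` paths and which serves `U` users. -/
def scaledPower (φ₀ : Fin NUE) (s : ℝ) (η U : ℕ) (t : ℝ) (γ : ℕ → ℂ) (a : Angles NBS NUE) : ℝ :=
  s * gain c * t⁻¹ / (η * U) * ∑ w ∈ Finset.range U,
    ‖∑ j ∈ Finset.range η, γ j * (chi c φ₀ a j w : ℂ)‖ ^ 2

lemma mul_power (φ₀ : Fin NUE) (s : ℝ) (y : Station NBS NUE) :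
    s * power c φ₀ y = scaledPower c φ₀ s (c.eta y.1.2.1) y.2.1 (pathLoss c y.1) y.2.2.1 y.2.2.2 := by
  rw [power, scaledPower, ← mul_assoc]
  congr 1
  rw [div_eq_mul_inv, div_eq_mul_inv, mul_inv, mul_inv, mul_inv]
  ring

lemma measurable_scaledPower (φ₀ : Fin NUE) (s : ℝ) (η U : ℕ) :
    Measurable fun z : ℝ × (ℕ → ℂ) × Angles NBS NUE =>
      scaledPower c φ₀ s η U z.1 z.2.1 z.2.2 := by
  have h1 : ∀ j w, Measurable fun z : ℝ × (ℕ → ℂ) × Angles NBS NUE =>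
      ((chi c φ₀ z.2.2 j w : ℝ) : ℂ) := fun j w =>
    Complex.measurable_ofReal.comp ((measurable_chi c φ₀ j w).comp
      (measurable_snd.comp measurable_snd))
  have h2 : ∀ j, Measurable fun z : ℝ × (ℕ → ℂ) × Angles NBS NUE => z.2.1 j := fun j =>
    (measurable_pi_apply j).comp (measurable_fst.comp measurable_snd)
  refine Measurable.mul ?_ (Finset.measurable_fun_sum _ fun w _ => Measurable.pow_const
    (Measurable.norm (Finset.measurable_fun_sum _ fun j _ => (h2 j).mul (h1 j w))) 2)
  exact (measurable_fst.inv.const_mul _).div_const _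

lemma measurable_power (φ₀ : Fin NUE) : Measurable (power c φ₀) := by
  have h : Measurable fun y : Station NBS NUE => scaledPower c φ₀ 1 (c.eta y.1.2.1) y.2.1
      (pathLoss c y.1) y.2.2.1 y.2.2.2 := by
    refine measurable_comp_countable (ι := Bool × ℕ) (g := fun y => (y.1.2.1, y.2.1))
      (f := fun i (y : Station NBS NUE) => scaledPower c φ₀ 1 (c.eta i.1) i.2 (pathLoss c y.1)
        y.2.2.1 y.2.2.2) (fun i => ?_) ?_
    · exact (measurable_scaledPower c φ₀ 1 _ _).comp
        ((measurable_stationLoss c).prodMk (measurable_snd.comp measurable_snd))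
    · exact (measurable_fst.comp (measurable_snd.comp measurable_fst)).prodMk
        (measurable_fst.comp measurable_snd)
  simp_rw [← mul_power, one_mul] at h
  exact h

/-! ### The intensity of the links -/

lemma measurable_stateProb (b : Bool) : Measurable (stateProb c b) :=
  Measurable.ite (measurableSet_le measurable_norm measurable_const) measurable_const
    measurable_const

lemma stateProb_le_one (b : Bool) (x : EuclideanSpace ℝ (Fin 2)) : stateProb c b x ≤ 1 := by
  rw [stateProb]
  have h1 := c.pLOS_le_one
  have h0 := c.pLOS_nonneg
  cases b <;> simp only [if_true, Bool.false_eq_true, if_false] <;> split_ifs <;>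
    simp [h1, h0]

lemma stateProb_add (x : EuclideanSpace ℝ (Fin 2)) :
    stateProb c true x + stateProb c false x = 1 := by
  have h1 := c.pLOS_le_one
  have h0 := c.pLOS_nonneg
  simp only [stateProb, if_true, Bool.false_eq_true, if_false]
  split_ifs
  · rw [← ENNReal.ofReal_add h0 (by linarith)]
    simp
  · simp

/-- The intensity of the positions of the BSs in link state `b`. -/
def positionIntensity (b : Bool) : Measure (EuclideanSpace ℝ (Fin 2)) :=
  (ENNReal.ofReal c.lam • (volume : Measure (EuclideanSpace ℝ (Fin 2)))).withDensity (stateProb c b)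

lemma positionIntensity_le (b : Bool) :
    positionIntensity c b ≤ ENNReal.ofReal c.lam • (volume : Measure (EuclideanSpace ℝ (Fin 2))) := by
  refine (withDensity_mono (g := 1) (Eventually.of_forall (stateProb_le_one c b))).trans ?_
  rw [withDensity_one]

instance : SigmaFinite (ENNReal.ofReal c.lam • (volume : Measure (EuclideanSpace ℝ (Fin 2)))) :=
  inferInstanceAs (SigmaFinite (c.lam.toNNReal • volume))

instance (b : Bool) : SigmaFinite (positionIntensity c b) :=
  SigmaFinite.withDensity_of_ne_top
    (Eventually.of_forall fun x => ((stateProb_le_one c b x).trans_lt ENNReal.one_lt_top).ne)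

lemma linkIntensity_eq (b : Bool) : linkIntensity c b =
    (positionIntensity c b).prod ((Measure.dirac b).prod (gaussianReal 0 (c.xi b ^ 2))) := rfl

instance (b : Bool) : SigmaFinite (linkIntensity c b) := by
  rw [linkIntensity_eq]
  infer_instance

lemma lintegral_linkIntensity (b : Bool) {f : Link → ℝ≥0∞} (hf : Measurable f) :
    ∫⁻ y, f y ∂linkIntensity c b =
      ∫⁻ z, ∫⁻ x, f (x, b, z) ∂positionIntensity c b ∂gaussianReal 0 (c.xi b ^ 2) := by
  rw [linkIntensity_eq, lintegral_prod_symm' _ hf,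
    lintegral_prod _ (Measurable.lintegral_prod_left' hf).aemeasurable, lintegral_dirac]

/-- The state coordinate has a Dirac law under `linkIntensity c b`. -/
lemma lintegral_linkIntensity_congr (b : Bool) {f : Bool → Link → ℝ≥0∞} (hf : ∀ b, Measurable (f b)) :
    ∫⁻ y, f y.2.1 y ∂linkIntensity c b = ∫⁻ y, f b y ∂linkIntensity c b := by
  have hm : Measurable fun y : Link => f y.2.1 y :=
    measurable_comp_countable hf (measurable_fst.comp measurable_snd)
  rw [lintegral_linkIntensity c b hm, lintegral_linkIntensity c b (hf b)]

lemma linkIntensity_apply (b : Bool) {A : Set Link} (hA : MeasurableSet A) :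
    linkIntensity c b A = ∫⁻ z, positionIntensity c b {x | (x, b, z) ∈ A}
      ∂gaussianReal 0 (c.xi b ^ 2) := by
  rw [← lintegral_indicator_one hA, lintegral_linkIntensity c b (measurable_one.indicator hA)]
  refine lintegral_congr fun z => ?_
  have hm : MeasurableSet {x | ((x, b, z) : Link) ∈ A} :=
    (measurable_id.prodMk measurable_const) hA
  rw [← lintegral_indicator_one hm]
  rfl

lemma norm_le_of_pathLoss_le {b : Bool} {z R : ℝ} (hR : 0 < R) {x : EuclideanSpace ℝ (Fin 2)}
    (h : pathLoss c (x, b, z) ≤ R) :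
    ‖x‖ ≤ 10 ^ ((10 * Real.logb 10 R - c.beta - z) / (10 * c.alpha b)) := by
  -- At the origin `Real.logb 10 0 = 0`, so the path loss carries no information on the norm; the
  -- bound is then trivial.
  rcases eq_or_ne x 0 with rfl | hx
  · rw [norm_zero]
    positivity
  have ha := c.alpha_pos b
  rw [pathLoss, ← Real.le_logb_iff_rpow_le (by norm_num) hR, pathLossDB] at h
  rw [← Real.logb_le_iff_le_rpow (by norm_num) (norm_pos_iff.2 hx), le_div_iff₀ (by positivity)]
  simp only at h
  linarith

/-- Given the shadowing `z`, these BSs lie in a disk whose area is exponential in `-z`, and a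
Gaussian has all exponential moments. -/
lemma linkIntensity_le_ne_top (b : Bool) (R : ℝ) :
    linkIntensity c b {y | pathLoss c y ≤ R} ≠ ∞ := by
  rcases le_or_gt R 0 with hR | hR
  · have : {y | pathLoss c y ≤ R} = ∅ := by
      ext y
      simpa using hR.trans_lt (pathLoss_pos c y)
    simp [this]
  rw [linkIntensity_apply c b (measurableSet_le (measurable_pathLoss c) measurable_const)]
  set A := 10 * Real.logb 10 R - c.beta with hA
  -- The disk has radius `10 ^ ((A - z) / (10 α))`, hence `e^{k(A - z)}` times the area of the unit
  -- disk; the `2` is the dimension.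
  set k := 2 * Real.log 10 / (10 * c.alpha b) with hk
  have hbd : ∀ z : ℝ, positionIntensity c b {x | (x, b, z) ∈ {y | pathLoss c y ≤ R}} ≤
      ENNReal.ofReal c.lam * volume (Metric.ball (0 : EuclideanSpace ℝ (Fin 2)) 1) *
        ENNReal.ofReal (Real.exp (k * A) * Real.exp (-k * z)) := by
    intro z
    refine (positionIntensity_le c b _).trans ?_
    rw [Measure.smul_apply, smul_eq_mul, mul_assoc]
    gcongr
    refine (measure_mono (t := Metric.closedBall 0 (10 ^ ((A - z) / (10 * c.alpha b))))
      fun x hx => ?_).trans ?_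
    · rw [mem_closedBall_zero_iff]
      exact norm_le_of_pathLoss_le c hR hx
    · rw [Measure.addHaar_closedBall _ _ (by positivity), finrank_euclideanSpace, Fintype.card_fin,
        mul_comm]
      refine le_of_eq ?_
      congr 2
      rw [Real.rpow_def_of_pos (by norm_num), ← Real.exp_nat_mul, ← Real.exp_add]
      congr 1
      rw [hk]
      push_cast
      ring
  refine ((lintegral_mono hbd).trans_lt ?_).ne
  rw [lintegral_const_mul _ (by fun_prop)]
  refine ENNReal.mul_lt_top (ENNReal.mul_lt_top ENNReal.ofReal_lt_top measure_ball_lt_top) ?_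
  exact ((integrable_exp_mul_gaussianReal (-k)).const_mul _).lintegral_lt_top

/-- For fixed shadowing, a prescribed path loss confines the position to a circle, or to the origin,
where the logarithm takes its default value. -/
lemma linkIntensity_eq_zero (b : Bool) (t : ℝ) : linkIntensity c b {y | pathLoss c y = t} = 0 := by
  rw [linkIntensity_apply c b (measurableSet_eq_fun (measurable_pathLoss c) measurable_const)]
  refine lintegral_eq_zero_of_ae_eq_zero (Eventually.of_forall fun z => ?_)
  refine le_antisymm ((positionIntensity_le c b _).trans ?_) zero_le
  rw [Measure.smul_apply, smul_eq_mul]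
  have h0 : volume {x : EuclideanSpace ℝ (Fin 2) | (x, b, z) ∈ {y | pathLoss c y = t}} = 0 := by
    set q := (10 * Real.logb 10 t - c.beta - z) / (10 * c.alpha b)
    refine measure_mono_null (t := {0} ∪ Metric.sphere 0 (10 ^ q)) (fun x hx => ?_) ?_
    · rcases eq_or_ne x 0 with rfl | hx0
      · exact Or.inl rfl
      refine Or.inr ?_
      rw [mem_sphere_zero_iff_norm]
      have ha := c.alpha_pos b
      have hx' : (10 : ℝ) ^ (pathLossDB c (x, b, z) / 10) = t := hx
      have h1 : pathLossDB c (x, b, z) = 10 * Real.logb 10 t := by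
        rw [← hx', Real.logb_rpow (by norm_num) (by norm_num)]
        ring
      have h2 : Real.logb 10 ‖x‖ = q := by
        rw [pathLossDB] at h1
        rw [eq_div_iff (by positivity)]
        simp only at h1
        linarith
      rw [← h2, Real.rpow_logb (by norm_num) (by norm_num) (norm_pos_iff.2 hx0)]
    · exact measure_union_null (measure_singleton _) (Measure.addHaar_sphere _ _ _)
  rw [h0, mul_zero]
  exact zero_le

/-- The two state probabilities add up to `1`, so the total is `lam` times the area of the plane.
This makes the configuration almost surely nonempty. -/
lemma linkIntensity_univ :
    linkIntensity c true Set.univ + linkIntensity c false Set.univ = ∞ := by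
  have h1 : ∀ b, linkIntensity c b Set.univ = positionIntensity c b Set.univ := fun b => by
    rw [linkIntensity_apply c b MeasurableSet.univ]
    simp
  have h2 : positionIntensity c true Set.univ + positionIntensity c false Set.univ = ∞ := by
    rw [positionIntensity, positionIntensity, withDensity_apply _ MeasurableSet.univ,
      withDensity_apply _ MeasurableSet.univ, Measure.restrict_univ,
      ← lintegral_add_left (measurable_stateProb c true)]
    simp_rw [stateProb_add]
    rw [lintegral_one, Measure.smul_apply, smul_eq_mul, measure_univ_of_isAddLeftInvariant]
    exact ENNReal.mul_top (by simpa using c.lam_pos)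
  rw [h1, h1, h2]

/-! ### The intensity of the marked process -/

instance : IsProbabilityMeasure complexNormal :=
  Measure.isProbabilityMeasure_map (by
    have : Measurable fun z : ℝ × ℝ => Complex.equivRealProdCLM.symm z :=
      Complex.equivRealProdCLM.symm.continuous.measurable
    exact this.aemeasurable)

instance : IsProbabilityMeasure (anglesLaw c) := by
  rw [anglesLaw]
  infer_instance

/-- The law of the marks of a BS, apart from its link. -/
def markLaw : Measure (ℕ × (ℕ → ℂ) × Angles NBS NUE) :=
  c.pU.toMeasure.prod ((Measure.infinitePi fun _ : ℕ => complexNormal).prod (anglesLaw c))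

instance : IsProbabilityMeasure (markLaw c) := by
  rw [markLaw]
  infer_instance

lemma stationIntensity_eq :
    stationIntensity c = (linkIntensity c true + linkIntensity c false).prod (markLaw c) := rfl

instance : SigmaFinite (stationIntensity c) := by
  rw [stationIntensity_eq]
  infer_instance

lemma lintegral_stationIntensity {f : Station NBS NUE → ℝ≥0∞} (hf : Measurable f) :
    ∫⁻ y, f y ∂stationIntensity c =
      ∫⁻ x, ∫⁻ m, f (x, m) ∂markLaw c ∂linkIntensity c true +
        ∫⁻ x, ∫⁻ m, f (x, m) ∂markLaw c ∂linkIntensity c false := by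
  rw [stationIntensity_eq, lintegral_prod _ hf.aemeasurable, lintegral_add_measure]

lemma stationIntensity_link (A : Set Link) :
    stationIntensity c {y | y.1 ∈ A} = linkIntensity c true A + linkIntensity c false A := by
  have : {y : Station NBS NUE | y.1 ∈ A} = A ×ˢ Set.univ := by
    ext y
    simp
  rw [stationIntensity_eq, this, Measure.prod_prod, measure_univ, mul_one, Measure.add_apply]

lemma stationIntensity_le_ne_top (R : ℝ) :
    stationIntensity c {y | pathLoss c y.1 ≤ R} ≠ ∞ := by
  have := stationIntensity_link c {y | pathLoss c y ≤ R}
  exact this.trans_ne (ENNReal.add_ne_top.2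
    ⟨linkIntensity_le_ne_top c true R, linkIntensity_le_ne_top c false R⟩)

lemma stationIntensity_eq_zero (t : ℝ) : stationIntensity c {y | pathLoss c y.1 = t} = 0 := by
  have := stationIntensity_link c {y | pathLoss c y = t}
  exact this.trans (by
    rw [linkIntensity_eq_zero, linkIntensity_eq_zero, add_zero])

lemma stationIntensity_univ : stationIntensity c Set.univ = ∞ :=
  (stationIntensity_link c Set.univ).trans (linkIntensity_univ c)

end

/-! ### The conditional law of the interference given the serving loss. -/

section

lemma measure_ext_of_Ioi {μ ν : Measure ℝ} [IsFiniteMeasure μ] [IsFiniteMeasure ν]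
    (h : ∀ r, μ (Set.Ioi r) = ν (Set.Ioi r)) : μ = ν := by
  refine Measure.ext_of_Ioc μ ν fun a b hab => ?_
  have h1 : Set.Ioc a b = Set.Ioi a \ Set.Ioi b := by
    ext x
    simp
  have hsub : Set.Ioi b ⊆ Set.Ioi a := Set.Ioi_subset_Ioi hab.le
  rw [h1, measure_sdiff hsub measurableSet_Ioi.nullMeasurableSet (measure_ne_top _ _),
    measure_sdiff hsub measurableSet_Ioi.nullMeasurableSet (measure_ne_top _ _), h, h]

variable {NBS NUE : ℕ} {c : Params NBS NUE}

/-- The Laplace functional at `s` of the interference of the BSs with path loss beyond `l`, when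
the AOA of the service link is `φ₀`. -/
def laplaceBeyond (c : Params NBS NUE) (s : ℝ) (φ₀ : Fin NUE) (l : ℝ) : ℝ≥0∞ :=
  expNeg (∫⁻ y in {y | l < pathLoss c y.1}, 1 - expNeg (ENNReal.ofReal (s * power c φ₀ y))
    ∂stationIntensity c)

lemma measurable_laplaceBeyond (s : ℝ) (φ₀ : Fin NUE) : Measurable (laplaceBeyond c s φ₀) := by
  refine measurable_expNeg.comp (Antitone.measurable fun l l' h => ?_)
  exact lintegral_mono_set fun y hy => lt_of_le_of_lt h hy

lemma laplaceBeyond_le_one (s : ℝ) (φ₀ : Fin NUE) (l : ℝ) : laplaceBeyond c s φ₀ l ≤ 1 :=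
  expNeg_le_one _

namespace IsNetwork

variable {Ω : Type*} [MeasurableSpace Ω] {P : Measure Ω}
  {Φ : Ω → Set (Station NBS NUE)} {φ₀ : Ω → Fin NUE}

lemma processSigma_le (hnet : IsNetwork P c Φ φ₀) : processSigma Φ ≤ ‹MeasurableSpace Ω› :=
  iSup_le fun A => (hnet.poisson.measurable_count A.1 A.2).comap_le

variable [IsProbabilityMeasure P]

lemma ae_good (hnet : IsNetwork P c Φ φ₀) : ∀ᵐ ω ∂P,
    Set.InjOn (fun y : Station NBS NUE => pathLoss c y.1) (Φ ω) ∧ ∃ x, IsServing c (Φ ω) x := by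
  have h := hnet.poisson
  filter_upwards [h.ae_injOn (measurable_stationLoss c) (stationIntensity_le_ne_top c)
    (stationIntensity_eq_zero c), h.ae_nonempty (stationIntensity_univ c),
    ae_all_iff.2 fun R : ℕ => h.ae_count_ne_top
      (measurableSet_le (measurable_stationLoss c) (measurable_const (a := (R : ℝ))))
      (stationIntensity_le_ne_top c R)] with ω h1 h2 h3
  exact ⟨h1, exists_isServing h2 h3⟩

/-- `servingBS` is defined by choice, but outside a null set `{u < servingLoss}` is a measurable
void event. -/
lemma aemeasurable_servingLoss (hnet : IsNetwork P c Φ φ₀) :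
    AEMeasurable (fun ω => servingLoss c (Φ ω)) P := by
  refine NullMeasurable.aemeasurable ?_
  refine @measurable_of_Ioi ℝ (NullMeasurableSpace Ω P) _ _ _ _ _ _ _ _ fun u => ?_
  have hm : MeasurableSet {ω | count (Φ ω) {y | pathLoss c y.1 ≤ u} = 0} :=
    hnet.poisson.measurable_count _ (measurableSet_le (measurable_stationLoss c) measurable_const)
      (measurableSet_singleton 0)
  refine NullMeasurableSet.congr hm.nullMeasurableSet ?_
  filter_upwards [hnet.ae_good] with ω hω
  exact propext (lt_servingLoss_iff hω.1 hω.2 u).symm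

/-- A measurable version of the path loss on the service link. -/
def lossVersion (hnet : IsNetwork P c Φ φ₀) : Ω → ℝ := hnet.aemeasurable_servingLoss.mk _

lemma measurable_lossVersion (hnet : IsNetwork P c Φ φ₀) : Measurable hnet.lossVersion :=
  hnet.aemeasurable_servingLoss.measurable_mk

lemma lossVersion_ae_eq (hnet : IsNetwork P c Φ φ₀) :
    (fun ω => servingLoss c (Φ ω)) =ᵐ[P] hnet.lossVersion :=
  hnet.aemeasurable_servingLoss.ae_eq_mk

lemma ae_lt_lossVersion_iff (hnet : IsNetwork P c Φ φ₀) : ∀ᵐ ω ∂P, ∀ u, u < hnet.lossVersion ω ↔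
    pointMeasure (Φ ω) {y | pathLoss c y.1 ≤ u} = 0 := by
  filter_upwards [hnet.ae_good, hnet.lossVersion_ae_eq] with ω hω hL u
  rw [← hL, lt_servingLoss_iff hω.1 hω.2 u, pointMeasure_apply _
    (measurableSet_le (measurable_stationLoss c) measurable_const), ENat.toENNReal_eq_zero]

lemma ae_lossVersion_pos (hnet : IsNetwork P c Φ φ₀) : ∀ᵐ ω ∂P, 0 < hnet.lossVersion ω := by
  filter_upwards [hnet.ae_lt_lossVersion_iff] with ω hω
  rw [hω 0]
  have : {y : Station NBS NUE | pathLoss c y.1 ≤ 0} = ∅ := by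
    ext y
    simpa using pathLoss_pos c y.1
  rw [this, measure_empty]

lemma ae_interference_eq (hnet : IsNetwork P c Φ φ₀) : ∀ᵐ ω ∂P,
    interference c (Φ ω) (φ₀ ω) = ∫⁻ y in {y | hnet.lossVersion ω < pathLoss c y.1},
      ENNReal.ofReal (power c (φ₀ ω) y) ∂(pointMeasure (Φ ω)) := by
  filter_upwards [hnet.ae_good, hnet.lossVersion_ae_eq] with ω hω hL
  rw [interference_eq hω.1 hω.2 _ (measurable_stationLoss c) (measurable_power c _), ← hL]

/-- Rounding the serving loss up to a grid and splitting by the value of `φ₀` leaves countably many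
fixed regions and integrands. The limit holds where the loss exceeds the base point `0` of the grid,
hence almost surely. -/
lemma aemeasurable_interference (hnet : IsNetwork P c Φ φ₀) :
    AEMeasurable (fun ω => interference c (Φ ω) (φ₀ ω)) P := by
  refine AEMeasurable.congr ?_ (hnet.ae_interference_eq.mono fun ω h => h.symm)
  refine aemeasurable_of_tendsto_metrizable_ae' (f := fun n ω =>
    ∫⁻ y in {y | dyadicCeil 0 n (hnet.lossVersion ω) < pathLoss c y.1},
      ENNReal.ofReal (power c (φ₀ ω) y) ∂(pointMeasure (Φ ω))) (fun n => ?_) ?_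
  · have hceil : Measurable fun ω => ⌈(hnet.lossVersion ω - 0) * 2 ^ n⌉₊ :=
      ((hnet.measurable_lossVersion.sub_const 0).mul_const _).nat_ceil
    have h := measurable_comp_countable (ι := Fin NUE × ℕ)
      (f := fun i ω => ∫⁻ y in {y | (0 : ℝ) + i.2 / 2 ^ n < pathLoss c y.1},
        ENNReal.ofReal (power c i.1 y) ∂(pointMeasure (Φ ω))) (fun i => ?_)
      (hnet.measurable_aoa.prodMk hceil)
    · exact h.aemeasurable
    · have hB : MeasurableSet {y : Station NBS NUE | (0 : ℝ) + i.2 / 2 ^ n < pathLoss c y.1} :=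
        measurableSet_lt measurable_const (measurable_stationLoss c)
      simp_rw [← lintegral_indicator hB]
      exact (Measure.measurable_lintegral ((measurable_power c i.1).ennreal_ofReal.indicator hB)).comp
        hnet.poisson.measurable_pointMeasure
  · filter_upwards [hnet.ae_lossVersion_pos] with ω hω
    exact tendsto_lintegral_dyadicCeil (measurable_stationLoss c) _ hω

/-- By independence, restricting `P` to `{φ₀ = i}` keeps the Poisson Laplace functional up to total
mass. The first-point results are therefore stated for finite measures: they apply with the AOA
frozen. -/
lemma laplace_restrict (hnet : IsNetwork P c Φ φ₀) (i : Fin NUE) {g : Station NBS NUE → ℝ≥0∞}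
    (hg : Measurable g) :
    ∫⁻ ω, expNeg (∫⁻ y, g y ∂(pointMeasure (Φ ω))) ∂(P.restrict (φ₀ ⁻¹' {i})) =
      P.restrict (φ₀ ⁻¹' {i}) Set.univ *
        expNeg (∫⁻ y, 1 - expNeg (g y) ∂stationIntensity c) := by
  have hi : MeasurableSet (φ₀ ⁻¹' {i}) := hnet.measurable_aoa (measurableSet_singleton i)
  have hN : Measurable[processSigma Φ] fun ω => pointMeasure (Φ ω) :=
    measurable_pointMeasure_of_count fun A hA =>
      (comap_measurable _).mono (le_iSup (fun A : {A : Set (Station NBS NUE) // MeasurableSet A} =>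
        MeasurableSpace.comap (fun ω => count (Φ ω) A.1) inferInstance) ⟨A, hA⟩) le_rfl
  have hf : Measurable[processSigma Φ] fun ω => expNeg (∫⁻ y, g y ∂(pointMeasure (Φ ω))) :=
    measurable_expNeg.comp ((Measure.measurable_lintegral hg).comp hN)
  have hind : Measurable[MeasurableSpace.comap φ₀ inferInstance]
      ((φ₀ ⁻¹' {i}).indicator (1 : Ω → ℝ≥0∞)) :=
    (measurable_of_countable (({i} : Set (Fin NUE)).indicator (1 : Fin NUE → ℝ≥0∞))).comp
      (comap_measurable φ₀)
  have h := lintegral_mul_eq_lintegral_mul_lintegral_of_independent_measurableSpace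
    hnet.processSigma_le hnet.measurable_aoa.comap_le hnet.indep hf hind
  rw [hnet.poisson.laplace hg, lintegral_indicator_one hi] at h
  rw [Measure.restrict_apply_univ, mul_comm, ← h, ← lintegral_indicator hi]
  refine lintegral_congr fun ω => ?_
  by_cases hω : ω ∈ φ₀ ⁻¹' {i} <;> simp [hω]

/-- The Laplace functional determines the law of the first point, so freezing `φ₀` only rescales
that law. -/
lemma map_lossVersion_restrict (hnet : IsNetwork P c Φ φ₀) (i : Fin NUE) :
    (P.restrict (φ₀ ⁻¹' {i})).map hnet.lossVersion = c.qUE i • P.map hnet.lossVersion := by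
  have hL := hnet.measurable_lossVersion
  have hi : P (φ₀ ⁻¹' {i}) = c.qUE i := by
    rw [← Measure.map_apply hnet.measurable_aoa (measurableSet_singleton i), hnet.law_aoa,
      PMF.toMeasure_apply_singleton _ _ (measurableSet_singleton i)]
  have : IsFiniteMeasure (c.qUE i • P.map hnet.lossVersion) :=
    Measure.smul_finite _ (c.qUE.apply_ne_top i)
  refine measure_ext_of_Ioi fun r => ?_
  rw [Measure.smul_apply, Measure.map_apply hL measurableSet_Ioi,
    Measure.map_apply hL measurableSet_Ioi, smul_eq_mul]
  have h1 := measure_lt_first (fun g hg => hnet.laplace_restrict i hg) (measurable_stationLoss c)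
    hL (ae_restrict_of_ae hnet.ae_lt_lossVersion_iff) r
  have h2 := measure_lt_first (Q := P) (fun g hg => by
    rw [hnet.poisson.laplace hg, measure_univ, one_mul]) (measurable_stationLoss c)
    hL hnet.ae_lt_lossVersion_iff r
  rw [measure_univ, one_mul] at h2
  rw [Measure.restrict_apply_univ, hi, ← h2] at h1
  exact h1

/-- As functions of `B` both sides are finite measures; they agree on half-lines by
`laplace_beyond_first`, hence on all Borel sets. -/
lemma setLIntegral_restrict (hnet : IsNetwork P c Φ φ₀) (s : ℝ) (i : Fin NUE)
    {B : Set ℝ} (hB : MeasurableSet B) :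
    ∫⁻ ω in hnet.lossVersion ⁻¹' B, expNeg (∫⁻ y in {y | hnet.lossVersion ω < pathLoss c y.1},
      ENNReal.ofReal (s * power c i y) ∂(pointMeasure (Φ ω))) ∂(P.restrict (φ₀ ⁻¹' {i})) =
    c.qUE i * ∫⁻ l in B, laplaceBeyond c s i l ∂(P.map hnet.lossVersion) := by
  set Q := P.restrict (φ₀ ⁻¹' {i}) with hQ
  have hL := hnet.measurable_lossVersion
  set X : Ω → ℝ≥0∞ := fun ω => expNeg (∫⁻ y in {y | hnet.lossVersion ω < pathLoss c y.1},
      ENNReal.ofReal (s * power c i y) ∂(pointMeasure (Φ ω))) with hX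
  have hf : Measurable fun y => ENNReal.ofReal (s * power c i y) :=
    ((measurable_power c i).const_mul s).ennreal_ofReal
  have hfin : ∀ (μ : Measure Ω) [IsFiniteMeasure μ], ∫⁻ ω, X ω ∂μ ≠ ∞ := fun μ _ =>
    ((lintegral_mono fun ω => expNeg_le_one _).trans_lt (by simp)).ne
  have hfin' : ∀ (μ : Measure ℝ) [IsFiniteMeasure μ], ∫⁻ l, laplaceBeyond c s i l ∂μ ≠ ∞ :=
    fun μ _ => ((lintegral_mono fun l => laplaceBeyond_le_one s i l).trans_lt (by simp)).ne
  have : IsFiniteMeasure (Q.withDensity X) := isFiniteMeasure_withDensity (hfin Q)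
  have : IsFiniteMeasure ((Q.map hnet.lossVersion).withDensity (laplaceBeyond c s i)) :=
    isFiniteMeasure_withDensity (hfin' _)
  have hext : (Q.withDensity X).map hnet.lossVersion =
      (Q.map hnet.lossVersion).withDensity (laplaceBeyond c s i) := by
    refine measure_ext_of_Ioi fun r => ?_
    rw [Measure.map_apply hL measurableSet_Ioi, withDensity_apply _ (hL measurableSet_Ioi),
      withDensity_apply _ measurableSet_Ioi,
      setLIntegral_map measurableSet_Ioi (measurable_laplaceBeyond s i) hL]
    exact laplace_beyond_first hnet.poisson.measurable_pointMeasure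
      (fun g hg => hnet.laplace_restrict i hg) (measurable_stationLoss c) hL
      (ae_restrict_of_ae hnet.ae_lt_lossVersion_iff) hf r
  have h := congrArg (fun μ => μ B) hext
  simp only [Measure.map_apply hL hB, withDensity_apply _ (hL hB), withDensity_apply _ hB] at h
  rw [h, hnet.map_lossVersion_restrict i, Measure.restrict_smul, lintegral_smul_measure,
    smul_eq_mul]

lemma setLIntegral_expNeg_interference (hnet : IsNetwork P c Φ φ₀) {s : ℝ} (hs : 0 ≤ s)
    {B : Set ℝ} (hB : MeasurableSet B) :
    ∫⁻ ω in hnet.lossVersion ⁻¹' B,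
      expNeg (ENNReal.ofReal s * interference c (Φ ω) (φ₀ ω)) ∂P =
    ∫⁻ l in B, ∑ i, c.qUE i * laplaceBeyond c s i l ∂(P.map hnet.lossVersion) := by
  have hLB := hnet.measurable_lossVersion hB
  have hi : ∀ i, MeasurableSet (φ₀ ⁻¹' {i}) := fun i =>
    hnet.measurable_aoa (measurableSet_singleton i)
  have hU : ⋃ i, φ₀ ⁻¹' {i} = Set.univ := by
    ext ω
    simp
  have hdisj : Pairwise (Function.onFun Disjoint fun i => φ₀ ⁻¹' {i}) := fun i j hij =>
    Disjoint.preimage _ (Set.disjoint_singleton.2 hij)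
  rw [lintegral_finsetSum _ fun i _ => (measurable_laplaceBeyond s i).const_mul _]
  simp_rw [lintegral_const_mul _ (measurable_laplaceBeyond (c := c) s _)]
  rw [← setLIntegral_univ, ← hU, lintegral_iUnion hi hdisj, tsum_fintype]
  refine Finset.sum_congr rfl fun i _ => ?_
  rw [← hnet.setLIntegral_restrict s i hB, Measure.restrict_restrict (hi i),
    Measure.restrict_restrict hLB, Set.inter_comm]
  refine lintegral_congr_ae ?_
  have h1 := ae_restrict_of_ae (s := hnet.lossVersion ⁻¹' B ∩ φ₀ ⁻¹' {i}) hnet.ae_interference_eq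
  filter_upwards [h1, ae_restrict_mem (hLB.inter (hi i))] with ω h1 h2
  have h3 : φ₀ ω = i := h2.2
  rw [h1, h3, ← lintegral_const_mul _ (measurable_power c i).ennreal_ofReal]
  simp_rw [ENNReal.ofReal_mul hs]

/-- The conditional Laplace functional of the out-of-cell interference. -/
theorem condLaplace_ae_eq (hnet : IsNetwork P c Φ φ₀) {s : ℝ} (hs : 0 ≤ s) :
    ∀ᵐ l ∂(P.map fun ω => servingLoss c (Φ ω)),
      condLaplace P c Φ φ₀ s l = ∑ i, c.qUE i * laplaceBeyond c s i l := by
  have hg : Measurable fun i : ℝ≥0∞ => expNeg (ENNReal.ofReal s * i) :=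
    measurable_expNeg.comp (measurable_const.mul measurable_id)
  have hg2 : Measurable fun x : ℝ × ℝ≥0∞ => expNeg (ENNReal.ofReal s * x.2) :=
    hg.comp measurable_snd
  have hmap : P.map (fun ω => servingLoss c (Φ ω)) = P.map hnet.lossVersion :=
    Measure.map_congr hnet.lossVersion_ae_eq
  have : IsProbabilityMeasure (P.map fun ω => servingLoss c (Φ ω)) :=
    Measure.isProbabilityMeasure_map hnet.aemeasurable_servingLoss
  -- Both functions of `l` are identified by their integrals over Borel sets `B`; for the
  -- conditional expectation these come from disintegrating the joint law.
  refine ae_eq_of_forall_setLIntegral_eq_of_sigmaFinite hg.lintegral_kernel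
    (Finset.measurable_fun_sum _ fun i _ => (measurable_laplaceBeyond s i).const_mul _)
    fun B hB _ => ?_
  conv_rhs => rw [hmap]
  rw [← hnet.setLIntegral_expNeg_interference hs hB]
  have h := Measure.setLIntegral_compProd (μ := P.map fun ω => servingLoss c (Φ ω))
    (κ := condDistrib (fun ω => interference c (Φ ω) (φ₀ ω)) (fun ω => servingLoss c (Φ ω)) P)
    hg2 hB MeasurableSet.univ
  simp only [Measure.restrict_univ] at h
  refine h.symm.trans ?_
  rw [compProd_map_condDistrib hnet.aemeasurable_interference,
    ← lintegral_indicator (hB.prod MeasurableSet.univ),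
    lintegral_map' (hg2.indicator (hB.prod MeasurableSet.univ)).aemeasurable
      (hnet.aemeasurable_servingLoss.prodMk hnet.aemeasurable_interference),
    ← lintegral_indicator (hnet.measurable_lossVersion hB)]
  refine lintegral_congr_ae (hnet.lossVersion_ae_eq.mono fun ω hω => ?_)
  dsimp only at hω ⊢
  by_cases hb : hnet.lossVersion ω ∈ B <;> simp [hω, hb]

end IsNetwork

end

section

/-! ### Complex normal fading -/

lemma measurable_complex_mk : Measurable fun z : ℝ × ℝ => (⟨z.1, z.2⟩ : ℂ) := by
  have : Measurable fun z : ℝ × ℝ => Complex.equivRealProdCLM.symm z :=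
    Complex.equivRealProdCLM.symm.continuous.measurable
  exact this

lemma integral_exp_sq_gaussianReal {v : ℝ} (hv : 0 ≤ v) :
    ∫ x, Real.exp (-(v * x ^ 2)) ∂(gaussianReal 0 (1 / 2)) = √(1 + v)⁻¹ := by
  rw [integral_gaussianReal_eq_integral_smul (by norm_num)]
  have h : ∀ x : ℝ, gaussianPDFReal 0 (1 / 2) x • Real.exp (-(v * x ^ 2)) =
      (√Real.pi)⁻¹ * Real.exp (-(1 + v) * x ^ 2) := by
    intro x
    have h1 : 2 * Real.pi * ((1 / 2 : ℝ≥0) : ℝ) = Real.pi := by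
      push_cast
      ring
    have h2 : -(x - 0) ^ 2 / (2 * ((1 / 2 : ℝ≥0) : ℝ)) + -(v * x ^ 2) = -(1 + v) * x ^ 2 := by
      push_cast
      ring
    rw [gaussianPDFReal, smul_eq_mul, mul_assoc, ← Real.exp_add, h1, h2]
  simp_rw [h]
  rw [integral_const_mul, integral_gaussian, ← Real.sqrt_inv, ← Real.sqrt_mul (by positivity)]
  congr 1
  field_simp

/-- Real and imaginary part have variance `1/2` and contribute `(1 + v)^{-1/2}` each. -/
lemma lintegral_expNeg_complexNormal {v : ℝ} (hv : 0 ≤ v) :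
    ∫⁻ z, expNeg (ENNReal.ofReal (v * ‖z‖ ^ 2)) ∂complexNormal = ENNReal.ofReal (1 + v)⁻¹ := by
  have hm : Measurable fun z : ℂ => expNeg (ENNReal.ofReal (v * ‖z‖ ^ 2)) :=
    measurable_expNeg.comp (by fun_prop)
  rw [complexNormal, lintegral_map hm measurable_complex_mk]
  have h : ∀ z : ℝ × ℝ, expNeg (ENNReal.ofReal (v * ‖(⟨z.1, z.2⟩ : ℂ)‖ ^ 2)) =
      ENNReal.ofReal (Real.exp (-(v * z.1 ^ 2))) * ENNReal.ofReal (Real.exp (-(v * z.2 ^ 2))) := by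
    intro z
    rw [expNeg_ofReal (by positivity), ← ENNReal.ofReal_mul (Real.exp_pos _).le, ← Real.exp_add,
      ← Complex.normSq_eq_norm_sq, Complex.normSq_mk]
    congr 2
    ring
  simp_rw [h]
  have hg : AEMeasurable (fun x : ℝ => ENNReal.ofReal (Real.exp (-(v * x ^ 2))))
      (gaussianReal 0 (1 / 2)) := by fun_prop
  rw [lintegral_prod_mul hg hg, ← ofReal_integral_eq_lintegral_ofReal,
    integral_exp_sq_gaussianReal hv, ← ENNReal.ofReal_mul (by positivity),
    Real.mul_self_sqrt (by positivity)]
  · refine Integrable.of_bound (C := 1) (by fun_prop) (Eventually.of_forall fun x => ?_)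
    rw [Real.norm_of_nonneg (Real.exp_pos _).le, Real.exp_le_one_iff]
    nlinarith [mul_nonneg hv (sq_nonneg x)]
  · exact Eventually.of_forall fun x => (Real.exp_pos _).le

lemma charFun_complexNormal (t : ℂ) :
    charFun complexNormal t = Complex.exp (-(‖t‖ ^ 2 / 4 : ℝ)) := by
  rw [charFun_apply, complexNormal, integral_map measurable_complex_mk.aemeasurable
    (by fun_prop)]
  have h : ∀ z : ℝ × ℝ, Complex.exp ((inner ℝ (⟨z.1, z.2⟩ : ℂ) t : ℝ) * Complex.I) =
      Complex.exp (t.re * z.1 * Complex.I) * Complex.exp (t.im * z.2 * Complex.I) := by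
    intro z
    rw [← Complex.exp_add, Complex.inner]
    congr 1
    simp
    ring
  simp_rw [h]
  rw [integral_prod_mul (fun x : ℝ => Complex.exp (t.re * x * Complex.I))
    (fun x : ℝ => Complex.exp (t.im * x * Complex.I)), ← charFun_apply_real, ← charFun_apply_real,
    charFun_gaussianReal, charFun_gaussianReal, ← Complex.exp_add, ← Complex.normSq_eq_norm_sq,
    Complex.normSq_apply]
  congr 1
  push_cast
  ring

/-- The law of independent complex normal gains. -/
abbrev fadingLaw : Measure (ℕ → ℂ) := Measure.infinitePi fun _ : ℕ => complexNormal

lemma map_eval_fadingLaw (j : ℕ) : fadingLaw.map (fun γ => γ j) = complexNormal :=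
  (measurePreserving_eval_infinitePi (fun _ : ℕ => complexNormal) j).map_eq

/-- The characteristic functions `exp(-χ_j² ‖t‖² / 4)` multiply, so the variances `χ_j²` add. -/
lemma map_sum_fadingLaw (χ : ℕ → ℝ) (η : ℕ) :
    fadingLaw.map (fun γ => ∑ j ∈ Finset.range η, γ j * (χ j : ℂ)) =
      complexNormal.map (fun z => (√(∑ j ∈ Finset.range η, χ j ^ 2)) • z) := by
  have hind : iIndepFun (fun (j : Fin η) (γ : ℕ → ℂ) => χ j • γ j) fadingLaw :=
    (iIndepFun_infinitePi (P := fun _ : ℕ => complexNormal) (X := fun j z => χ j • z)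
      (fun j => by fun_prop)).precomp Fin.val_injective
  have hm : ∀ j : Fin η, Measurable fun γ : ℕ → ℂ => χ j • γ j := fun j => by fun_prop
  have hsum : (fun γ : ℕ → ℂ => ∑ j ∈ Finset.range η, γ j * (χ j : ℂ)) =
      ∑ j : Fin η, fun γ : ℕ → ℂ => χ j • γ j := by
    ext γ
    rw [Finset.sum_range, Finset.sum_apply]
    refine Finset.sum_congr rfl fun j _ => ?_
    rw [Complex.real_smul, mul_comm]
  have hpm : IsProbabilityMeasure (fadingLaw.map (∑ j : Fin η, fun γ : ℕ → ℂ => χ j • γ j)) :=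
    Measure.isProbabilityMeasure_map (by
      rw [← hsum]
      exact Measurable.aemeasurable (by fun_prop))
  have hpm' : IsProbabilityMeasure
      (complexNormal.map (fun z => (√(∑ j ∈ Finset.range η, χ j ^ 2)) • z)) :=
    Measure.isProbabilityMeasure_map (by fun_prop)
  rw [hsum]
  refine Measure.ext_of_charFun ?_
  rw [hind.charFun_map_sum_eq_prod fun j => (hm j).aemeasurable]
  ext t
  rw [Finset.prod_apply, charFun_map_smul, charFun_complexNormal]
  have h1 : ∀ j : Fin η, charFun (fadingLaw.map fun γ : ℕ → ℂ => χ j • γ j) t =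
      Complex.exp (-((χ j ^ 2 * ‖t‖ ^ 2 / 4 : ℝ))) := by
    intro j
    have : (fun γ : ℕ → ℂ => χ j • γ j) = (fun z : ℂ => χ j • z) ∘ fun γ : ℕ → ℂ => γ j := rfl
    rw [this, ← Measure.map_map (by fun_prop) (by fun_prop), map_eval_fadingLaw, charFun_map_smul,
      charFun_complexNormal, norm_smul, mul_pow, Real.norm_eq_abs, sq_abs]
  simp_rw [h1]
  rw [← Complex.exp_sum, norm_smul, mul_pow, Real.norm_eq_abs, sq_abs,
    Real.sq_sqrt (Finset.sum_nonneg fun j _ => sq_nonneg _), Finset.sum_range]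
  congr 1
  push_cast
  rw [Finset.sum_neg_distrib, Finset.sum_mul, Finset.sum_div]

lemma lintegral_expNeg_norm_sum (χ : ℕ → ℝ) (η : ℕ) {v : ℝ} (hv : 0 ≤ v) :
    ∫⁻ γ, expNeg (ENNReal.ofReal (v * ‖∑ j ∈ Finset.range η, γ j * (χ j : ℂ)‖ ^ 2)) ∂fadingLaw =
      ENNReal.ofReal (1 + v * ∑ j ∈ Finset.range η, χ j ^ 2)⁻¹ := by
  have hm : Measurable fun z : ℂ => expNeg (ENNReal.ofReal (v * ‖z‖ ^ 2)) :=
    measurable_expNeg.comp (by fun_prop)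
  have hs : 0 ≤ ∑ j ∈ Finset.range η, χ j ^ 2 := Finset.sum_nonneg fun j _ => sq_nonneg _
  rw [← lintegral_map (f := fun z : ℂ => expNeg (ENNReal.ofReal (v * ‖z‖ ^ 2)))
    (g := fun γ : ℕ → ℂ => ∑ j ∈ Finset.range η, γ j * (χ j : ℂ)) hm (by fun_prop),
    map_sum_fadingLaw, lintegral_map hm (by fun_prop)]
  simp_rw [norm_smul, mul_pow, Real.norm_eq_abs, sq_abs, Real.sq_sqrt hs, ← mul_assoc]
  exact lintegral_expNeg_complexNormal (mul_nonneg hv hs)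

/-- `∑ |γ_j|²` is a sum of `η` independent unit exponentials, whose transforms multiply. -/
lemma lintegral_expNeg_sum_norm (η : ℕ) {v : ℝ} (hv : 0 ≤ v) :
    ∫⁻ γ, expNeg (ENNReal.ofReal (v * ∑ j ∈ Finset.range η, ‖γ j‖ ^ 2)) ∂fadingLaw =
      ENNReal.ofReal ((1 + v) ^ η)⁻¹ := by
  have hm : Measurable fun z : ℂ => expNeg (ENNReal.ofReal (v * ‖z‖ ^ 2)) :=
    measurable_expNeg.comp (by fun_prop)
  have hind : iIndepFun (fun (j : ℕ) (γ : ℕ → ℂ) => expNeg (ENNReal.ofReal (v * ‖γ j‖ ^ 2)))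
      fadingLaw :=
    iIndepFun_infinitePi (P := fun _ : ℕ => complexNormal)
      (X := fun _ z => expNeg (ENNReal.ofReal (v * ‖z‖ ^ 2))) (fun _ => hm)
  have h := lintegral_prod_eq_prod_lintegral_of_indepFun (Finset.range η) _ hind
    (fun j => hm.comp (measurable_pi_apply j))
  have h1 : ∀ j, ∫⁻ γ, expNeg (ENNReal.ofReal (v * ‖γ j‖ ^ 2)) ∂fadingLaw =
      ENNReal.ofReal (1 + v)⁻¹ := fun j => by
    rw [← lintegral_expNeg_complexNormal hv, ← map_eval_fadingLaw j,
      lintegral_map hm (measurable_pi_apply j)]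
  simp_rw [h1] at h
  rw [Finset.prod_const, Finset.card_range, ← ENNReal.ofReal_pow (by positivity), inv_pow] at h
  rw [← h]
  refine lintegral_congr fun γ => ?_
  rw [← expNeg_sum, Finset.mul_sum, ENNReal.ofReal_sum_of_nonneg fun j _ => by positivity]

end

section

/-! ### Auxiliary inequalities -/

/-- Jensen for the convex function `e^{-x}`. Indices with `q i = 0` are treated apart, since there
`e i` may be `∞`. -/
lemma expNeg_sum_mul_le {n : ℕ} (q : PMF (Fin n)) (e : Fin n → ℝ≥0∞) :
    expNeg (∑ i, q i * e i) ≤ ∑ i, q i * expNeg (e i) := by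
  by_cases htop : ∑ i, q i * e i = ∞
  · simp [htop, expNeg_top]
  have hfin : ∀ i, q i * e i ≠ ∞ := fun i => ENNReal.sum_ne_top.1 htop i (Finset.mem_univ i)
  have hq : ∀ i, q i = ENNReal.ofReal (q i).toReal := fun i =>
    (ENNReal.ofReal_toReal (q.apply_ne_top i)).symm
  have h1 : ∀ i, q i * e i = ENNReal.ofReal ((q i).toReal * (e i).toReal) := fun i => by
    rw [← ENNReal.toReal_mul, ENNReal.ofReal_toReal (hfin i)]
  have h2 : ∀ i, ENNReal.ofReal ((q i).toReal * Real.exp (-(e i).toReal)) ≤ q i * expNeg (e i) := by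
    intro i
    by_cases h0 : q i = 0
    · simp [h0]
    have he : e i ≠ ∞ := fun he => hfin i (by rw [he, ENNReal.mul_top h0])
    rw [ENNReal.ofReal_mul ENNReal.toReal_nonneg, ← hq, ← expNeg_ofReal ENNReal.toReal_nonneg,
      ENNReal.ofReal_toReal he]
  have hsum : ∑ i, (q i).toReal = 1 := by
    have h : ∑ i, q i = 1 := by rw [← q.tsum_coe, tsum_fintype]
    rw [← ENNReal.toReal_sum fun i _ => q.apply_ne_top i, h, ENNReal.toReal_one]
  refine le_trans ?_ (Finset.sum_le_sum fun i _ => h2 i)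
  rw [← ENNReal.ofReal_sum_of_nonneg fun i _ => by positivity]
  simp_rw [h1]
  rw [← ENNReal.ofReal_sum_of_nonneg fun i _ => by positivity,
    expNeg_ofReal (Finset.sum_nonneg fun i _ => by positivity)]
  refine ENNReal.ofReal_le_ofReal ?_
  have := convexOn_exp.map_sum_le (t := Finset.univ) (w := fun i => (q i).toReal)
    (p := fun i => -(e i).toReal) (fun i _ => ENNReal.toReal_nonneg) hsum (fun i _ => Set.mem_univ _)
  simpa [Finset.sum_neg_distrib] using this

lemma one_sub_expNeg_ofReal {x : ℝ} (hx : 0 ≤ x) :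
    1 - ENNReal.ofReal (1 + x)⁻¹ = 1 / (1 + (ENNReal.ofReal x)⁻¹) := by
  rcases hx.eq_or_lt with rfl | hx
  · simp
  rw [← ENNReal.ofReal_inv_of_pos hx, ← ENNReal.ofReal_one, ← ENNReal.ofReal_sub _ (by positivity),
    ← ENNReal.ofReal_add zero_le_one (by positivity), ← ENNReal.ofReal_div_of_pos (by positivity)]
  congr 1
  field_simp
  ring

lemma lintegral_one_sub {α : Type*} [MeasurableSpace α] {μ : Measure α} [IsProbabilityMeasure μ]
    {f : α → ℝ≥0∞} (hf : Measurable f) (h1 : ∀ a, f a ≤ 1) :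
    ∫⁻ a, 1 - f a ∂μ = 1 - ∫⁻ a, f a ∂μ := by
  rw [lintegral_sub hf ((lintegral_mono h1).trans_lt (by simp)).ne (Eventually.of_forall h1)]
  simp

variable {NBS NUE : ℕ} (c : Params NBS NUE)

lemma gain_nonneg : 0 ≤ gain c := by
  have := c.power_pos
  rw [gain]
  positivity

lemma le_beamInner {n : ℕ} {ρ : ℝ} (h1 : ρ ≤ 1) (θ₁ θ₂ : Fin n) : ρ ≤ beamInner ρ θ₁ θ₂ := by
  rw [beamInner]
  split_ifs
  · exact h1
  · exact le_rfl

lemma le_chi_sq (φ₀ : Fin NUE) (a : Angles NBS NUE) (j w : ℕ) :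
    c.rhoBS ^ 2 * c.rhoUE ^ 2 ≤ chi c φ₀ a j w ^ 2 := by
  have hB := c.rhoBS_nonneg
  have hU := c.rhoUE_nonneg
  have h1 := le_beamInner c.rhoUE_lt_one.le φ₀ (a.1 j)
  have h2 := le_beamInner c.rhoBS_lt_one.le (a.2.1 j) (a.2.2 w)
  have h3 := hU.trans h1
  rw [chi, ← mul_pow, mul_comm c.rhoBS]
  gcongr

/-! ### The effect of one interfering BS -/

lemma scaledPower_nonneg (φ₀ : Fin NUE) {s t : ℝ} (hs : 0 ≤ s) (ht : 0 < t) (η U : ℕ) (γ : ℕ → ℂ)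
    (a : Angles NBS NUE) : 0 ≤ scaledPower c φ₀ s η U t γ a := by
  have := gain_nonneg c
  rw [scaledPower]
  positivity

lemma measurable_scaledPower_fading (φ₀ : Fin NUE) (s : ℝ) (η U : ℕ) (t : ℝ)
    (a : Angles NBS NUE) : Measurable fun γ => scaledPower c φ₀ s η U t γ a :=
  (measurable_scaledPower c φ₀ s η U).comp
    (measurable_const.prodMk (measurable_id.prodMk measurable_const))

/-- Convexity with weights `1/U` separates the beams, which share their fading and are correlated.
Each beam is then exactly computable, and the `η` terms `χ²`, all at least `ρ_BS² ρ_UE²`, cancel the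
normalisation `1/η`. -/
lemma lintegral_fading_le (φ₀ : Fin NUE) {s t : ℝ} (hs : 0 ≤ s) (ht : 0 < t) {η U : ℕ}
    (hη : 1 ≤ η) (hU : 1 ≤ U) (a : Angles NBS NUE) :
    ∫⁻ γ, expNeg (ENNReal.ofReal (scaledPower c φ₀ s η U t γ a)) ∂fadingLaw ≤
      ENNReal.ofReal (1 + s * gain c * t⁻¹ * c.rhoBS ^ 2 * c.rhoUE ^ 2)⁻¹ := by
  have hg := gain_nonneg c
  have hη' : (0 : ℝ) < η := by exact_mod_cast hη
  have hU' : (0 : ℝ) < U := by exact_mod_cast hU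
  set C := s * gain c * t⁻¹ with hC
  have hC0 : 0 ≤ C := by positivity
  set X : ℕ → (ℕ → ℂ) → ℝ := fun w γ =>
    ‖∑ j ∈ Finset.range η, γ j * (chi c φ₀ a j w : ℂ)‖ ^ 2 with hX
  have hpt : ∀ γ, expNeg (ENNReal.ofReal (scaledPower c φ₀ s η U t γ a)) ≤
      ∑ w ∈ Finset.range U, ENNReal.ofReal (U : ℝ)⁻¹ * expNeg (ENNReal.ofReal (C / η * X w γ)) := by
    intro γ
    have hX0 : ∀ w, 0 ≤ C / η * X w γ := fun w => by positivity
    rw [expNeg_ofReal (scaledPower_nonneg c φ₀ hs ht η U γ a)]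
    simp_rw [expNeg_ofReal (hX0 _), ← ENNReal.ofReal_mul (inv_nonneg.2 hU'.le)]
    rw [← ENNReal.ofReal_sum_of_nonneg fun w _ => by positivity]
    refine ENNReal.ofReal_le_ofReal ?_
    have := convexOn_exp.map_sum_le (t := Finset.range U) (w := fun _ => (U : ℝ)⁻¹)
      (p := fun w => -(C / η * X w γ)) (fun _ _ => by positivity)
      (by rw [Finset.sum_const, Finset.card_range, nsmul_eq_mul, mul_inv_cancel₀ hU'.ne'])
      (fun _ _ => Set.mem_univ _)
    simp only [smul_eq_mul] at this
    refine le_of_eq_of_le ?_ this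
    congr 1
    rw [← Finset.mul_sum, Finset.sum_neg_distrib, ← Finset.mul_sum, scaledPower]
    simp only [hC, hX]
    field_simp
  have hm : ∀ w, Measurable fun γ : ℕ → ℂ => expNeg (ENNReal.ofReal (C / η * X w γ)) := fun w =>
    measurable_expNeg.comp (by fun_prop)
  refine (lintegral_mono hpt).trans ?_
  rw [lintegral_finsetSum _ fun w _ => (hm w).const_mul _]
  have hw : ∀ w, ∫⁻ γ, ENNReal.ofReal (U : ℝ)⁻¹ * expNeg (ENNReal.ofReal (C / η * X w γ))
      ∂fadingLaw ≤ ENNReal.ofReal (U : ℝ)⁻¹ *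
        ENNReal.ofReal (1 + C * c.rhoBS ^ 2 * c.rhoUE ^ 2)⁻¹ := by
    intro w
    rw [lintegral_const_mul _ (hm w)]
    gcongr
    rw [lintegral_expNeg_norm_sum (fun j => chi c φ₀ a j w) η (by positivity)]
    refine ENNReal.ofReal_le_ofReal ?_
    have h1 : (η : ℝ) * (c.rhoBS ^ 2 * c.rhoUE ^ 2) ≤
        ∑ j ∈ Finset.range η, chi c φ₀ a j w ^ 2 := by
      have := Finset.card_nsmul_le_sum (Finset.range η) (fun j => chi c φ₀ a j w ^ 2) _
        (fun j _ => le_chi_sq c φ₀ a j w)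
      simpa using this
    have h2 : C * c.rhoBS ^ 2 * c.rhoUE ^ 2 = C / η * (η * (c.rhoBS ^ 2 * c.rhoUE ^ 2)) := by
      field_simp
    rw [h2]
    gcongr
  refine (Finset.sum_le_sum fun w _ => hw w).trans (le_of_eq ?_)
  rw [Finset.sum_const, Finset.card_range, nsmul_eq_mul, ← mul_assoc, ← ENNReal.ofReal_natCast,
    ← ENNReal.ofReal_mul hU'.le, mul_inv_cancel₀ hU'.ne', ENNReal.ofReal_one, one_mul]

/-- The integrand of `PsiCS`. -/
def psiIntegrand (s : ℝ) (η U : ℕ) (t : ℝ) (z : Fin NUE × Angles NBS NUE) : ℝ :=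
  ((1 + s * gain c * t⁻¹ / (η * U) *
      ∑ w ∈ Finset.range U, ∑ j ∈ Finset.range η, chi c z.1 z.2 j w ^ 2) ^ η)⁻¹

/-- Cauchy-Schwarz bounds every beam by the same variable `∑ |γ_j|²`, so the sum over beams acts
only on the `χ²`. -/
lemma le_lintegral_fading (φ₀ : Fin NUE) {s t : ℝ} (hs : 0 ≤ s) (ht : 0 < t) (η U : ℕ)
    (a : Angles NBS NUE) :
    ENNReal.ofReal (psiIntegrand c s η U t (φ₀, a)) ≤
      ∫⁻ γ, expNeg (ENNReal.ofReal (scaledPower c φ₀ s η U t γ a)) ∂fadingLaw := by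
  have hg := gain_nonneg c
  rw [psiIntegrand, ← lintegral_expNeg_sum_norm η (by positivity)]
  refine lintegral_mono fun γ => expNeg_antitone (ENNReal.ofReal_le_ofReal ?_)
  rw [scaledPower, mul_assoc (s * gain c * t⁻¹ / (η * U)), Finset.sum_mul]
  gcongr with w hw
  calc ‖∑ j ∈ Finset.range η, γ j * (chi c φ₀ a j w : ℂ)‖ ^ 2
      ≤ (∑ j ∈ Finset.range η, |chi c φ₀ a j w| * ‖γ j‖) ^ 2 := by
        gcongr
        refine (norm_sum_le _ _).trans (le_of_eq (Finset.sum_congr rfl fun j _ => ?_))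
        rw [norm_mul, Complex.norm_real, Real.norm_eq_abs, mul_comm]
    _ ≤ (∑ j ∈ Finset.range η, |chi c φ₀ a j w| ^ 2) * ∑ j ∈ Finset.range η, ‖γ j‖ ^ 2 :=
        Finset.sum_mul_sq_le_sq_mul_sq _ _ _
    _ = _ := by simp_rw [sq_abs]

lemma psiIntegrand_mem {s t : ℝ} (hs : 0 ≤ s) (ht : 0 < t) (η U : ℕ)
    (z : Fin NUE × Angles NBS NUE) :
    0 ≤ psiIntegrand c s η U t z ∧ psiIntegrand c s η U t z ≤ 1 := by
  have hg := gain_nonneg c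
  rw [psiIntegrand]
  refine ⟨by positivity, inv_le_one_of_one_le₀ (one_le_pow₀ ?_)⟩
  rw [le_add_iff_nonneg_right]
  positivity

lemma measurable_psiIntegrand (s : ℝ) (η U : ℕ) (t : ℝ) : Measurable (psiIntegrand c s η U t) := by
  refine measurable_from_prod_countable_right fun i => ?_
  refine ((((Finset.measurable_fun_sum _ fun w _ => Finset.measurable_fun_sum _ fun j _ => ?_).const_mul
    _).const_add 1).pow_const η).inv
  exact (measurable_chi c i j w).pow_const 2

lemma integrable_psiIntegrand {s t : ℝ} (hs : 0 ≤ s) (ht : 0 < t) (η U : ℕ) :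
    Integrable (psiIntegrand c s η U t) (c.qUE.toMeasure.prod (anglesLaw c)) := by
  refine Integrable.of_bound (C := 1) (measurable_psiIntegrand c s η U t).aestronglyMeasurable
    (Eventually.of_forall fun z => ?_)
  have := psiIntegrand_mem c hs ht η U z
  rw [Real.norm_of_nonneg this.1]
  exact this.2

lemma PsiCS_eq (s : ℝ) (η U : ℕ) (t : ℝ) : PsiCS c s η U t =
    ∫ z, psiIntegrand c s η U t z ∂(c.qUE.toMeasure.prod (anglesLaw c)) := rfl

lemma PsiCS_mem {s t : ℝ} (hs : 0 ≤ s) (ht : 0 < t) (η U : ℕ) :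
    0 ≤ PsiCS c s η U t ∧ PsiCS c s η U t ≤ 1 := by
  rw [PsiCS_eq]
  refine ⟨integral_nonneg fun z => (psiIntegrand_mem c hs ht η U z).1, ?_⟩
  have := integral_mono (integrable_psiIntegrand c hs ht η U) (integrable_const 1)
    fun z => (psiIntegrand_mem c hs ht η U z).2
  simpa using this

/-- The expectation of `1 - e^{-sI}` over fading and angles, for a BS at path loss `t` whose link
has `η` paths and which serves `U` users. -/
def fadingDeficit (s : ℝ) (φ₀ : Fin NUE) (η U : ℕ) (t : ℝ) : ℝ≥0∞ :=
  ∫⁻ z, 1 - expNeg (ENNReal.ofReal (scaledPower c φ₀ s η U t z.1 z.2)) ∂(fadingLaw.prod (anglesLaw c))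

lemma fadingDeficit_eq (s : ℝ) (φ₀ : Fin NUE) (η U : ℕ) (t : ℝ) :
    fadingDeficit c s φ₀ η U t =
      ∫⁻ a, 1 - ∫⁻ γ, expNeg (ENNReal.ofReal (scaledPower c φ₀ s η U t γ a)) ∂fadingLaw
        ∂anglesLaw c := by
  have hm : Measurable fun z : (ℕ → ℂ) × Angles NBS NUE =>
      expNeg (ENNReal.ofReal (scaledPower c φ₀ s η U t z.1 z.2)) :=
    measurable_expNeg.comp ((measurable_scaledPower c φ₀ s η U).comp
      (measurable_const.prodMk measurable_id)).ennreal_ofReal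
  have hm2 : Measurable fun z : (ℕ → ℂ) × Angles NBS NUE =>
      1 - expNeg (ENNReal.ofReal (scaledPower c φ₀ s η U t z.1 z.2)) := measurable_const.sub hm
  rw [fadingDeficit, lintegral_prod_symm' _ hm2]
  refine lintegral_congr fun a => lintegral_one_sub ?_ fun γ => expNeg_le_one _
  exact measurable_expNeg.comp (measurable_scaledPower_fading c φ₀ s η U t a).ennreal_ofReal

lemma le_fadingDeficit (φ₀ : Fin NUE) {s t : ℝ} (hs : 0 ≤ s) (ht : 0 < t) {η U : ℕ}
    (hη : 1 ≤ η) (hU : 1 ≤ U) :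
    1 / (1 + (ENNReal.ofReal (s * gain c * t⁻¹ * c.rhoBS ^ 2 * c.rhoUE ^ 2))⁻¹) ≤
      fadingDeficit c s φ₀ η U t := by
  have hg := gain_nonneg c
  rw [fadingDeficit_eq, ← one_sub_expNeg_ofReal (by positivity)]
  calc _ = ∫⁻ _, 1 - ENNReal.ofReal (1 + s * gain c * t⁻¹ * c.rhoBS ^ 2 * c.rhoUE ^ 2)⁻¹
        ∂anglesLaw c := by simp
    _ ≤ _ := lintegral_mono fun a => tsub_le_tsub_left (lintegral_fading_le c φ₀ hs ht hη hU a) _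

/-- The average over `φ₀` is needed because `PsiCS` already includes it. -/
lemma sum_fadingDeficit_le {s t : ℝ} (hs : 0 ≤ s) (ht : 0 < t) (η U : ℕ) :
    ∑ i, c.qUE i * fadingDeficit c s i η U t ≤ ENNReal.ofReal (1 - PsiCS c s η U t) := by
  have hmem := psiIntegrand_mem c hs ht η U
  have hm := measurable_psiIntegrand c s η U t
  have hint := integrable_psiIntegrand c hs ht η U
  have h1 : ENNReal.ofReal (1 - PsiCS c s η U t) =
      ∫⁻ z, ENNReal.ofReal (1 - psiIntegrand c s η U t z) ∂(c.qUE.toMeasure.prod (anglesLaw c)) := by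
    have hint2 : Integrable (fun z => 1 - psiIntegrand c s η U t z)
        (c.qUE.toMeasure.prod (anglesLaw c)) := (integrable_const 1).sub hint
    rw [← ofReal_integral_eq_lintegral_ofReal hint2
      (Eventually.of_forall fun z => sub_nonneg.2 (hmem z).2),
      integral_sub (integrable_const 1) hint, PsiCS_eq]
    simp only [integral_const, probReal_univ, smul_eq_mul, mul_one]
  rw [h1, lintegral_prod _ (hm.const_sub 1).ennreal_ofReal.aemeasurable, lintegral_fintype]
  refine Finset.sum_le_sum fun i _ => ?_
  rw [PMF.toMeasure_apply_singleton _ _ (measurableSet_singleton i), mul_comm, fadingDeficit_eq]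
  gcongr with a
  rw [ENNReal.ofReal_sub _ (hmem _).1, ENNReal.ofReal_one]
  exact tsub_le_tsub_left (le_lintegral_fading c i hs ht η U a) _

/-- The expectation of `1 - e^{-sI}` over all marks, for a BS at path loss `t` in link state `b`. -/
def markDeficit (s : ℝ) (φ₀ : Fin NUE) (b : Bool) (t : ℝ) : ℝ≥0∞ :=
  ∫⁻ m, 1 - expNeg (ENNReal.ofReal (scaledPower c φ₀ s (c.eta b) m.1 t m.2.1 m.2.2)) ∂markLaw c

lemma measurable_deficit (s : ℝ) (φ₀ : Fin NUE) (b : Bool) :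
    Measurable fun z : ℝ × ℕ × (ℕ → ℂ) × Angles NBS NUE =>
      1 - expNeg (ENNReal.ofReal (scaledPower c φ₀ s (c.eta b) z.2.1 z.1 z.2.2.1 z.2.2.2)) := by
  refine measurable_const.sub (measurable_expNeg.comp (Measurable.ennreal_ofReal ?_))
  refine measurable_comp_countable (f := fun U (z : ℝ × ℕ × (ℕ → ℂ) × Angles NBS NUE) =>
    scaledPower c φ₀ s (c.eta b) U z.1 z.2.2.1 z.2.2.2) (g := fun z => z.2.1) (fun U => ?_)
    (measurable_fst.comp measurable_snd)
  exact (measurable_scaledPower c φ₀ s (c.eta b) U).comp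
    (measurable_fst.prodMk (measurable_snd.comp measurable_snd))

lemma measurable_markDeficit (s : ℝ) (φ₀ : Fin NUE) (b : Bool) :
    Measurable (markDeficit c s φ₀ b) :=
  (measurable_deficit c s φ₀ b).lintegral_prod_right'

lemma markDeficit_eq (s : ℝ) (φ₀ : Fin NUE) (b : Bool) (t : ℝ) :
    markDeficit c s φ₀ b t = ∑' U, c.pU U * fadingDeficit c s φ₀ (c.eta b) U t := by
  have hm : Measurable fun m : ℕ × (ℕ → ℂ) × Angles NBS NUE =>
      1 - expNeg (ENNReal.ofReal (scaledPower c φ₀ s (c.eta b) m.1 t m.2.1 m.2.2)) := by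
    have h := (measurable_deficit c s φ₀ b).comp (measurable_prodMk_left (x := t))
    exact h
  rw [markDeficit, markLaw, lintegral_prod _ hm.aemeasurable, lintegral_countable']
  refine tsum_congr fun U => ?_
  rw [PMF.toMeasure_apply_singleton _ _ (measurableSet_singleton U), mul_comm]
  rfl

lemma le_markDeficit (φ₀ : Fin NUE) {s t : ℝ} (hs : 0 ≤ s) (ht : 0 < t) (b : Bool) :
    (1 - c.pU 0) * (1 / (1 + (ENNReal.ofReal (s * gain c * t⁻¹ * c.rhoBS ^ 2 * c.rhoUE ^ 2))⁻¹)) ≤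
      markDeficit c s φ₀ b t := by
  have h1 : 1 - c.pU 0 = ∑' U, if U = 0 then 0 else c.pU U := by
    rw [← c.pU.tsum_coe, ENNReal.tsum_eq_add_tsum_ite 0,
      ENNReal.add_sub_cancel_left (c.pU.apply_ne_top 0)]
    exact tsum_congr fun U => by split_ifs <;> rfl
  rw [markDeficit_eq, h1, ← ENNReal.tsum_mul_right]
  refine ENNReal.tsum_le_tsum fun U => ?_
  split_ifs with hU
  · simp
  · gcongr
    exact le_fadingDeficit c φ₀ hs ht (c.eta_pos b) (Nat.one_le_iff_ne_zero.2 hU)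

lemma tsum_mul_ofReal_one_sub {Ψ : ℕ → ℝ} (h : ∀ U, 0 ≤ Ψ U ∧ Ψ U ≤ 1) :
    ∑' U, c.pU U * ENNReal.ofReal (1 - Ψ U) =
      ENNReal.ofReal (1 - ∑' U, (c.pU U).toReal * Ψ U) := by
  have hp : HasSum (fun U => (c.pU U).toReal) 1 := by
    have h2 := ENNReal.hasSum_toReal (f := c.pU) (by rw [c.pU.tsum_coe]; exact ENNReal.one_ne_top)
    rwa [← ENNReal.tsum_toReal_eq c.pU.apply_ne_top, c.pU.tsum_coe, ENNReal.toReal_one] at h2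
  have hs : Summable fun U => (c.pU U).toReal * Ψ U :=
    Summable.of_nonneg_of_le (fun U => mul_nonneg ENNReal.toReal_nonneg (h U).1)
      (fun U => mul_le_of_le_one_right ENNReal.toReal_nonneg (h U).2) hp.summable
  have h1 : HasSum (fun U => (c.pU U).toReal * (1 - Ψ U)) (1 - ∑' U, (c.pU U).toReal * Ψ U) := by
    simpa only [mul_sub, mul_one] using hp.sub hs.hasSum
  rw [← h1.tsum_eq, ENNReal.ofReal_tsum_of_nonneg
    (fun U => mul_nonneg ENNReal.toReal_nonneg (sub_nonneg.2 (h U).2)) h1.summable]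
  refine tsum_congr fun U => ?_
  rw [ENNReal.ofReal_mul ENNReal.toReal_nonneg, ENNReal.ofReal_toReal (c.pU.apply_ne_top U)]

lemma sum_markDeficit_le {s t : ℝ} (hs : 0 ≤ s) (ht : 0 < t) (b : Bool) :
    ∑ i, c.qUE i * markDeficit c s i b t ≤
      ENNReal.ofReal (1 - ∑' U, (c.pU U).toReal * PsiCS c s (c.eta b) U t) := by
  simp_rw [markDeficit_eq, ← ENNReal.tsum_mul_left]
  rw [← tsum_mul_ofReal_one_sub c (PsiCS_mem c hs ht (c.eta b)),
    ← Summable.tsum_finsetSum fun i _ => ENNReal.summable]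
  refine ENNReal.tsum_le_tsum fun U => ?_
  simp_rw [mul_left_comm _ (c.pU U)]
  rw [← Finset.mul_sum]
  gcongr
  exact sum_fadingDeficit_le c hs ht (c.eta b) U

/-! ### Bounds on the exponent -/

/-- The marks are integrated out for a fixed link; what remains depends on the link only through its
state and path loss, and so lives on the intensities of path losses. -/
lemma laplaceBeyond_eq {s : ℝ} (φ₀ : Fin NUE) (l : ℝ) :
    laplaceBeyond c s φ₀ l = expNeg (∫⁻ t in Set.Ioi l, markDeficit c s φ₀ true t ∂lossIntensity c true +
      ∫⁻ t in Set.Ioi l, markDeficit c s φ₀ false t ∂lossIntensity c false) := by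
  have hκ := measurable_pathLoss c
  have hB : MeasurableSet {y : Station NBS NUE | l < pathLoss c y.1} :=
    measurableSet_lt measurable_const (measurable_stationLoss c)
  have hG : Measurable fun y : Station NBS NUE =>
      1 - expNeg (ENNReal.ofReal (s * power c φ₀ y)) :=
    measurable_const.sub (measurable_expNeg.comp ((measurable_power c φ₀).const_mul s).ennreal_ofReal)
  have hb : ∀ b, ∫⁻ x, ∫⁻ m, {y : Station NBS NUE | l < pathLoss c y.1}.indicator
      (fun y => 1 - expNeg (ENNReal.ofReal (s * power c φ₀ y))) (x, m) ∂markLaw c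
        ∂linkIntensity c b = ∫⁻ t in Set.Ioi l, markDeficit c s φ₀ b t ∂lossIntensity c b := by
    intro b
    have h1 : ∀ x, ∫⁻ m, {y : Station NBS NUE | l < pathLoss c y.1}.indicator
        (fun y => 1 - expNeg (ENNReal.ofReal (s * power c φ₀ y))) (x, m) ∂markLaw c =
        (Set.Ioi l).indicator (markDeficit c s φ₀ x.2.1) (pathLoss c x) := by
      intro x
      by_cases hx : l < pathLoss c x
      · simp only [Set.indicator, Set.mem_ofPred_eq, hx, if_true, Set.mem_Ioi, markDeficit,
          mul_power]
      · simp [Set.indicator, hx]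
    simp_rw [h1]
    rw [lintegral_linkIntensity_congr c b
      (f := fun b x => (Set.Ioi l).indicator (markDeficit c s φ₀ b) (pathLoss c x))
      (fun b => ((measurable_markDeficit c s φ₀ b).indicator measurableSet_Ioi).comp hκ),
      ← lintegral_indicator measurableSet_Ioi, lossIntensity,
      lintegral_map ((measurable_markDeficit c s φ₀ b).indicator measurableSet_Ioi) hκ]
  rw [laplaceBeyond, ← lintegral_indicator hB, lintegral_stationIntensity c (hG.indicator hB), hb, hb]

lemma ae_lossIntensity_pos (b : Bool) : ∀ᵐ t ∂lossIntensity c b, 0 < t := by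
  rw [lossIntensity, ae_map_iff (measurable_pathLoss c).aemeasurable measurableSet_Ioi]
  exact Eventually.of_forall (pathLoss_pos c)

/-- The path loss intensities have no atoms. -/
lemma setLIntegral_Ioi_eq_Ici (b : Bool) (l : ℝ) (f : ℝ → ℝ≥0∞) :
    ∫⁻ t in Set.Ioi l, f t ∂lossIntensity c b = ∫⁻ t in Set.Ici l, f t ∂lossIntensity c b := by
  refine setLIntegral_congr (Ioi_ae_eq_Ici' ?_)
  rw [lossIntensity, Measure.map_apply (measurable_pathLoss c) (measurableSet_singleton l)]
  exact linkIntensity_eq_zero c b l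

lemma laplaceBeyond_le {s : ℝ} (hs : 0 ≤ s) (φ₀ : Fin NUE) (l : ℝ) :
    laplaceBeyond c s φ₀ l ≤ expNeg ((1 - c.pU 0) * upperExponent c s l) := by
  rw [laplaceBeyond_eq, upperExponent, Measure.restrict_add, lintegral_add_measure, mul_add]
  refine expNeg_antitone ?_
  have hm : Measurable fun t : ℝ =>
      1 / (1 + (ENNReal.ofReal (s * gain c * t⁻¹ * c.rhoBS ^ 2 * c.rhoUE ^ 2))⁻¹) := by
    fun_prop
  have h : ∀ b, (1 - c.pU 0) * ∫⁻ t in Set.Ici l,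
      1 / (1 + (ENNReal.ofReal (s * gain c * t⁻¹ * c.rhoBS ^ 2 * c.rhoUE ^ 2))⁻¹)
        ∂lossIntensity c b ≤ ∫⁻ t in Set.Ioi l, markDeficit c s φ₀ b t ∂lossIntensity c b := by
    intro b
    rw [setLIntegral_Ioi_eq_Ici, ← lintegral_const_mul _ hm]
    refine lintegral_mono_ae (ae_restrict_of_ae ((ae_lossIntensity_pos c b).mono fun t ht => ?_))
    exact le_markDeficit c φ₀ hs ht b
  exact add_le_add (h true) (h false)

/-- Jensen brings the average over `φ₀` into the exponent. `Ψ` is left arbitrary so that both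
versions of the lower bound are instances. -/
lemma le_sum_laplaceBeyond {s : ℝ} (l : ℝ) {Ψ : ℕ → ℕ → ℝ → ℝ}
    (hΨ : ∀ b t, 0 < t → ∑ i, c.qUE i * markDeficit c s i b t ≤
      ENNReal.ofReal (1 - ∑' U, (c.pU U).toReal * Ψ (c.eta b) U t)) :
    expNeg (lowerExponent c Ψ true l) * expNeg (lowerExponent c Ψ false l) ≤
      ∑ i, c.qUE i * laplaceBeyond c s i l := by
  simp_rw [laplaceBeyond_eq]
  refine le_trans ?_ (expNeg_sum_mul_le _ _)
  rw [← expNeg_add]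
  refine expNeg_antitone ?_
  simp_rw [mul_add]
  rw [Finset.sum_add_distrib]
  have h : ∀ b, ∑ i, c.qUE i * ∫⁻ t in Set.Ioi l, markDeficit c s i b t ∂lossIntensity c b ≤
      lowerExponent c Ψ b l := by
    intro b
    simp_rw [← lintegral_const_mul _ (measurable_markDeficit c s _ b)]
    rw [← lintegral_finsetSum _ fun i _ => (measurable_markDeficit c s i b).const_mul _,
      setLIntegral_Ioi_eq_Ici, lowerExponent]
    exact lintegral_mono_ae (ae_restrict_of_ae ((ae_lossIntensity_pos c b).mono fun t ht => hΨ b t ht))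
  exact add_le_add (h true) (h false)

end

section

/-! ### Mixtures of exponentials -/

lemma integrable_exp_sum_norm (η : ℕ) {v : ℝ} (hv : 0 ≤ v) :
    Integrable (fun γ : ℕ → ℂ => Real.exp (-(v * ∑ j ∈ Finset.range η, ‖γ j‖ ^ 2))) fadingLaw := by
  refine Integrable.of_bound (C := 1) (Measurable.aestronglyMeasurable (by fun_prop))
    (Eventually.of_forall fun γ => ?_)
  rw [Real.norm_of_nonneg (Real.exp_pos _).le, Real.exp_le_one_iff, neg_nonpos]
  positivity

lemma integral_exp_sum_norm (η : ℕ) {v : ℝ} (hv : 0 ≤ v) :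
    ∫ γ, Real.exp (-(v * ∑ j ∈ Finset.range η, ‖γ j‖ ^ 2)) ∂fadingLaw = ((1 + v) ^ η)⁻¹ := by
  rw [integral_eq_lintegral_of_nonneg_ae (Eventually.of_forall fun γ => (Real.exp_pos _).le)
    (integrable_exp_sum_norm η hv).aestronglyMeasurable,
    ← ENNReal.toReal_ofReal (r := ((1 + v) ^ η)⁻¹) (by positivity), ← lintegral_expNeg_sum_norm η hv]
  congr 1
  exact lintegral_congr fun γ => (expNeg_ofReal (by positivity)).symm

/-- `(1 + C x)^{-η}` is the mean of `e^{-C x Z}` with `Z = ∑ |γ_j|²`. -/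
lemma sum_mul_inv_pow_eq {ι : Type*} (S : Finset ι) (w x : ι → ℝ) (hx : ∀ i ∈ S, 0 ≤ x i)
    (η : ℕ) {C : ℝ} (hC : 0 ≤ C) :
    Integrable (fun γ : ℕ → ℂ => ∑ i ∈ S, w i *
      Real.exp (-(C * x i * ∑ j ∈ Finset.range η, ‖γ j‖ ^ 2))) fadingLaw ∧
    ∑ i ∈ S, w i * ((1 + C * x i) ^ η)⁻¹ = ∫ γ, ∑ i ∈ S, w i *
      Real.exp (-(C * x i * ∑ j ∈ Finset.range η, ‖γ j‖ ^ 2)) ∂fadingLaw := by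
  have hint : ∀ i ∈ S, Integrable (fun γ : ℕ → ℂ => w i *
      Real.exp (-(C * x i * ∑ j ∈ Finset.range η, ‖γ j‖ ^ 2))) fadingLaw := fun i hi =>
    (integrable_exp_sum_norm η (mul_nonneg hC (hx i hi))).const_mul _
  refine ⟨integrable_finsetSum _ hint, ?_⟩
  rw [integral_finsetSum _ hint]
  refine Finset.sum_congr rfl fun i hi => ?_
  rw [integral_const_mul, integral_exp_sum_norm η (mul_nonneg hC (hx i hi))]

/-- An inequality between Laplace transforms of finite measures on `[0,∞)` carries over to the
mixtures `(1 + C x)^{-η}` of exponentials. -/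
lemma sum_mul_inv_pow_le {ι κ : Type*} (S : Finset ι) (T : Finset κ) (w x : ι → ℝ) (w' x' : κ → ℝ)
    (hx : ∀ i ∈ S, 0 ≤ x i) (hx' : ∀ i ∈ T, 0 ≤ x' i)
    (h : ∀ a : ℝ, 0 ≤ a →
      ∑ i ∈ S, w i * Real.exp (-(a * x i)) ≤ ∑ i ∈ T, w' i * Real.exp (-(a * x' i)))
    (η : ℕ) {C : ℝ} (hC : 0 ≤ C) :
    ∑ i ∈ S, w i * ((1 + C * x i) ^ η)⁻¹ ≤ ∑ i ∈ T, w' i * ((1 + C * x' i) ^ η)⁻¹ := by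
  obtain ⟨hi, he⟩ := sum_mul_inv_pow_eq S w x hx η hC
  obtain ⟨hi', he'⟩ := sum_mul_inv_pow_eq T w' x' hx' η hC
  rw [he, he']
  refine integral_mono hi hi' fun γ => ?_
  have := h (C * ∑ j ∈ Finset.range η, ‖γ j‖ ^ 2) (by positivity)
  simpa only [mul_right_comm] using this

/-! ### Combinatorics of the virtual angles -/

/-- The quantity `∑_j a_j² b_j²` for `η` paths, when `m` AOAs and `j` AODs are aligned, in the
arrangement that maximises it. -/
def alignedGain (ρB ρU : ℝ) (η j m : ℕ) : ℝ :=
  ∑ r ∈ Finset.Icc 1 η, (ρB ^ 2 + if r ≤ j then 1 - ρB ^ 2 else 0) *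
    (ρU ^ 2 + if r ≤ m then 1 - ρU ^ 2 else 0)

lemma sum_Icc_ite {η j : ℕ} (hj : j ≤ η) (x : ℝ) :
    ∑ r ∈ Finset.Icc 1 η, (if r ≤ j then x else 0) = j * x := by
  rw [← Finset.sum_filter]
  have : (Finset.Icc 1 η).filter (· ≤ j) = Finset.Icc 1 j := by
    ext r
    simp only [Finset.mem_filter, Finset.mem_Icc]
    omega
  rw [this, Finset.sum_const, Nat.card_Icc, nsmul_eq_mul, Nat.add_sub_cancel]

/-- Expanding the product, the two conditions `r ≤ j` and `r ≤ m` combine to `r ≤ min j m`: the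
overlap is as large as it can be. -/
lemma alignedGain_eq (ρB ρU : ℝ) {η j m : ℕ} (hj : j ≤ η) (hm : m ≤ η) :
    alignedGain ρB ρU η j m = ρB ^ 2 * (η * ρU ^ 2 + m * (1 - ρU ^ 2)) +
      (1 - ρB ^ 2) * (j * ρU ^ 2 + (min j m : ℕ) * (1 - ρU ^ 2)) := by
  have h : ∀ r, (ρB ^ 2 + if r ≤ j then 1 - ρB ^ 2 else 0) *
      (ρU ^ 2 + if r ≤ m then 1 - ρU ^ 2 else 0) =
      ρB ^ 2 * ρU ^ 2 + (if r ≤ m then ρB ^ 2 * (1 - ρU ^ 2) else 0) +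
        (if r ≤ j then (1 - ρB ^ 2) * ρU ^ 2 else 0) +
        (if r ≤ min j m then (1 - ρB ^ 2) * (1 - ρU ^ 2) else 0) := by
    intro r
    simp only [le_min_iff]
    by_cases h1 : r ≤ j <;> by_cases h2 : r ≤ m <;> simp [h1, h2] <;> ring
  rw [alignedGain, Finset.sum_congr rfl fun r _ => h r, Finset.sum_add_distrib,
    Finset.sum_add_distrib, Finset.sum_add_distrib, sum_Icc_ite hm, sum_Icc_ite hj,
    sum_Icc_ite ((min_le_left j m).trans hj), Finset.sum_const, Nat.card_Icc, nsmul_eq_mul,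
    Nat.add_sub_cancel]
  ring

lemma alignedGain_nonneg (ρB ρU : ℝ) (η j m : ℕ) :
    0 ≤ alignedGain ρB ρU η j m := by
  refine Finset.sum_nonneg fun r _ => mul_nonneg ?_ ?_ <;> split_ifs <;> nlinarith

lemma beamInner_sq {n : ℕ} (ρ : ℝ) (i k : Fin n) :
    beamInner ρ i k ^ 2 = ρ ^ 2 + if k = i then 1 - ρ ^ 2 else 0 := by
  rw [beamInner]
  by_cases h : i = k
  · simp [h]
  · simp [h, Ne.symm h]

lemma sum_mul_beamInner {n : ℕ} {q : Fin n → ℝ} (hq : ∑ i, q i = 1) (ρ : ℝ) (k : Fin n)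
    (F : ℝ → ℝ) :
    ∑ x, q x * F (beamInner ρ x k) = q k * F 1 + (1 - q k) * F ρ := by
  have h1 := Finset.add_sum_erase Finset.univ q (Finset.mem_univ k)
  rw [← Finset.add_sum_erase Finset.univ (fun x => q x * F (beamInner ρ x k)) (Finset.mem_univ k)]
  have h2 : ∑ x ∈ Finset.univ.erase k, q x * F (beamInner ρ x k) =
      ∑ x ∈ Finset.univ.erase k, q x * F ρ :=
    Finset.sum_congr rfl fun x hx => by rw [beamInner, if_neg (Finset.ne_of_mem_erase hx)]
  rw [h2, ← Finset.sum_mul, beamInner, if_pos rfl]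
  congr 2
  linarith

lemma sum_pi_prod {n η : ℕ} {q : Fin n → ℝ} (hq : ∑ i, q i = 1) :
    ∑ φ : Fin η → Fin n, ∏ r, q (φ r) = 1 := by
  rw [← Fintype.sum_pow, hq, one_pow]

/-- The number of coordinates equal to `i` of a random vector with independent identically
distributed coordinates is binomial. -/
lemma sum_pi_card {n η : ℕ} {q : Fin n → ℝ} (hq : ∑ i, q i = 1) (i : Fin n) (G : ℕ → ℝ) :
    ∑ φ : Fin η → Fin n, (∏ r, q (φ r)) * G (Finset.univ.filter fun r => φ r = i).card =
      ∑ m ∈ Finset.range (η + 1), (η.choose m : ℝ) * q i ^ m * (1 - q i) ^ (η - m) * G m := by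
  -- Vectors are grouped by the set `T` of coordinates equal to `i`; the weight depends on `T` only
  -- through its cardinality.
  have hT : ∀ T : Finset (Fin η),
      ∑ φ : Fin η → Fin n with (Finset.univ.filter fun r => φ r = i) = T, ∏ r, q (φ r) =
        q i ^ T.card * (1 - q i) ^ (η - T.card) := by
    intro T
    have h1 : (Finset.univ.filter fun φ : Fin η → Fin n =>
        (Finset.univ.filter fun r => φ r = i) = T) =
        Fintype.piFinset fun r => if r ∈ T then {i} else Finset.univ.erase i := by
      ext φ
      simp only [Finset.mem_filter, Finset.mem_univ, true_and, Fintype.mem_piFinset,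
        Finset.ext_iff]
      refine forall_congr' fun r => ?_
      by_cases hr : r ∈ T <;> simp [hr]
    have h2 := Finset.add_sum_erase Finset.univ q (Finset.mem_univ i)
    have h3 : ∀ r, ∑ x ∈ (if r ∈ T then {i} else Finset.univ.erase i), q x =
        if r ∈ T then q i else 1 - q i := by
      intro r
      split_ifs
      · simp
      · linarith
    rw [h1, ← Finset.prod_univ_sum]
    simp_rw [h3]
    rw [Finset.prod_ite]
    simp [Finset.filter_not, Finset.card_sdiff]
  rw [← Finset.sum_fiberwise Finset.univ
    (fun φ : Fin η → Fin n => Finset.univ.filter fun r => φ r = i)]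
  have h4 : ∀ T : Finset (Fin η),
      ∑ φ : Fin η → Fin n with (Finset.univ.filter fun r => φ r = i) = T,
        (∏ r, q (φ r)) * G (Finset.univ.filter fun r => φ r = i).card =
        q i ^ T.card * (1 - q i) ^ (η - T.card) * G T.card := by
    intro T
    rw [← hT T, Finset.sum_mul]
    refine Finset.sum_congr rfl fun φ hφ => ?_
    rw [(Finset.mem_filter.1 hφ).2]
  rw [Finset.sum_congr rfl fun T _ => h4 T, ← Finset.powerset_univ,
    Finset.sum_powerset_apply_card (fun m => q i ^ m * (1 - q i) ^ (η - m) * G m), Finset.card_univ,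
    Fintype.card_fin]
  refine Finset.sum_congr rfl fun m _ => ?_
  rw [nsmul_eq_mul]
  ring

section Alignment

variable {N η : ℕ} {ρB ρU : ℝ}

/-- Here `T` is the set of paths aligned at the BS and `J` below the set aligned at the user. The
gain increases with `|T ∩ J|`, which is at most `min |T| |J|`. -/
lemma sum_le_alignedGain (hB : ρB ^ 2 ≤ 1) (hU : ρU ^ 2 ≤ 1) (i : Fin N) (φ : Fin η → Fin N)
    (T : Finset (Fin η)) :
    ∑ r ∈ T, beamInner ρU i (φ r) ^ 2 + ∑ r ∈ Tᶜ, beamInner ρU i (φ r) ^ 2 * ρB ^ 2 ≤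
      alignedGain ρB ρU η T.card (Finset.univ.filter fun r => φ r = i).card := by
  have hcard : ∀ S : Finset (Fin η), S.card ≤ η := fun S => by
    simpa using Finset.card_le_univ S
  set J := Finset.univ.filter fun r => φ r = i with hJ
  have hS : ∀ S : Finset (Fin η), ∑ r ∈ S, beamInner ρU i (φ r) ^ 2 =
      S.card * ρU ^ 2 + (S ∩ J).card * (1 - ρU ^ 2) := by
    intro S
    simp_rw [beamInner_sq]
    rw [Finset.sum_add_distrib, Finset.sum_const, nsmul_eq_mul, ← Finset.sum_filter,
      Finset.sum_const, nsmul_eq_mul, hJ, Finset.inter_filter, Finset.inter_univ]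
  have hsum := Finset.sum_add_sum_compl T fun r => beamInner ρU i (φ r) ^ 2
  have huniv := hS Finset.univ
  rw [Finset.univ_inter, Finset.card_univ, Fintype.card_fin] at huniv
  rw [huniv, hS T] at hsum
  rw [alignedGain_eq _ _ (hcard T) (hcard J), ← Finset.sum_mul, hS T]
  have hmin : ((T ∩ J).card : ℝ) ≤ (min T.card J.card : ℕ) := by
    exact_mod_cast le_min (Finset.card_le_card Finset.inter_subset_left)
      (Finset.card_le_card Finset.inter_subset_right)
  have h1 := mul_le_mul_of_nonneg_right hmin (sub_nonneg.2 hU)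
  have h2 := mul_le_mul_of_nonneg_left h1 (sub_nonneg.2 hB)
  have h3 : ∑ r ∈ Tᶜ, beamInner ρU i (φ r) ^ 2 = η * ρU ^ 2 + J.card * (1 - ρU ^ 2) -
      (T.card * ρU ^ 2 + (T ∩ J).card * (1 - ρU ^ 2)) := by linarith
  rw [h3]
  nlinarith

/-- Expanding the product over paths sums over the sets `T` of paths aligned with the beam, whose
size is binomial; `sum_le_alignedGain` compares term by term. -/
lemma sum_alignedGain_le_prod (hB : ρB ^ 2 ≤ 1) (hU : ρU ^ 2 ≤ 1) (i : Fin N) (φ : Fin η → Fin N)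
    {q a : ℝ} (hq0 : 0 ≤ q) (hq1 : q ≤ 1) (ha : 0 ≤ a) :
    ∑ j ∈ Finset.range (η + 1), (η.choose j : ℝ) * q ^ j * (1 - q) ^ (η - j) *
        Real.exp (-(a * alignedGain ρB ρU η j (Finset.univ.filter fun r => φ r = i).card)) ≤
      ∏ r, (q * Real.exp (-(a * beamInner ρU i (φ r) ^ 2)) +
        (1 - q) * Real.exp (-(a * (beamInner ρU i (φ r) ^ 2 * ρB ^ 2)))) := by
  rw [Fintype.prod_add]
  set J := Finset.univ.filter fun r => φ r = i
  have h := Finset.sum_powerset_apply_card (x := (Finset.univ : Finset (Fin η)))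
    (fun j => q ^ j * (1 - q) ^ (η - j) * Real.exp (-(a * alignedGain ρB ρU η j J.card)))
  rw [Finset.card_univ, Fintype.card_fin, Finset.powerset_univ] at h
  have h' : ∑ j ∈ Finset.range (η + 1), (η.choose j : ℝ) * q ^ j * (1 - q) ^ (η - j) *
        Real.exp (-(a * alignedGain ρB ρU η j J.card)) = ∑ j ∈ Finset.range (η + 1), η.choose j •
      (q ^ j * (1 - q) ^ (η - j) * Real.exp (-(a * alignedGain ρB ρU η j J.card))) :=
    Finset.sum_congr rfl fun j _ => by
      rw [nsmul_eq_mul]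
      ring
  rw [h', ← h]
  refine Finset.sum_le_sum fun T _ => ?_
  rw [Finset.prod_mul_distrib, Finset.prod_mul_distrib, Finset.prod_const, Finset.prod_const,
    ← Real.exp_sum, ← Real.exp_sum, mul_mul_mul_comm, ← Real.exp_add, Finset.card_compl,
    Fintype.card_fin, Finset.sum_neg_distrib, Finset.sum_neg_distrib, ← Finset.mul_sum,
    ← Finset.mul_sum, ← neg_add, ← mul_add]
  have := sub_nonneg.2 hq1
  gcongr
  exact sum_le_alignedGain hB hU i φ T

end Alignment

section Comparison

variable {M N : ℕ} {qB : Fin M → ℝ} {qU : Fin N → ℝ} {ρB ρU : ℝ}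

/-- Given the AODs `θ`, the beams are independent and identically distributed, so the transform is
`X θ ^ U`. The power mean inequality `(E X)^U ≤ E X^U` replaces the shared AODs by fresh ones for
each beam. -/
lemma sum_beams_pow (hqB : ∑ k, qB k = 1) (hqB0 : ∀ k, 0 ≤ qB k) (hB : ρB ^ 2 ≤ 1)
    (hU : ρU ^ 2 ≤ 1) (η U : ℕ) (i : Fin N) (φ : Fin η → Fin N) {a : ℝ} (ha : 0 ≤ a) :
    (∑ k, qB k * ∑ j ∈ Finset.range (η + 1), (η.choose j : ℝ) * qB k ^ j * (1 - qB k) ^ (η - j) *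
        Real.exp (-(a * alignedGain ρB ρU η j (Finset.univ.filter fun r => φ r = i).card))) ^ U ≤
      ∑ θ : Fin η → Fin M, ∑ k : Fin U → Fin M, (∏ r, qB (θ r)) * (∏ n, qB (k n)) *
        Real.exp (-(a * ∑ n, ∑ r, beamInner ρU i (φ r) ^ 2 * beamInner ρB (θ r) (k n) ^ 2)) := by
  have hqB1 : ∀ k, qB k ≤ 1 := fun k =>
    hqB ▸ Finset.single_le_sum (fun k _ => hqB0 k) (Finset.mem_univ k)
  set X : (Fin η → Fin M) → ℝ := fun θ => ∑ k, qB k *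
    Real.exp (-(a * ∑ r, beamInner ρU i (φ r) ^ 2 * beamInner ρB (θ r) k ^ 2)) with hX
  have h1 : ∑ θ : Fin η → Fin M, ∑ k : Fin U → Fin M, (∏ r, qB (θ r)) * (∏ n, qB (k n)) *
        Real.exp (-(a * ∑ n, ∑ r, beamInner ρU i (φ r) ^ 2 * beamInner ρB (θ r) (k n) ^ 2)) =
      ∑ θ : Fin η → Fin M, (∏ r, qB (θ r)) * X θ ^ U := by
    refine Finset.sum_congr rfl fun θ _ => ?_
    rw [hX, Fintype.sum_pow, Finset.mul_sum]
    refine Finset.sum_congr rfl fun k _ => ?_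
    rw [Finset.prod_mul_distrib, ← Real.exp_sum, Finset.sum_neg_distrib, ← Finset.mul_sum, mul_assoc]
  have h2 : ∑ θ : Fin η → Fin M, (∏ r, qB (θ r)) * X θ = ∑ k, qB k *
      ∏ r, (qB k * Real.exp (-(a * beamInner ρU i (φ r) ^ 2)) +
        (1 - qB k) * Real.exp (-(a * (beamInner ρU i (φ r) ^ 2 * ρB ^ 2)))) := by
    simp_rw [hX, Finset.mul_sum]
    rw [Finset.sum_comm]
    refine Finset.sum_congr rfl fun k _ => ?_
    have h3 : ∀ r, qB k * Real.exp (-(a * beamInner ρU i (φ r) ^ 2)) +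
        (1 - qB k) * Real.exp (-(a * (beamInner ρU i (φ r) ^ 2 * ρB ^ 2))) =
        ∑ x, qB x * Real.exp (-(a * (beamInner ρU i (φ r) ^ 2 * beamInner ρB x k ^ 2))) := fun r => by
      rw [sum_mul_beamInner hqB ρB k
        (fun y => Real.exp (-(a * (beamInner ρU i (φ r) ^ 2 * y ^ 2))))]
      simp
    simp_rw [h3]
    rw [Fintype.prod_sum, Finset.mul_sum]
    refine Finset.sum_congr rfl fun θ _ => ?_
    rw [Finset.prod_mul_distrib, ← Real.exp_sum, Finset.sum_neg_distrib, ← Finset.mul_sum]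
    ring
  rw [h1]
  refine le_trans ?_ (Real.pow_arith_mean_le_arith_mean_pow Finset.univ _ X
    (fun θ _ => Finset.prod_nonneg fun r _ => hqB0 _) (sum_pi_prod hqB)
    (fun θ _ => Finset.sum_nonneg fun k _ => mul_nonneg (hqB0 k) (Real.exp_pos _).le) U)
  rw [h2]
  refine pow_le_pow_left₀ (Finset.sum_nonneg fun k _ => mul_nonneg (hqB0 k)
    (Finset.sum_nonneg fun j _ => ?_)) (Finset.sum_le_sum fun k _ => ?_) U
  · have h4 := hqB0 k
    have h5 := sub_nonneg.2 (hqB1 k)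
    positivity
  · exact mul_le_mul_of_nonneg_left
      (sum_alignedGain_le_prod hB hU i φ (hqB0 k) (hqB1 k) ha) (hqB0 k)

/-- In the explicit sum the beams do not share AODs, so the transform is exactly a power. -/
lemma sum_aligned_eq_pow (η U m : ℕ) (a : ℝ) :
    ∑ k : Fin U → Fin M, ∑ j : Fin U → Fin (η + 1),
      (∏ n, (η.choose (j n) : ℝ) * qB (k n) ^ ((j n : ℕ) + 1) *
        (1 - qB (k n)) ^ (η - (j n : ℕ))) *
        Real.exp (-(a * ∑ n, alignedGain ρB ρU η (j n) m)) =
    (∑ k, qB k * ∑ j ∈ Finset.range (η + 1), (η.choose j : ℝ) * qB k ^ j * (1 - qB k) ^ (η - j) *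
        Real.exp (-(a * alignedGain ρB ρU η j m))) ^ U := by
  rw [Fintype.sum_pow]
  refine Finset.sum_congr rfl fun k _ => ?_
  simp_rw [Finset.sum_range, Finset.mul_sum]
  rw [Fintype.prod_sum]
  refine Finset.sum_congr rfl fun j _ => ?_
  rw [← Finset.sum_neg_distrib, Real.exp_sum, ← Finset.prod_mul_distrib]
  refine Finset.prod_congr rfl fun n _ => ?_
  ring

/-- Aligning the AODs independently for each beam, in the arrangement that maximises the
interference, decreases its Laplace transform. -/
lemma sum_aligned_le (hqB : ∑ k, qB k = 1) (hqB0 : ∀ k, 0 ≤ qB k) (hqU : ∑ k, qU k = 1)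
    (hqU0 : ∀ k, 0 ≤ qU k) (hB : ρB ^ 2 ≤ 1) (hU : ρU ^ 2 ≤ 1) (η U : ℕ) {a : ℝ} (ha : 0 ≤ a) :
    ∑ i, ∑ m ∈ Finset.range (η + 1), ∑ k : Fin U → Fin M, ∑ j : Fin U → Fin (η + 1),
      (η.choose m : ℝ) * qU i ^ (m + 1) * (1 - qU i) ^ (η - m) *
      (∏ n, (η.choose (j n) : ℝ) * qB (k n) ^ ((j n : ℕ) + 1) *
        (1 - qB (k n)) ^ (η - (j n : ℕ))) *
        Real.exp (-(a * ∑ n, alignedGain ρB ρU η (j n) m)) ≤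
    ∑ i, ∑ φ : Fin η → Fin N, ∑ θ : Fin η → Fin M, ∑ k : Fin U → Fin M,
      qU i * (∏ r, qU (φ r)) * ((∏ r, qB (θ r)) * ∏ n, qB (k n)) *
        Real.exp (-(a * ∑ n, ∑ r, beamInner ρU i (φ r) ^ 2 * beamInner ρB (θ r) (k n) ^ 2)) := by
  refine Finset.sum_le_sum fun i _ => ?_
  set G : ℕ → ℝ := fun m => (∑ k, qB k * ∑ j ∈ Finset.range (η + 1), (η.choose j : ℝ) * qB k ^ j *
    (1 - qB k) ^ (η - j) * Real.exp (-(a * alignedGain ρB ρU η j m))) ^ U with hG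
  calc _ = qU i * ∑ m ∈ Finset.range (η + 1),
        (η.choose m : ℝ) * qU i ^ m * (1 - qU i) ^ (η - m) * G m := by
        rw [Finset.mul_sum]
        refine Finset.sum_congr rfl fun m _ => ?_
        rw [hG]
        dsimp only
        rw [← sum_aligned_eq_pow, Finset.mul_sum, Finset.mul_sum]
        refine Finset.sum_congr rfl fun k _ => ?_
        rw [Finset.mul_sum, Finset.mul_sum]
        refine Finset.sum_congr rfl fun j _ => ?_
        ring
    _ = ∑ φ : Fin η → Fin N, qU i * (∏ r, qU (φ r)) *
        G (Finset.univ.filter fun r => φ r = i).card := by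
        rw [← sum_pi_card hqU i G, Finset.mul_sum]
        simp_rw [mul_assoc]
    _ ≤ _ := by
        refine Finset.sum_le_sum fun φ _ => ?_
        have h := mul_le_mul_of_nonneg_left (sum_beams_pow hqB hqB0 hB hU η U i φ ha)
          (mul_nonneg (hqU0 i) (Finset.prod_nonneg fun r (_ : r ∈ Finset.univ) => hqU0 (φ r)))
        refine h.trans (le_of_eq ?_)
        simp_rw [Finset.mul_sum, ← mul_assoc]

end Comparison

end

section

variable {NBS NUE : ℕ} (c : Params NBS NUE)

/-! ### Comparison of `Psi` and `PsiCS` -/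

lemma map_restrict_infinitePi {N : ℕ} (q : PMF (Fin N)) (n : ℕ) :
    (Measure.infinitePi fun _ : ℕ => q.toMeasure).map (fun φ (r : Fin n) => φ r) =
      Measure.pi fun _ : Fin n => q.toMeasure := by
  have hind : iIndepFun (fun (r : Fin n) (φ : ℕ → Fin N) => φ r)
      (Measure.infinitePi fun _ : ℕ => q.toMeasure) :=
    (iIndepFun_infinitePi (P := fun _ : ℕ => q.toMeasure) (X := fun _ x => x)
      (fun _ => measurable_id)).precomp Fin.val_injective
  have h := (iIndepFun_iff_map_fun_eq_pi_map
    (fun r : Fin n => (measurable_pi_apply (r : ℕ)).aemeasurable)).1 hind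
  rw [h]
  congr 1
  ext1 r
  exact (measurePreserving_eval_infinitePi (fun _ : ℕ => q.toMeasure) (r : ℕ)).map_eq

/-- The virtual angles that matter for a BS with `η` paths and `U` users, and the AOA of the service
link. -/
abbrev FiniteAngles (NBS NUE η U : ℕ) : Type :=
  Fin NUE × (Fin η → Fin NUE) × (Fin η → Fin NBS) × (Fin U → Fin NBS)

/-- The sum `∑_w ∑_j χ_{j,w}²`. -/
def angleGain (η U : ℕ) (x : FiniteAngles NBS NUE η U) : ℝ :=
  ∑ n, ∑ r, beamInner c.rhoUE x.1 (x.2.1 r) ^ 2 * beamInner c.rhoBS (x.2.2.1 r) (x.2.2.2 n) ^ 2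

/-- The probability of a configuration of angles. -/
def angleWeight (η U : ℕ) (x : FiniteAngles NBS NUE η U) : ℝ :=
  (c.qUE x.1).toReal * (∏ r, (c.qUE (x.2.1 r)).toReal) *
    ((∏ r, (c.qBS (x.2.2.1 r)).toReal) * ∏ n, (c.qBS (x.2.2.2 n)).toReal)

lemma PsiCS_eq_sum (s : ℝ) (η U : ℕ) (t : ℝ) : PsiCS c s η U t =
    ∑ x, angleWeight c η U x *
      ((1 + s * gain c * t⁻¹ / (η * U) * angleGain c η U x) ^ η)⁻¹ := by
  set R : Fin NUE × Angles NBS NUE → FiniteAngles NBS NUE η U :=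
    Prod.map id (Prod.map (fun φ r => φ r) (Prod.map (fun θ r => θ r) (fun k n => k n))) with hR
  have hm1 : Measurable fun (φ : ℕ → Fin NUE) (r : Fin η) => φ r := by fun_prop
  have hm2 : Measurable fun (θ : ℕ → Fin NBS) (r : Fin η) => θ r := by fun_prop
  have hm3 : Measurable fun (k : ℕ → Fin NBS) (n : Fin U) => k n := by fun_prop
  have hRm : Measurable R := measurable_id.prodMap (hm1.prodMap (hm2.prodMap hm3))
  have hmap : (c.qUE.toMeasure.prod (anglesLaw c)).map R =
      c.qUE.toMeasure.prod ((Measure.pi fun _ : Fin η => c.qUE.toMeasure).prod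
        ((Measure.pi fun _ : Fin η => c.qBS.toMeasure).prod
          (Measure.pi fun _ : Fin U => c.qBS.toMeasure))) := by
    rw [hR, anglesLaw, ← Measure.map_prod_map _ _ measurable_id (hm1.prodMap (hm2.prodMap hm3)),
      ← Measure.map_prod_map _ _ hm1 (hm2.prodMap hm3), ← Measure.map_prod_map _ _ hm2 hm3,
      map_restrict_infinitePi, map_restrict_infinitePi, map_restrict_infinitePi, Measure.map_id]
  have hint : ∀ z, psiIntegrand c s η U t z = (fun x : FiniteAngles NBS NUE η U =>
      ((1 + s * gain c * t⁻¹ / (η * U) * angleGain c η U x) ^ η)⁻¹) (R z) := by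
    intro z
    simp only [psiIntegrand, angleGain, hR, Prod.map_fst, Prod.map_snd, id, Finset.sum_range, chi,
      mul_pow]
  rw [PsiCS_eq]
  simp_rw [hint]
  rw [← integral_map (f := fun x : FiniteAngles NBS NUE η U =>
      ((1 + s * gain c * t⁻¹ / (η * U) * angleGain c η U x) ^ η)⁻¹) hRm.aemeasurable
    (measurable_of_finite _).aestronglyMeasurable, hmap,
    integral_fintype Integrable.of_finite]
  refine Finset.sum_congr rfl fun x _ => ?_
  obtain ⟨i, φ, θ, k⟩ := x
  have hq : ∀ {N : ℕ} (q : PMF (Fin N)) (x : Fin N), q.toMeasure {x} = q x := fun q x =>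
    PMF.toMeasure_apply_singleton _ _ (measurableSet_singleton x)
  have hw : (c.qUE.toMeasure.prod ((Measure.pi fun _ : Fin η => c.qUE.toMeasure).prod
        ((Measure.pi fun _ : Fin η => c.qBS.toMeasure).prod
          (Measure.pi fun _ : Fin U => c.qBS.toMeasure)))).real {(i, φ, θ, k)} =
      angleWeight c η U (i, φ, θ, k) := by
    rw [measureReal_def, ← Set.singleton_prod_singleton, ← Set.singleton_prod_singleton,
      ← Set.singleton_prod_singleton, Measure.prod_prod, Measure.prod_prod, Measure.prod_prod,
      Measure.pi_singleton, Measure.pi_singleton, Measure.pi_singleton]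
    simp only [hq, ENNReal.toReal_mul, ENNReal.toReal_prod, angleWeight]
    ring
  rw [hw, smul_eq_mul]

lemma sum_toReal {N : ℕ} (q : PMF (Fin N)) : ∑ i, (q i).toReal = 1 := by
  have h : ∑ i, q i = 1 := by rw [← q.tsum_coe, tsum_fintype]
  rw [← ENNReal.toReal_sum fun i _ => q.apply_ne_top i, h, ENNReal.toReal_one]

lemma sum_gain_eq (η U m : ℕ) (j : Fin U → Fin (η + 1)) :
    ∑ r ∈ Finset.Icc 1 η, (∑ n : Fin U, (c.rhoBS ^ 2 + if r ≤ (j n : ℕ) then 1 - c.rhoBS ^ 2 else 0)) *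
      (c.rhoUE ^ 2 + if r ≤ m then 1 - c.rhoUE ^ 2 else 0) =
      ∑ n, alignedGain c.rhoBS c.rhoUE η (j n) m := by
  simp_rw [alignedGain, Finset.sum_mul]
  exact Finset.sum_comm

/-- Once both sides are finite weighted sums of terms `(1 + C x)^{-η}` with the same `C`, the
comparison of Laplace transforms in `sum_aligned_le` is sufficient. -/
theorem Psi_le_PsiCS {s t : ℝ} (hs : 0 ≤ s) (ht : 0 < t) (η U : ℕ) :
    Psi c s η U t ≤ PsiCS c s η U t := by
  have hg := gain_nonneg c
  have hB : c.rhoBS ^ 2 ≤ 1 := pow_le_one₀ c.rhoBS_nonneg c.rhoBS_lt_one.le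
  have hU : c.rhoUE ^ 2 ≤ 1 := pow_le_one₀ c.rhoUE_nonneg c.rhoUE_lt_one.le
  have hC : 0 ≤ s * gain c * t⁻¹ / (η * U) := by positivity
  set S : Finset (Fin NUE × ℕ × (Fin U → Fin NBS) × (Fin U → Fin (η + 1))) :=
    Finset.univ ×ˢ Finset.range (η + 1) ×ˢ Finset.univ ×ˢ Finset.univ with hS
  set w : Fin NUE × ℕ × (Fin U → Fin NBS) × (Fin U → Fin (η + 1)) → ℝ := fun x =>
    (η.choose x.2.1 : ℝ) * (c.qUE x.1).toReal ^ (x.2.1 + 1) *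
      (1 - (c.qUE x.1).toReal) ^ (η - x.2.1) *
      ∏ n, (η.choose (x.2.2.2 n) : ℝ) * (c.qBS (x.2.2.1 n)).toReal ^ ((x.2.2.2 n : ℕ) + 1) *
        (1 - (c.qBS (x.2.2.1 n)).toReal) ^ (η - (x.2.2.2 n : ℕ)) with hw
  have hPsi : Psi c s η U t = ∑ x ∈ S, w x * ((1 + s * gain c * t⁻¹ / (η * U) *
      ∑ n, alignedGain c.rhoBS c.rhoUE η (x.2.2.2 n) x.2.1) ^ η)⁻¹ := by
    rw [hS, Finset.sum_product, Psi]
    refine Finset.sum_congr rfl fun i _ => ?_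
    rw [Finset.sum_product]
    refine Finset.sum_congr rfl fun m _ => ?_
    rw [Finset.sum_product, Finset.mul_sum]
    refine Finset.sum_congr rfl fun k _ => ?_
    rw [Finset.mul_sum]
    refine Finset.sum_congr rfl fun j _ => ?_
    rw [sum_gain_eq, ← mul_assoc]
  rw [hPsi, PsiCS_eq_sum]
  refine sum_mul_inv_pow_le S Finset.univ w _ (angleWeight c η U) (angleGain c η U)
    (fun x _ => Finset.sum_nonneg fun n _ => alignedGain_nonneg _ _ _ _ _)
    (fun x _ => Finset.sum_nonneg fun n _ => Finset.sum_nonneg fun r _ => by positivity)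
    (fun a ha => ?_) η hC
  have h := sum_aligned_le (sum_toReal c.qBS) (fun _ => ENNReal.toReal_nonneg) (sum_toReal c.qUE)
    (fun _ => ENNReal.toReal_nonneg) hB hU η U ha
  rw [hS]
  simp_rw [Finset.sum_product, Fintype.sum_prod_type]
  exact h

lemma tsum_mul_Psi_le {s t : ℝ} (hs : 0 ≤ s) (ht : 0 < t) (η : ℕ) :
    ∑' U, (c.pU U).toReal * Psi c s η U t ≤ ∑' U, (c.pU U).toReal * PsiCS c s η U t := by
  have hmem := fun U => PsiCS_mem c hs ht η U
  have hp : Summable fun U => (c.pU U).toReal :=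
    ENNReal.summable_toReal (by rw [c.pU.tsum_coe]; exact ENNReal.one_ne_top)
  have hsum : Summable fun U => (c.pU U).toReal * PsiCS c s η U t :=
    Summable.of_nonneg_of_le (fun U => mul_nonneg ENNReal.toReal_nonneg (hmem U).1)
      (fun U => mul_le_of_le_one_right ENNReal.toReal_nonneg (hmem U).2) hp
  -- The case distinction spares a proof of summability: a divergent series has value `0`, below the
  -- nonnegative right-hand side.
  by_cases h : Summable fun U => (c.pU U).toReal * Psi c s η U t
  · exact h.tsum_le_tsum (fun U => mul_le_mul_of_nonneg_left (Psi_le_PsiCS c hs ht η U)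
      ENNReal.toReal_nonneg) hsum
  · rw [tsum_eq_zero_of_not_summable h]
    exact tsum_nonneg fun U => mul_nonneg ENNReal.toReal_nonneg (hmem U).1

lemma sum_markDeficit_le_Psi {s t : ℝ} (hs : 0 ≤ s) (ht : 0 < t) (b : Bool) :
    ∑ i, c.qUE i * markDeficit c s i b t ≤
      ENNReal.ofReal (1 - ∑' U, (c.pU U).toReal * Psi c s (c.eta b) U t) :=
  (sum_markDeficit_le c hs ht b).trans
    (ENNReal.ofReal_le_ofReal (sub_le_sub_left (tsum_mul_Psi_le c hs ht (c.eta b)) 1))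

/-! ### Equiprobable virtual angles -/

theorem Psi_eq_PsiUniform (hUE : ∀ i, c.qUE i = (NUE : ℝ≥0∞)⁻¹) (hBS : ∀ i, c.qBS i = (NBS : ℝ≥0∞)⁻¹)
    (s : ℝ) (η U : ℕ) (t : ℝ) : Psi c s η U t = PsiUniform c s η U t := by
  have h1 : ∀ i, (c.qUE i).toReal = 1 / (NUE : ℝ) := fun i => by
    rw [hUE, ENNReal.toReal_inv, ENNReal.toReal_natCast, one_div]
  have h2 : ∀ i, (c.qBS i).toReal = 1 / (NBS : ℝ) := fun i => by
    rw [hBS, ENNReal.toReal_inv, ENNReal.toReal_natCast, one_div]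
  -- A `PMF` has total mass `1`, which rules out `NUE = 0`.
  have h3 : (NUE : ℝ) * (1 / NUE) = 1 := by
    have := sum_toReal c.qUE
    simpa [h1] using this
  have h4 : (NBS : ℝ) * (1 / NBS) = 1 := by
    have := sum_toReal c.qBS
    simpa [h2] using this
  rw [Psi, PsiUniform]
  simp_rw [h1, h2]
  rw [Finset.sum_const, Finset.card_univ, Fintype.card_fin, nsmul_eq_mul, Finset.mul_sum]
  refine Finset.sum_congr rfl fun m _ => ?_
  rw [Finset.sum_const, Finset.card_univ, Fintype.card_fun, Fintype.card_fin, Fintype.card_fin,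
    nsmul_eq_mul]
  push_cast
  have h5 : ∀ j : Fin U → Fin (η + 1), ∏ n, (η.choose (j n) : ℝ) * (1 / (NBS : ℝ)) ^ ((j n : ℕ) + 1) *
      (1 - 1 / (NBS : ℝ)) ^ (η - (j n : ℕ)) = (1 / (NBS : ℝ)) ^ U *
      ∏ n, (η.choose (j n) : ℝ) * (1 / (NBS : ℝ)) ^ (j n : ℕ) *
      (1 - 1 / (NBS : ℝ)) ^ (η - (j n : ℕ)) := by
    intro j
    have : (1 / (NBS : ℝ)) ^ U = ∏ _n : Fin U, 1 / (NBS : ℝ) := by simp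
    rw [this, ← Finset.prod_mul_distrib]
    refine Finset.prod_congr rfl fun n _ => ?_
    ring
  simp_rw [h5, mul_assoc, ← Finset.mul_sum]
  rw [← mul_assoc ((NBS : ℝ) ^ U), ← mul_pow, h4, one_pow, one_mul, pow_succ]
  linear_combination (η.choose m : ℝ) * (1 / (NUE : ℝ)) ^ m * (1 - 1 / (NUE : ℝ)) ^ (η - m) *
    (∑ j : Fin U → Fin (η + 1), (∏ n, (η.choose (j n) : ℝ) * ((1 / (NBS : ℝ)) ^ (j n : ℕ) *
      (1 - 1 / (NBS : ℝ)) ^ (η - (j n : ℕ)))) *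
      ((1 + s * (gain c * t⁻¹) / (η * U) * ∑ r ∈ Finset.Icc 1 η,
        (∑ n : Fin U, (c.rhoBS ^ 2 + if r ≤ (j n : ℕ) then 1 - c.rhoBS ^ 2 else 0)) *
        (c.rhoUE ^ 2 + if r ≤ m then 1 - c.rhoUE ^ 2 else 0)) ^ η)⁻¹) * h3

end

end MmWave

end

/-! ### The bounds assembled. -/

theorem mainTheorem9 {NBS NUE : ℕ} (c : MmWave.Params NBS NUE)
    {Ω : Type*} [MeasurableSpace Ω] (P : MeasureTheory.Measure Ω)
    [MeasureTheory.IsProbabilityMeasure P]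
    (Φ : Ω → Set (MmWave.Station NBS NUE)) (φ₀ : Ω → Fin NUE)
    (hnet : MmWave.IsNetwork P c Φ φ₀) (s : ℝ) (hs : 0 ≤ s) :
    (∀ᵐ l ∂(P.map fun ω => MmWave.servingLoss c (Φ ω)),
      -- upper bound
      MmWave.condLaplace P c Φ φ₀ s l ≤
        MmWave.expNeg ((1 - c.pU 0) * MmWave.upperExponent c s l) ∧
      (c.pU 0 = 0 → MmWave.condLaplace P c Φ φ₀ s l ≤
        MmWave.expNeg (MmWave.upperExponent c s l)) ∧
      -- lower bound with the expectation over the angles that Cauchy-Schwarz gives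
      MmWave.expNeg (MmWave.lowerExponent c (MmWave.PsiCS c s) true l) *
        MmWave.expNeg (MmWave.lowerExponent c (MmWave.PsiCS c s) false l) ≤
          MmWave.condLaplace P c Φ φ₀ s l ∧
      -- lower bound with the explicit sum
      MmWave.expNeg (MmWave.lowerExponent c (MmWave.Psi c s) true l) *
        MmWave.expNeg (MmWave.lowerExponent c (MmWave.Psi c s) false l) ≤
          MmWave.condLaplace P c Φ φ₀ s l) ∧
    -- the explicit sum for equiprobable virtual angles
    ((∀ i, c.qUE i = (NUE : ℝ≥0∞)⁻¹) → (∀ i, c.qBS i = (NBS : ℝ≥0∞)⁻¹) →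
      ∀ (η U : ℕ) (t : ℝ), MmWave.Psi c s η U t = MmWave.PsiUniform c s η U t) := by
  refine ⟨?_, fun hUE hBS η U t => MmWave.Psi_eq_PsiUniform c hUE hBS s η U t⟩
  filter_upwards [hnet.condLaplace_ae_eq hs] with l hl
  have hup : MmWave.condLaplace P c Φ φ₀ s l ≤
      MmWave.expNeg ((1 - c.pU 0) * MmWave.upperExponent c s l) := by
    rw [hl]
    refine (Finset.sum_le_sum fun i _ =>
      mul_le_mul_right (MmWave.laplaceBeyond_le c hs i l) (c.qUE i)).trans (le_of_eq ?_)
    have h : ∑ i, c.qUE i = 1 := by rw [← c.qUE.tsum_coe, tsum_fintype]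
    rw [← Finset.sum_mul, h, one_mul]
  refine ⟨hup, fun h0 => ?_, ?_, ?_⟩
  · simpa [h0] using hup
  · rw [hl]
    exact MmWave.le_sum_laplaceBeyond c l fun b t ht => MmWave.sum_markDeficit_le c hs ht b
  · rw [hl]
    exact MmWave.le_sum_laplaceBeyond c l fun b t ht => MmWave.sum_markDeficit_le_Psi c hs ht b
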